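/- Let $\Lambda$ be a regular local ring and let $\mathcal{R} \supseteq \Lambda$ be a commutative ring that is free of finite rank as a $\Lambda$-module, such that $\operatorname{Hom}_\Lambda(\mathcal{R},\Lambda) \simeq \mathcal{R}$ as $\mathcal{R}$-modules. An $\mathcal{R}$-module $M$ is called pseudo-null if $M_{\mathfrak{q}} = 0$ for all primes $\mathfrak{q}$ of $\mathcal{R}$ of height at most $1$, and $M_{\mathrm{tor}}$ denotes the submodule of elements of $M$ killed by a non-zero-divisor of $\mathcal{R}$. Let $C$ be a perfect complex over $\mathcal{R}$ such that $H^i(C)$ is pseudo-null for every $i \neq 1$. Choose a bounded complex $P$ of finitely generated projective $\mathcal{R}$-modules quasi-isomorphic to $C$, and let $a \le 1 \le b$ be such that $P^i = 0$ for $i \notin [a,b]$. Put $$l = \chi_{\mathcal{R}}(C) = \sum_i (-1)^{i-1}\operatorname{rank}(P^i), \qquad \operatorname{Det}_{\mathcal{R}}(C) = \bigotimes_{i=a}^{b} \det(P^i)^{(-1)^i}, \qquad \operatorname{Det}^{-1}_{\mathcal{R}}(C) = \operatorname{Hom}_{\mathcal{R}}(\operatorname{Det}_{\mathcal{R}}(C),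 \mathcal{R}),$$ where $\det F = \bigwedge^{\operatorname{rank} F} F$ and $\det^{-1} F$ is its linear dual. Ranks and $l$ are locally constant functions on $\operatorname{Spec} \mathcal{R}$, and exterior powers with such exponents are taken componentwise. Then $l \geq 0$, and there is a unique $\mathcal{R}$-linear map $$\Psi_C : \bigwedge\nolimits^l_{\mathcal{R}} H^1(C) \to \operatorname{Det}^{-1}_{\mathcal{R}}(C)$$ which, over the total ring of fractions $Q$ of $\mathcal{R}$, becomes the canonical isomorphism $\bigwedge^l H^1(Q\otimes C) \simeq \operatorname{Det}_Q^{-1}(Q \otimes C)$ (the complex $Q\otimes C$ has cohomology in degree $1$ only). Explicitly, $\Psi_C$ is characterized as follows. Let $r_i \ge 0$ be the locally constant functions with $r_i = 0$ for $i<a$ and for $i \ge b$, with $r_{i-1}+r_i = \operatorname{rank} P^i$ for $i \ne 1$, and with $r_0 + l + r_1 = \operatorname{rank} P^1$. Let $x_i \in \bigwedge^{r_i} P^i$ be arbitrary elements with $x_i = 1$ for $i < a$ and for $i \geq b$, and let $y \in \bigwedge^l \ker(P^1 \to P^2)$ have image $\eta \in \bigwedge^l H^1(C)$. Put $u_i =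 d x_{i-1}\wedge x_i \in \det P^i$ for $i\neq 1$ and $u_1 = d x_0 \wedge y \wedge x_1 \in \det P^1$. Then for all $\theta_i \in (\det P^i)^*$ ($i$ odd), $$\Psi_C(\eta)\Big(\bigotimes_{i \text{ even}} u_i \otimes \bigotimes_{i \text{ odd}} \theta_i\Big) = \prod_{i \text{ odd}} \theta_i(u_i), \qquad i \in [a,b].$$ Moreover, $\Psi_C$ is the reflexive hull of $\bigwedge^l_{\mathcal{R}} H^1(C)$ (that is, its target is reflexive, its kernel is $\big(\bigwedge^l_{\mathcal{R}} H^1(C)\big)_{\mathrm{tor}}$, and its cokernel is pseudo-null) if and only if $H^1(C)_{\mathrm{tor}}$ is pseudo-null. -/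

import Mathlib

open scoped TensorProduct

universe u v

namespace PerfectDet

section Modules

variable (R : Type u) [CommRing R]

/-- The exterior power `⋀^ρ M` for an exponent `ρ` which is a function on `Spec R`
(a locally constant one in all uses): the elements of the exterior algebra which, locally at each
prime `𝔭`, are homogeneous of degree `ρ 𝔭`. For a constant function `ρ = n` this is `⋀^n M`
(see `extPow_const`); in general, if `R = ∏ Rᵢ` with `ρ` constant equal to `nᵢ` on `Spec Rᵢ`, it is
the product of the modules `⋀^nᵢ (Rᵢ ⊗ M)`. -/
def extPow (M : Type u) [AddCommGroup M] [Module R M] (ρ : PrimeSpectrum R → ℕ) :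
    Submodule R (ExteriorAlgebra R M) where
  carrier := {x | ∀ 𝔭 : PrimeSpectrum R, ∃ s : R, s ∉ 𝔭.asIdeal ∧ s • x ∈ ⋀[R]^(ρ 𝔭) M}
  zero_mem' := fun 𝔭 => ⟨1, 𝔭.asIdeal.primeCompl.one_mem, by simp⟩
  add_mem' := by
    intro x y hx hy 𝔭
    obtain ⟨s, hs, hsx⟩ := hx 𝔭
    obtain ⟨t, ht, hty⟩ := hy 𝔭
    refine ⟨s * t, 𝔭.asIdeal.primeCompl.mul_mem hs ht, ?_⟩
    rw [smul_add]
    refine Submodule.add_mem _ ?_ ?_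
    · rw [mul_comm, mul_smul]
      exact Submodule.smul_mem _ _ hsx
    · rw [mul_smul]
      exact Submodule.smul_mem _ _ hty
  smul_mem' := by
    intro c x hx 𝔭
    obtain ⟨s, hs, hsx⟩ := hx 𝔭
    refine ⟨s, hs, ?_⟩
    rw [smul_comm]
    exact Submodule.smul_mem _ _ hsx

theorem extPow_const (M : Type u) [AddCommGroup M] [Module R M] (n : ℕ) :
    extPow R M (fun _ => n) = ⋀[R]^n M := by
  apply le_antisymm
  · intro x hx
    let I : Ideal R := (⋀[R]^n M).colon {x}
    have hI : I = ⊤ := by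
      by_contra h
      obtain ⟨m, hm, hle⟩ := Ideal.exists_le_maximal I h
      obtain ⟨s, hs, hsx⟩ := hx ⟨m, hm.isPrime⟩
      exact hs (hle (Submodule.mem_colon_singleton.2 hsx))
    have h1 : (1 : R) ∈ I := hI ▸ Submodule.mem_top
    simpa using Submodule.mem_colon_singleton.1 h1
  · intro x hx 𝔭
    exact ⟨1, 𝔭.asIdeal.primeCompl.one_mem, by simpa using hx⟩

/-- The determinant `det F = ⋀^{rank F} F` of a finitely generated projective module, where the
rank is the (locally constant) rank function on `Spec R`. -/
noncomputable abbrev detMod (F : Type u) [AddCommGroup F] [Module R F] : Submodule R (ExteriorAlgebra R F) :=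
  extPow R F (Module.rankAtStalk (R := R) F)

/-- `M` is pseudo-null: `M_𝔮 = 0` for every prime ideal `𝔮` of `R` of height at most one. -/
def IsPseudoNull (M : Type u) [AddCommGroup M] [Module R M] : Prop :=
  ∀ (𝔮 : Ideal R) [𝔮.IsPrime], 𝔮.height ≤ 1 → Subsingleton (LocalizedModule 𝔮.primeCompl M)

variable {R}

/-- `f : M → N` is the reflexive hull of `M`: `N` is reflexive, the kernel of `f` is the torsion
submodule of `M` (elements killed by a non-zero-divisor of `R`) and the cokernel is pseudo-null. -/
def IsReflexiveHull {M N : Type u} [AddCommGroup M] [Module R M] [AddCommGroup N] [Module R N]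
    (f : M →ₗ[R] N) : Prop :=
  Module.IsReflexive R N ∧ LinearMap.ker f = Submodule.torsion R M ∧
    IsPseudoNull R (N ⧸ LinearMap.range f)

end Modules

/-- `Hom_Λ(R, Λ) ≃ R` as `R`-modules, where `R` acts on `Hom_Λ(R, Λ)` by `(a φ)(x) = φ (a x)`. -/
def IsSelfDual (Λ : Type v) (R : Type u) [CommRing Λ] [CommRing R] [Algebra Λ R] : Prop :=
  ∃ e : (R →ₗ[Λ] Λ) ≃+ R, ∀ (a : R) (φ : R →ₗ[Λ] Λ), e (φ ∘ₗ LinearMap.mulLeft Λ a) = a * e φ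

section Complexes

open CategoryTheory

variable {R : Type u} [CommRing R]

/-- A perfect representative of a complex `C`: a bounded complex `P` of finitely generated
projective modules, concentrated in degrees `a, …, b`, with a quasi-isomorphism to `C`.
(As `P` is bounded with projective terms, every isomorphism `P ≅ C` in the derived category comes
from such a quasi-isomorphism; enlarging `[a, b]` one may always assume that it contains `1`.) -/
structure PerfectRep (C : CochainComplex (ModuleCat.{u} R) ℤ) where
  P : CochainComplex (ModuleCat.{u} R) ℤ
  a : ℤ
  b : ℤ
  a_le : a ≤ 1
  le_b : 1 ≤ b
  finite : ∀ i, Module.Finite R (P.X i)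
  projective : ∀ i, Module.Projective R (P.X i)
  isZero : ∀ i, i ∉ Finset.Icc a b → Limits.IsZero (P.X i)
  φ : P ⟶ C
  quasiIso : QuasiIso φ

namespace PerfectRep

variable {C : CochainComplex (ModuleCat.{u} R) ℤ} (S : PerfectRep C)

/-- The Euler characteristic `χ(C) = ∑ᵢ (-1)^(i-1) rank(Pⁱ)`, a function on `Spec R`. -/
noncomputable def euler (𝔭 : PrimeSpectrum R) : ℤ :=
  ∑ i ∈ Finset.Icc S.a S.b, ((i - 1).negOnePow : ℤ) * Module.rankAtStalk (R := R) (S.P.X i) 𝔭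

/-- `⋀^l H¹(C)` with `l = χ(C)`. (Used only where `χ(C) ≥ 0`.) -/
noncomputable abbrev extH1 : Submodule R (ExteriorAlgebra R (C.homology 1)) :=
  extPow R (C.homology 1) (fun 𝔭 => (S.euler 𝔭).toNat)

/-- The even degrees in `[a, b]`. -/
noncomputable abbrev evens : Finset ℤ := (Finset.Icc S.a S.b).filter Even

/-- The odd degrees in `[a, b]`. -/
noncomputable abbrev odds : Finset ℤ := (Finset.Icc S.a S.b).filter Odd

/-- The determinant module `Det(C) = ⨂ᵢ det(Pⁱ)^((-1)^i)`, where `det⁻¹` is the linear dual of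
`det`; the factors of even degree are written first. -/
noncomputable abbrev Det : Type u :=
  (⨂[R] i : S.evens, detMod R (S.P.X i)) ⊗[R] (⨂[R] i : S.odds, Module.Dual R (detMod R (S.P.X i)))

/-- `Det⁻¹(C)`, the linear dual of `Det(C)`. -/
noncomputable abbrev DetInv : Type u := Module.Dual R S.Det

/-- `Ψ` is the canonical map `⋀^l H¹(C) → Det⁻¹(C)`, `l = χ(C)`, i.e. the restriction of the
canonical isomorphism `⋀^l H¹(Q ⊗ C) ≃ Det⁻¹(Q ⊗ C)`, where `Q` is the total ring of fractions and
`Q ⊗ C` has cohomology only in degree `1`. With denominators cleared, this isomorphism is described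
as follows.

Let `rᵢ` be the generic rank of `d : Pⁱ → Pⁱ⁺¹`; the `rᵢ` are determined by
`rᵢ₋₁ + rᵢ = rank Pⁱ` for `i ≠ 1` and `r₀ + l + r₁ = rank P¹`. Take any `xᵢ ∈ ⋀^rᵢ Pⁱ`
(with `xᵢ = 1` for `i < a` and for `i ≥ b`), and let `y ∈ ⋀^l Z¹` be a lift of
`η ∈ ⋀^l H¹(C)`, where `Z¹ ⊆ P¹` is the module of cocycles. Put
`uᵢ = d xᵢ₋₁ ∧ xᵢ ∈ det Pⁱ` for `i ≠ 1` and `u₁ = d x₀ ∧ y ∧ x₁ ∈ det P¹`. Then for all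
`θᵢ ∈ (det Pⁱ)^*` (`i` odd), `Ψ(η)` sends `(⨂_{i even} uᵢ) ⊗ (⨂_{i odd} θᵢ)` to
`∏_{i odd} θᵢ(uᵢ)`.

For `C = [P⁰ → P¹]` with injective differential `α` this is the map
`β(y₁) ∧ ⋯ ∧ β(y_l) ↦ (x ⊗ θ ↦ θ(α x ∧ y₁ ∧ ⋯ ∧ y_l))`, with `β : P¹ → H¹(C)` the projection. -/
def IsPsi (Ψ : S.extH1 →ₗ[R] S.DetInv) : Prop :=
  ∀ (r : ℤ → PrimeSpectrum R → ℕ)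
    (x : ∀ i : ℤ, ExteriorAlgebra R (S.P.X i))
    (y : ExteriorAlgebra R (S.P.cycles 1))
    (η : S.extH1)
    (u : ∀ i : ℤ, detMod R (S.P.X i))
    (θ : ∀ i : ℤ, Module.Dual R (detMod R (S.P.X i))),
    (∀ i, i ∉ Finset.Ico S.a S.b → r i = 0) →
    (∀ i, i ≠ 1 → ∀ 𝔭, r (i - 1) 𝔭 + r i 𝔭 = Module.rankAtStalk (R := R) (S.P.X i) 𝔭) →
    (∀ 𝔭, (r 0 𝔭 : ℤ) + S.euler 𝔭 + r 1 𝔭 = Module.rankAtStalk (R := R) (S.P.X 1) 𝔭) →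
    (∀ i, x i ∈ extPow R (S.P.X i) (r i)) →
    (∀ i, i ∉ Finset.Ico S.a S.b → x i = 1) →
    y ∈ extPow R (S.P.cycles 1) (fun 𝔭 => (S.euler 𝔭).toNat) →
    ExteriorAlgebra.map
      (S.P.homologyπ 1 ≫ HomologicalComplex.homologyMap S.φ 1).hom y = (η : ExteriorAlgebra R _) →
    (∀ i, i ≠ 1 → (u i : ExteriorAlgebra R (S.P.X i)) =
      ExteriorAlgebra.map (S.P.d (i - 1) i).hom (x (i - 1)) * x i) →
    (u 1 : ExteriorAlgebra R (S.P.X 1)) =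
      ExteriorAlgebra.map (S.P.d 0 1).hom (x 0) *
        ExteriorAlgebra.map (S.P.iCycles 1).hom y * x 1 →
    Ψ η ((PiTensorProduct.tprod R fun i : S.evens => u i) ⊗ₜ[R]
        (PiTensorProduct.tprod R fun i : S.odds => θ i)) =
      ∏ i : S.odds, θ i (u i)

end PerfectRep

end Complexes

end PerfectDet

namespace PerfectDet

/-! ### Regular local rings: they are domains and satisfy Serre's condition S₂. -/

section RegularLocal

open IsLocalRing

/-! The ring `R` satisfies Serre's conditions S₁ and S₂ (`SerreTwo`), because it is finite free over
a regular local ring. S₁ lets an identity in `R`, or in a projective module, be checked at the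
minimal primes. S₂ lets divisibility by a non-zero-divisor be checked at the primes of height at
most one. Everything is reduced to such primes `q`, where "at `q`" means after multiplication by
some `s ∉ q`.

At such a `q` the localized complex is a bounded complex of free modules, exact outside degree `1`,
over a local ring of depth at most one. An Auslander–Buchsbaum type argument shows that all images
of differentials are free; the only cokernel of a differential into degree at most `1` that may fail
to be free is that of `P⁰ → P¹`, and it is free exactly when `H¹` has no torsion at `q`. So there
are families `xᵢ` adapted to `q` for which `uᵢ = d xᵢ₋₁ ∧ xᵢ` generates `det Pⁱ` at `q` for all `i ≠
1`, in particular in all even degrees. The same local picture at the minimal primes gives the rank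
functions `rᵢ`, and telescoping gives `l = χ(C) ≥ 0`.

For functionals `θᵢ` in even degrees, the map must satisfy (∏ even `θᵢ(uᵢ)`) · `Ψ(η)(w ⊗ ε)` = (∏
even `θᵢ`)(`w`) · `ε`(⊗ odd `uᵢ`) for every admissible family `x`. This is a linear system for the
value of `Ψ(η)`, with one equation for each pair `(x, θ)`. It has at most one solution because the
coefficients do not all vanish at any minimal prime. Compatibility of the equations is the exchange
relation `RankData.mixedProd_comm`: at a minimal prime the image of `⋀^rᵢ Pⁱ` in `⋀^rᵢ Pⁱ⁺¹` has
rank one, so `xᵢ` and `xᵢ'` may be interchanged between two neighbouring factors. An adapted family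
solves the system at each `q` of height at most one, and `SerreTwo.exists_glue` turns these local
solutions into one in `R`.

If `H¹` is torsion free at `q`, then `u₁` can be made a generator as well and `Ψ` is surjective at
`q`; at minimal primes this is automatic, and it identifies the kernel of `Ψ` with the torsion.
Conversely, if `Ψ` is surjective at `q`, some value `θ₁(d x₀ ∧ y ∧ x₁)` is a unit there. Then
vectors spanning the image of `P⁰` extend to a basis of `P¹` at `q`, and by Cramer's rule `H¹` has
no torsion at `q`. -/

theorem exists_finset_span_quotient {Λ : Type v} [CommRing Λ] [IsLocalRing Λ] [IsNoetherianRing Λ]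
    {x : Λ} (hx : x ∈ maximalIdeal Λ) (hx2 : x ∉ maximalIdeal Λ ^ 2) :
    ((maximalIdeal Λ).map (Ideal.Quotient.mk (Ideal.span {x}))).spanFinrank + 1 ≤
      (maximalIdeal Λ).spanFinrank := by
  classical
  obtain ⟨s, hs, hspan⟩ := (IsNoetherian.noetherian (maximalIdeal Λ)).exists_span_finset_card_eq_spanFinrank
  have hxs : x ∈ Submodule.span Λ (s : Set Λ) := by rw [hspan]; exact hx
  obtain ⟨f, -, hf⟩ := Submodule.mem_span_finset.1 hxs
  have hsm : ∀ a ∈ s, a ∈ maximalIdeal Λ := fun a ha => by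
    rw [← hspan]; exact Submodule.subset_span ha
  -- An expression of `x` in a minimal generating set with all coefficients in the maximal ideal
  -- would put `x` in its square. The generator with a unit coefficient becomes redundant modulo
  -- `x`.
  obtain ⟨a, ha, hfa⟩ : ∃ a ∈ s, f a ∉ maximalIdeal Λ := by
    by_contra! h
    apply hx2
    rw [← hf, pow_two]
    exact Ideal.sum_mem _ fun a ha => Ideal.mul_mem_mul (h a ha) (hsm a ha)
  have hu : IsUnit (f a) := by simpa using hfa
  have key : (maximalIdeal Λ).map (Ideal.Quotient.mk (Ideal.span {x})) ≤
      Submodule.span _ (((s.erase a).image (Ideal.Quotient.mk (Ideal.span {x})) : Finset _) : Set _) := by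
    rw [Ideal.map_le_iff_le_comap, ← hspan]
    refine Submodule.span_le.2 fun b hb => ?_
    have hmem : ∀ c ∈ s.erase a, Ideal.Quotient.mk (Ideal.span {x}) c ∈
        Ideal.span (((s.erase a).image (Ideal.Quotient.mk (Ideal.span {x})) : Finset _) : Set _) :=
      fun c hc => Ideal.subset_span (by exact_mod_cast Finset.mem_image_of_mem _ hc)
    by_cases hba : b = a
    · subst hba
      have h0 : Ideal.Quotient.mk (Ideal.span {x}) (∑ a ∈ s, f a • a) = 0 := by
        rw [hf]; exact Ideal.Quotient.eq_zero_iff_mem.2 (Ideal.mem_span_singleton_self x)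
      rw [← Finset.add_sum_erase _ _ ha, map_add, smul_eq_mul, map_mul] at h0
      have h1 := eq_neg_of_add_eq_zero_left h0
      have : (Ideal.Quotient.mk (Ideal.span {x})) (f b) * (Ideal.Quotient.mk (Ideal.span {x})) b ∈
        Ideal.span (((s.erase b).image (Ideal.Quotient.mk (Ideal.span {x})) : Finset _) : Set _) := by
        rw [h1, map_sum]
        refine Ideal.neg_mem_iff _ |>.2 (Ideal.sum_mem _ fun c hc => ?_)
        rw [smul_eq_mul, map_mul]
        exact Ideal.mul_mem_left _ _ (hmem c hc)
      exact (Ideal.unit_mul_mem_iff_mem (Ideal.span _)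
        (hu.map (Ideal.Quotient.mk (Ideal.span {x})))).1 this
    · exact hmem b (Finset.mem_erase.2 ⟨hba, hb⟩)
  have hsub : ∀ y ∈ (s.erase a).image (Ideal.Quotient.mk (Ideal.span {x})),
      y ∈ (maximalIdeal Λ).map (Ideal.Quotient.mk (Ideal.span {x})) := by
    intro y hy
    obtain ⟨c, hc, rfl⟩ := Finset.mem_image.1 hy
    exact Ideal.mem_map_of_mem _ (hsm c (Finset.mem_of_mem_erase hc))
  have heq := le_antisymm key (Submodule.span_le.2 hsub)
  rw [heq]
  calc _ ≤ ((s.erase a).image (Ideal.Quotient.mk (Ideal.span {x}))).card + 1 := by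
        gcongr
        exact (Submodule.spanFinrank_span_le_ncard_of_finite (Finset.finite_toSet _)).trans
          (by rw [Set.ncard_coe_finset])
    _ ≤ (s.erase a).card + 1 := by gcongr; exact Finset.card_image_le
    _ = s.card := Finset.card_erase_add_one ha
    _ = _ := hs

/-- Passing to the quotient lowers the number of generators of the maximal ideal by at least one,
and its height by at most one. -/
theorem quotient_regular {Λ : Type v} [CommRing Λ] [IsRegularLocalRing Λ]
    {x : Λ} (hx : x ∈ maximalIdeal Λ) (hx2 : x ∉ maximalIdeal Λ ^ 2) :
    ∃ _ : IsRegularLocalRing (Λ ⧸ Ideal.span {x}),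
      (maximalIdeal (Λ ⧸ Ideal.span {x})).spanFinrank < (maximalIdeal Λ).spanFinrank := by
  have hne : Ideal.span {x} ≠ ⊤ := fun h => by
    have := (Ideal.span_singleton_le_iff_mem _).2 hx
    rw [h] at this
    exact (maximalIdeal.isMaximal Λ).ne_top (top_le_iff.1 this)
  have : Nontrivial (Λ ⧸ Ideal.span {x}) := Ideal.Quotient.nontrivial_iff.2 hne
  have hloc : IsLocalRing (Λ ⧸ Ideal.span {x}) :=
    IsLocalRing.of_surjective' (Ideal.Quotient.mk _) Ideal.Quotient.mk_surjective
  have hmax : (maximalIdeal Λ).map (Ideal.Quotient.mk (Ideal.span {x})) =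
      maximalIdeal (Λ ⧸ Ideal.span {x}) := by
    refine le_antisymm ?_ ?_
    · rw [Ideal.map_le_iff_le_comap]
      intro y hy
      rw [Ideal.mem_comap, mem_maximalIdeal, mem_nonunits_iff]
      intro hu
      have hsurj : Function.Surjective (Ideal.Quotient.mk (Ideal.span {x})) :=
        Ideal.Quotient.mk_surjective
      have := (IsLocalHom.of_surjective _ hsurj).map_nonunit y hu
      exact hy this
    · intro y hy
      obtain ⟨y, rfl⟩ := Ideal.Quotient.mk_surjective y
      refine Ideal.mem_map_of_mem _ ?_
      rw [mem_maximalIdeal, mem_nonunits_iff] at hy ⊢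
      exact fun hu => hy (hu.map _)
  have h1 := exists_finset_span_quotient hx hx2
  rw [hmax] at h1
  refine ⟨IsRegularLocalRing.of_spanFinrank_maximalIdeal_le _ ?_, h1⟩
  have h2 := Ideal.height_le_height_add_one_of_mem hx
  rw [hmax] at h2
  have hd : (maximalIdeal Λ).height = ((maximalIdeal Λ).spanFinrank : ℕ∞) := by
    have := maximalIdeal_height_eq_ringKrullDim (R := Λ)
    rw [← IsRegularLocalRing.spanFinrank_maximalIdeal] at this
    exact_mod_cast this
  rw [← maximalIdeal_height_eq_ringKrullDim]
  rw [hd] at h2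
  have h3 : (((maximalIdeal (Λ ⧸ Ideal.span {x})).spanFinrank : ℕ) : ℕ∞) + 1 ≤
      (maximalIdeal (Λ ⧸ Ideal.span {x})).height + 1 := le_trans (by exact_mod_cast h1) h2
  have h4 := (ENat.add_le_add_iff_right (ENat.natCast_ne_top 1)).1 h3
  exact_mod_cast h4

theorem isDomain_of_regular (n : ℕ) : ∀ (Λ : Type v) [CommRing Λ] [IsRegularLocalRing Λ],
    (maximalIdeal Λ).spanFinrank = n → IsDomain Λ := by
  induction n using Nat.strong_induction_on with
  | _ n ih =>
  intro Λ _ _ hn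
  have hdim := IsRegularLocalRing.spanFinrank_maximalIdeal (R := Λ)
  rcases Nat.eq_zero_or_pos n with h0 | hpos
  · have hbot : maximalIdeal Λ = ⊥ := by
      rw [← Submodule.spanFinrank_eq_zero_iff_eq_bot (IsNoetherian.noetherian (maximalIdeal Λ)), hn, h0]
    exact (IsLocalRing.isField_iff_maximalIdeal_eq.2 hbot).isDomain
  have hmin : ∀ p ∈ minimalPrimes Λ, ¬ maximalIdeal Λ ≤ p := by
    intro p hp hle
    have hpp : p.IsPrime := hp.1.1
    have h1 : p.height = 0 := Ideal.height_eq_zero_iff.2 hp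
    have h2 := Ideal.height_mono hle
    rw [h1] at h2
    have h3 := maximalIdeal_height_eq_ringKrullDim (R := Λ)
    rw [← hdim, hn, le_zero_iff.1 h2] at h3
    have : (0 : ℕ) = n := by exact_mod_cast h3
    omega
  have hsq : ¬ maximalIdeal Λ ≤ maximalIdeal Λ ^ 2 := by
    intro hle
    have : maximalIdeal Λ = ⊥ := by
      refine Submodule.eq_bot_of_le_smul_of_le_jacobson_bot (maximalIdeal Λ) _
        (IsNoetherian.noetherian _) ?_ (by rw [jacobson_eq_maximalIdeal _ bot_ne_top])
      rwa [smul_eq_mul, ← pow_two]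
    rw [this] at hn
    simp at hn
    omega
  -- Prime avoidance tolerates the one ideal in the list that is not prime, the square of the
  -- maximal ideal.
  obtain ⟨x, hx, hx'⟩ : ∃ x ∈ maximalIdeal Λ, ∀ I ∈ insert (maximalIdeal Λ ^ 2) (minimalPrimes Λ), x ∉ I := by
    by_contra! h
    have hfin : (insert (maximalIdeal Λ ^ 2) (minimalPrimes Λ)).Finite :=
      (minimalPrimes.finite_of_isNoetherianRing Λ).insert _
    have := (Ideal.subset_union_prime_finite (f := fun I : Ideal Λ => I) hfin (maximalIdeal Λ ^ 2) (maximalIdeal Λ ^ 2)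
      (I := maximalIdeal Λ) (fun I hI h1 _ => (hI.resolve_left h1).1.1)).1 (fun x hx => by
        obtain ⟨I, hI, hxI⟩ := h x hx
        exact Set.mem_biUnion hI hxI)
    obtain ⟨I, hI, hle⟩ := this
    rcases hI with rfl | hI
    · exact hsq hle
    · exact hmin I hI hle
  obtain ⟨hreg, hlt⟩ := quotient_regular hx (hx' _ (Set.mem_insert _ _))
  have hdom := ih _ (hn ▸ hlt) (Λ ⧸ Ideal.span {x}) rfl
  have hxp : (Ideal.span {x}).IsPrime := (Ideal.Quotient.isDomain_iff_prime _).1 hdom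
  obtain ⟨p, hp, hle⟩ := Ideal.exists_minimalPrimes_le (I := ⊥) (J := Ideal.span {x}) bot_le
  have hpp : p.IsPrime := hp.1.1
  have hxnp : x ∉ p := hx' p (Set.mem_insert_of_mem _ hp)
  -- By induction `x` generates a prime ideal, and it contains `p`. Since `x ∉ p`, every element of
  -- `p` is `x` times an element of `p`, and Nakayama applies.
  have hpbot : p = ⊥ := by
    refine Submodule.eq_bot_of_le_smul_of_le_jacobson_bot (maximalIdeal Λ) _
        (IsNoetherian.noetherian _) ?_ (by rw [jacobson_eq_maximalIdeal _ bot_ne_top])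
    intro y hy
    obtain ⟨z, rfl⟩ := Ideal.mem_span_singleton.1 (hle hy)
    exact Submodule.smul_mem_smul hx ((hpp.mem_or_mem hy).resolve_left hxnp)
  rw [hpbot] at hpp
  exact IsDomain.of_bot_isPrime Λ

/-- Condition S₂: principal ideals have no associated primes of height two or more. If `a ∤ b`, some
associated prime `P = (a : c)` lies in no prime of height at most one. Elements `x` of the maximal
ideal outside its square are prime, so they serve both for a depth argument and for induction on the
dimension through `Λ/x`. -/
theorem dvd_of_codim_one_of_regular (n : ℕ) : ∀ (Λ : Type v) [CommRing Λ] [IsRegularLocalRing Λ],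
    (maximalIdeal Λ).spanFinrank = n → ∀ a b : Λ, a ≠ 0 →
    (∀ q : Ideal Λ, q.IsPrime → q.height ≤ 1 → ∃ t ∉ q, a ∣ t * b) → a ∣ b := by
  induction n using Nat.strong_induction_on with
  | _ n ih =>
  intro Λ _ _ hn a b ha hab
  have hdom : IsDomain Λ := isDomain_of_regular n Λ hn
  by_contra hnd
  obtain ⟨P, hass, hbP⟩ := exists_le_isAssociatedPrime_of_isNoetherianRing Λ
    (Ideal.Quotient.mk (Ideal.span {a}) b)
    (fun h => hnd (Ideal.mem_span_singleton.1 (Ideal.Quotient.eq_zero_iff_mem.1 h)))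
  obtain ⟨hPp, c', hc'⟩ := isAssociatedPrime_iff.1 hass
  obtain ⟨c, rfl⟩ := Ideal.Quotient.mk_surjective c'
  have hmem : ∀ t e : Λ, t ∈ (⊥ : Submodule Λ (Λ ⧸ Ideal.span {a})).colon
      {Ideal.Quotient.mk (Ideal.span {a}) e} ↔ a ∣ t * e := by
    intro t e
    rw [Submodule.mem_colon_singleton, Submodule.mem_bot, ← Ideal.mem_span_singleton,
      ← Ideal.Quotient.eq_zero_iff_mem, map_mul]
    rfl
  have hPmem : ∀ t ∈ P, a ∣ t * c := fun t ht => (hmem t c).1 (hc' ▸ ht)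
  have hca : ¬ a ∣ c := fun h => by
    apply hPp.ne_top
    rw [Ideal.eq_top_iff_one, hc']
    exact (hmem 1 c).2 (by rwa [one_mul])
  have hPnot : ∀ q : Ideal Λ, q.IsPrime → q.height ≤ 1 → ∃ t ∈ P, t ∉ q := by
    intro q hq hq1
    obtain ⟨t, ht, htb⟩ := hab q hq hq1
    exact ⟨t, hbP ((hmem t b).2 htb), ht⟩
  have hprime : ∀ x ∈ maximalIdeal Λ, x ∉ maximalIdeal Λ ^ 2 → Prime x ∧ ∃ t ∈ P, ¬ x ∣ t := by
    intro x hx hx2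
    obtain ⟨hreg, hlt⟩ := quotient_regular hx hx2
    have hd := isDomain_of_regular _ (Λ ⧸ Ideal.span {x}) rfl
    have hxp : (Ideal.span {x}).IsPrime := (Ideal.Quotient.isDomain_iff_prime _).1 hd
    have hx0 : x ≠ 0 := fun h => hx2 (h ▸ Ideal.zero_mem _)
    obtain ⟨t, ht, htx⟩ := hPnot _ hxp (Ideal.height_span_singleton_le_one
      ((mem_maximalIdeal _).1 hx))
    exact ⟨(Ideal.span_singleton_prime hx0).1 hxp, t, ht, fun h =>
      htx (Ideal.mem_span_singleton.2 h)⟩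
  -- If `P` contains such an `x`, it also contains some `t` with `x ∤ t`. From `t c = a e` and `x c
  -- = a f` follows `t f = x e`, so `x ∣ f` and `a ∣ c`.
  by_cases hcase : ∃ x ∈ P, x ∈ maximalIdeal Λ ∧ x ∉ maximalIdeal Λ ^ 2
  · obtain ⟨x, hxP, hx, hx2⟩ := hcase
    obtain ⟨hxprime, t, ht, hxt⟩ := hprime x hx hx2
    obtain ⟨e, he⟩ := hPmem t ht
    obtain ⟨f, hf⟩ := hPmem x hxP
    have h1 : t * f = x * e := by
      apply mul_left_cancel₀ ha
      linear_combination x * he - t * hf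
    obtain ⟨g, rfl⟩ := (hxprime.dvd_or_dvd (Dvd.intro e h1.symm)).resolve_left hxt
    apply hca
    refine ⟨g, mul_left_cancel₀ hxprime.ne_zero ?_⟩
    linear_combination hf
  push Not at hcase
  obtain ⟨x, hx, hx2⟩ : ∃ x ∈ maximalIdeal Λ, x ∉ maximalIdeal Λ ^ 2 := by
    by_contra! hle
    have hbot : maximalIdeal Λ = ⊥ := by
      refine Submodule.eq_bot_of_le_smul_of_le_jacobson_bot (maximalIdeal Λ) _
        (IsNoetherian.noetherian _) ?_ (by rw [jacobson_eq_maximalIdeal _ bot_ne_top])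
      rw [smul_eq_mul, ← pow_two]
      exact hle
    have hau : IsUnit a := by
      by_contra hau
      have : a ∈ maximalIdeal Λ := hau
      rw [hbot] at this
      exact ha this
    exact hca hau.dvd
  have hxP : x ∉ P := fun h => hx2 (hcase x h hx)
  obtain ⟨hxprime, t, ht, hxt⟩ := hprime x hx hx2
  obtain ⟨hreg, hlt⟩ := quotient_regular hx hx2
  obtain ⟨k, a', hxa', rfl⟩ : ∃ (k : ℕ) (a' : Λ), ¬ x ∣ a' ∧ a = x ^ k * a' := by
    obtain ⟨a', h1, h2⟩ :=
      (FiniteMultiplicity.of_not_isUnit hxprime.not_isUnit ha).exists_eq_pow_mul_and_not_dvd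
    exact ⟨_, a', h2, h1⟩
  have ha' : a' ≠ 0 := fun h => ha (by rw [h, mul_zero])
  obtain ⟨c, rfl⟩ : x ^ k ∣ c :=
    hxprime.pow_dvd_of_dvd_mul_left k hxt ((Dvd.intro _ rfl).trans (hPmem t ht))
  have hPc : ∀ t ∈ P, a' ∣ t * c := by
    intro t ht
    obtain ⟨e, he⟩ := hPmem t ht
    refine ⟨e, mul_left_cancel₀ (pow_ne_zero k hxprime.ne_zero) ?_⟩
    linear_combination he
  -- Induction modulo `x`: a prime of height at most one in `Λ/x` pulls back to one of height at
  -- most two containing `x ∉ P`. If it contained `P`, then strictly, and `P` would have height at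
  -- most one.
  have hstep : ∀ c : Λ, (∀ t ∈ P, a' ∣ t * c) → ∃ r d, c = a' * r + x * d ∧ ∀ t ∈ P, a' ∣ t * d := by
    intro c hc
    have hdvd : Ideal.Quotient.mk (Ideal.span {x}) a' ∣ Ideal.Quotient.mk (Ideal.span {x}) c := by
      refine ih _ (hn ▸ hlt) _ rfl _ _ (fun h => hxa' (Ideal.mem_span_singleton.1
        (Ideal.Quotient.eq_zero_iff_mem.1 h))) fun q hq hq1 => ?_
      obtain ⟨t, ht, htq⟩ : ∃ t ∈ P, t ∉ q.comap (Ideal.Quotient.mk (Ideal.span {x})) := by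
        by_contra! hle
        have hxq : x ∈ q.comap (Ideal.Quotient.mk (Ideal.span {x})) := by
          rw [Ideal.mem_comap, Ideal.Quotient.eq_zero_iff_mem.2 (Ideal.mem_span_singleton_self x)]
          exact q.zero_mem
        have hlt : P < q.comap (Ideal.Quotient.mk (Ideal.span {x})) :=
          lt_of_le_of_ne hle (fun h => hxP (h ▸ hxq))
        have h1 := Ideal.height_add_one_le_of_lt_of_isPrime hlt
        have h2 := Ideal.height_le_height_add_one_of_mem hxq
        rw [Ideal.map_comap_of_surjective _ Ideal.Quotient.mk_surjective] at h2
        have h3 : P.height + 1 ≤ 1 + 1 := h1.trans (h2.trans (by gcongr))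
        have h4 := (ENat.add_le_add_iff_right (ENat.natCast_ne_top 1)).1 h3
        obtain ⟨t, ht, htP⟩ := hPnot P hPp h4
        exact htP ht
      refine ⟨Ideal.Quotient.mk _ t, htq, ?_⟩
      rw [← map_mul]
      exact map_dvd _ (hc t ht)
    obtain ⟨r', hr'⟩ := hdvd
    obtain ⟨r, rfl⟩ := Ideal.Quotient.mk_surjective r'
    rw [← map_mul, Ideal.Quotient.eq, Ideal.mem_span_singleton] at hr'
    obtain ⟨d, hd⟩ := hr'
    refine ⟨r, d, by linear_combination hd, fun t ht => ?_⟩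
    obtain ⟨e, he⟩ := hc t ht
    have h1 : a' * (e - t * r) = x * (t * d) := by linear_combination t * hd - he
    obtain ⟨g, hg⟩ := (hxprime.dvd_or_dvd (Dvd.intro _ h1.symm)).resolve_left hxa'
    refine ⟨g, mul_left_cancel₀ hxprime.ne_zero ?_⟩
    linear_combination a' * hg - h1
  -- So `c` lies in `(a', x^m)` for all `m`, and Krull's intersection theorem in `Λ/a'` gives `a' ∣
  -- c`.
  have hiter : ∀ m : ℕ, ∃ r d, c = a' * r + x ^ m * d ∧ ∀ t ∈ P, a' ∣ t * d := by
    intro m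
    induction m with
    | zero => exact ⟨0, c, by simp, hPc⟩
    | succ m hm =>
      obtain ⟨r, d, h1, h2⟩ := hm
      obtain ⟨r', d', h3, h4⟩ := hstep d h2
      exact ⟨r + x ^ m * r', d', by rw [h1, h3]; ring, h4⟩
  apply hca
  have hxtop : Ideal.span {x} ≠ ⊤ := fun h =>
    hxprime.not_isUnit (Ideal.span_singleton_eq_top.1 h)
  have hinf := Ideal.iInf_pow_smul_eq_bot_of_isLocalRing (M := Λ ⧸ Ideal.span {a'}) _ hxtop
  have hc0 : Ideal.Quotient.mk (Ideal.span {a'}) c = 0 := by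
    have : Ideal.Quotient.mk (Ideal.span {a'}) c ∈
        (⨅ i : ℕ, Ideal.span {x} ^ i • ⊤ : Submodule Λ (Λ ⧸ Ideal.span {a'})) := by
      rw [Submodule.mem_iInf]
      intro m
      obtain ⟨r, d, h1, -⟩ := hiter m
      have h2 : Ideal.Quotient.mk (Ideal.span {a'}) c =
          (x ^ m) • Ideal.Quotient.mk (Ideal.span {a'}) d := by
        rw [h1, map_add, map_mul, Ideal.Quotient.eq_zero_iff_mem.2 (Ideal.mem_span_singleton_self a'),
          zero_mul, zero_add, map_mul]
        rfl
      rw [h2]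
      exact Submodule.smul_mem_smul (Ideal.pow_mem_pow (Ideal.mem_span_singleton_self x) m) trivial
    rw [hinf] at this
    exact this
  exact mul_dvd_mul_left _ (Ideal.mem_span_singleton.1 (Ideal.Quotient.eq_zero_iff_mem.1 hc0))

end RegularLocal

/-! ### Serre's conditions for finite free algebras, and gluing in codimension one. -/

section Serre

/-- Serre's conditions `S₁` and `S₂`, in elementary form. -/
structure SerreTwo (R : Type u) [CommRing R] : Prop where
  eq_zero : ∀ r : R, (∀ p ∈ minimalPrimes R, ∃ s ∉ p, s * r = 0) → r = 0
  dvd : ∀ a ∈ nonZeroDivisors R, ∀ c : R,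
    (∀ q : Ideal R, q.IsPrime → q.height ≤ 1 → ∃ t ∉ q, a ∣ t * c) → a ∣ c

/-- By incomparability, strict chains of primes contract to strict chains. -/
theorem height_le_height_comap {Λ : Type v} {R : Type u} [CommRing Λ] [CommRing R] [Algebra Λ R]
    [Algebra.IsIntegral Λ R] (q : Ideal R) [q.IsPrime] :
    q.height ≤ (q.comap (algebraMap Λ R)).height := by
  have h := Order.height_le_height_apply_of_strictMono
    (fun p : PrimeSpectrum R => p.comap (algebraMap Λ R))
    (fun p p' hp => Ideal.IsIntegral.comap_lt_comap (I := p.asIdeal) (J := p'.asIdeal) hp) ⟨q, ‹_›⟩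
  rwa [← PrimeSpectrum.height_eq_orderHeight, ← PrimeSpectrum.height_eq_orderHeight] at h

theorem SerreTwo.of_free {Λ : Type v} {R : Type u} [CommRing Λ] [IsDomain Λ] [CommRing R] [Algebra Λ R]
    [Module.Free Λ R] [Module.Finite Λ R]
    (hΛ : ∀ a b : Λ, a ≠ 0 →
      (∀ q : Ideal Λ, q.IsPrime → q.height ≤ 1 → ∃ t ∉ q, a ∣ t * b) → a ∣ b) :
    SerreTwo R := by
  have hsmul : ∀ (l : Λ) (r : R), algebraMap Λ R l * r = 0 → l = 0 ∨ r = 0 := by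
    intro l r h
    rw [← Algebra.smul_def] at h
    exact smul_eq_zero.1 h
  refine ⟨fun r hr => ?_, fun a ha c hc => ?_⟩
  · by_contra hr0
    -- The annihilator of a nonzero `r` avoids the nonzero elements of `Λ`, since `R` is torsion
    -- free over `Λ`. It therefore lies in a prime contracting to `0`, which is minimal by
    -- incomparability.
    let I : Ideal R := LinearMap.ker (LinearMap.mulRight R r)
    have hImem : ∀ s, s ∈ I ↔ s * r = 0 := fun s => Iff.rfl
    let S : Submonoid R := (nonZeroDivisors Λ).map (algebraMap Λ R)
    have hdisj : Disjoint (I : Set R) S := by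
      rw [Set.disjoint_left]
      rintro _ h1 ⟨l, hl, rfl⟩
      exact (hsmul l r ((hImem _).1 h1)).elim (nonZeroDivisors.ne_zero hl) hr0
    obtain ⟨P, hP, hIP, hPS⟩ := Ideal.exists_le_prime_disjoint I S hdisj
    obtain ⟨p, hp, hle⟩ := Ideal.exists_minimalPrimes_le (I := ⊥) (J := P) bot_le
    have hpp : p.IsPrime := hp.1.1
    have hcomap : P.comap (algebraMap Λ R) = ⊥ := by
      rw [eq_bot_iff]
      intro l hl
      by_contra hl0
      exact Set.disjoint_left.1 hPS hl ⟨l, mem_nonZeroDivisors_of_ne_zero hl0, rfl⟩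
    have hpP : p = P := by
      by_contra hne
      have := Ideal.IsIntegral.comap_lt_comap (R := Λ) (lt_of_le_of_ne hle hne)
      rw [hcomap] at this
      exact not_lt_bot this
    obtain ⟨s, hs, hsr⟩ := hr p hp
    exact hs (hpP ▸ hIP ((hImem s).2 hsr))
  -- A non-zero-divisor integral over `Λ` divides a nonzero `l ∈ Λ`. Writing `l = a a'`,
  -- divisibility of `c` by `a` becomes divisibility of `a' c` by `l`, which can be read off
  -- coordinates over `Λ`.
  · obtain ⟨l, hl0, a', hl⟩ : ∃ l : Λ, l ≠ 0 ∧ a ∣ algebraMap Λ R l := by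
      obtain ⟨f, hf, hfa⟩ := Algebra.IsIntegral.isIntegral (R := Λ) a
      obtain ⟨i, hi0, hi⟩ := Ideal.exists_coeff_ne_zero_mem_comap_of_non_zero_divisor_root_mem
        (fun {x} hx => (mem_nonZeroDivisors_iff_right.1 ha) x hx) (Ideal.mem_span_singleton_self a) hf.ne_zero hfa
      exact ⟨_, hi0, Ideal.mem_span_singleton.1 hi⟩
    suffices h : algebraMap Λ R l ∣ a' * c by
      obtain ⟨r, hr⟩ := h
      refine ⟨r, ?_⟩
      have : algebraMap Λ R l * (c - a * r) = 0 := by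
        linear_combination a * hr + c * hl
      rcases hsmul _ _ this with h | h
      · exact absurd h hl0
      · exact sub_eq_zero.1 h
    let b := Module.Free.chooseBasis Λ R
    have hdvd : ∀ x : R, algebraMap Λ R l ∣ x ↔ ∀ i, l ∣ b.repr x i := by
      intro x
      constructor
      · rintro ⟨y, rfl⟩ i
        rw [← Algebra.smul_def, map_smul]
        exact ⟨_, rfl⟩
      · intro h
        choose f hf using h
        refine ⟨∑ i, f i • b i, ?_⟩
        conv_lhs => rw [← b.sum_repr x]
        rw [← Algebra.smul_def, Finset.smul_sum]
        exact Finset.sum_congr rfl fun i _ => by rw [hf i, mul_smul]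
    rw [hdvd]
    intro i
    refine hΛ l _ hl0 fun p hp hp1 => ?_
    -- If the ideal of denominators contracted into `p`, lying over would put it inside a prime of
    -- `R` above `p`, of height at most one, against the assumption on `c`.
    let I : Ideal R := (Ideal.span {algebraMap Λ R l}).colon {a' * c}
    have hImem : ∀ t : R, t ∈ I ↔ algebraMap Λ R l ∣ t * (a' * c) := by
      intro t
      rw [Submodule.mem_colon_singleton, Ideal.mem_span_singleton, smul_eq_mul]
    by_contra! hcon
    have hle : I.comap (algebraMap Λ R) ≤ p := by
      intro t ht
      by_contra htp
      apply hcon t htp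
      rw [Ideal.mem_comap, hImem, hdvd] at ht
      have := ht i
      rwa [← Algebra.smul_def, map_smul] at this
    obtain ⟨Q, hIQ, hQ, hQp⟩ := Ideal.exists_ideal_over_prime_of_isIntegral p I hle
    have hQ1 : Q.height ≤ 1 := (height_le_height_comap (Λ := Λ) Q).trans (by rw [hQp]; exact hp1)
    obtain ⟨t, ht, e, he⟩ := hc Q hQ hQ1
    refine ht (hIQ ((hImem t).2 ⟨e, ?_⟩))
    rw [hl]
    linear_combination a' * he

theorem SerreTwo.of_regular {Λ : Type v} {R : Type u} [CommRing Λ] [IsRegularLocalRing Λ] [CommRing R]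
    [Algebra Λ R] [Module.Free Λ R] [Module.Finite Λ R] :
    SerreTwo R := by
  have := isDomain_of_regular _ Λ rfl
  exact SerreTwo.of_free (dvd_of_codim_one_of_regular _ Λ rfl)

section

variable {R : Type u} [CommRing R] [IsNoetherianRing R]

omit [IsNoetherianRing R] in
theorem SerreTwo.mem_nonZeroDivisors (hR : SerreTwo R) {a : R} (ha : ∀ p ∈ minimalPrimes R, a ∉ p) :
    a ∈ nonZeroDivisors R :=
  mem_nonZeroDivisors_iff_left.2 fun x hx => hR.eq_zero x fun p hp => ⟨a, ha p hp, hx⟩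

/-- Prime avoidance. -/
theorem SerreTwo.exists_mem_nonZeroDivisors (hR : SerreTwo R) (I : Ideal R)
    (hI : ∀ p ∈ minimalPrimes R, ∃ s ∈ I, s ∉ p) : ∃ a ∈ I, a ∈ nonZeroDivisors R := by
  by_contra! h
  have hne : (minimalPrimes R).Nonempty := by
    by_contra hemp
    rw [Set.not_nonempty_iff_eq_empty] at hemp
    refine h 0 I.zero_mem (hR.mem_nonZeroDivisors fun p hp => ?_)
    rw [hemp] at hp
    exact absurd hp (Set.notMem_empty _)
  obtain ⟨p0, hp0⟩ := hne
  obtain ⟨p, hp, hle⟩ := (Ideal.subset_union_prime_finite (f := fun I : Ideal R => I)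
    (minimalPrimes.finite_of_isNoetherianRing R) p0 p0 (I := I)
    (fun p hp _ _ => hp.1.1)).1 (fun x hx => by
      by_contra hx'
      refine h x hx (hR.mem_nonZeroDivisors fun p hp hxp => hx' (Set.mem_biUnion hp hxp)))
  obtain ⟨s, hs, hsp⟩ := hI p hp
  exact hsp (hle hs)

omit [IsNoetherianRing R] in
theorem notMem_minimalPrimes_of_mem_nonZeroDivisors {a : R} (ha : a ∈ nonZeroDivisors R)
    {p : Ideal R} (hp : p ∈ minimalPrimes R) : a ∉ p := fun h =>
  Set.disjoint_left.1 (Ideal.disjoint_nonZeroDivisors_of_mem_minimalPrimes hp) h ha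

/-- The admissible denominators of the system form an ideal contained in no minimal prime, so there
is a solution `v0 / s0` with `s0` a non-zero-divisor. Any solution at `q` must agree with it, so
`s0` divides `v0` in codimension one and S₂ finishes. -/
theorem SerreTwo.exists_glue (hR : SerreTwo R) {K : Type*} (A B : K → R)
    (hA : ∀ p ∈ minimalPrimes R, ∃ k, A k ∉ p)
    (hAB : ∀ q : Ideal R, q.IsPrime → q.height ≤ 1 → ∃ s ∉ q, ∃ v, ∀ k, A k * v = s * B k) :
    ∃! v, ∀ k, A k * v = B k := by
  have huniq : ∀ v : R, (∀ k, A k * v = 0) → v = 0 := fun v hv => hR.eq_zero v fun p hp => by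
    obtain ⟨k, hk⟩ := hA p hp
    exact ⟨A k, hk, hv k⟩
  let I : Ideal R :=
    { carrier := {s | ∃ v, ∀ k, A k * v = s * B k}
      zero_mem' := ⟨0, fun k => by ring⟩
      add_mem' := by
        rintro s t ⟨v, hv⟩ ⟨w, hw⟩
        exact ⟨v + w, fun k => by rw [mul_add, hv, hw, add_mul]⟩
      smul_mem' := by
        rintro c s ⟨v, hv⟩
        exact ⟨c * v, fun k => by rw [smul_eq_mul, mul_left_comm, hv, mul_assoc]⟩ }
  obtain ⟨s0, ⟨v0, hv0⟩, hs0⟩ := hR.exists_mem_nonZeroDivisors I fun p hp => by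
    have : p.IsPrime := hp.1.1
    obtain ⟨s, hs, v, hv⟩ := hAB p this ((Ideal.height_eq_zero_iff.2 hp).le.trans zero_le_one)
    exact ⟨s, ⟨v, hv⟩, hs⟩
  obtain ⟨v, rfl⟩ := hR.dvd s0 hs0 v0 fun q hq hq1 => by
    obtain ⟨s, hs, v, hv⟩ := hAB q hq hq1
    refine ⟨s, hs, v, ?_⟩
    rw [← sub_eq_zero]
    refine huniq _ fun k => ?_
    linear_combination s * hv0 k - s0 * hv k
  refine ⟨v, fun k => ?_, fun w hw => ?_⟩
  · have : s0 * (A k * v - B k) = 0 := by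
      rw [mul_sub, ← hv0]; ring
    exact sub_eq_zero.1 (mem_nonZeroDivisors_iff_left.1 hs0 _ this)
  · rw [← sub_eq_zero]
    refine huniq _ fun k => ?_
    have h2 : s0 * (A k * v - B k) = 0 := by
      rw [mul_sub, ← hv0]; ring
    rw [mul_sub, hw, sub_eq_zero]
    exact (sub_eq_zero.1 (mem_nonZeroDivisors_iff_left.1 hs0 _ h2)).symm

end

end Serre

/-! ### Exterior powers of modules spanned at a prime by given vectors. -/

section LocalGeneration

variable {R : Type u} [CommRing R] {M : Type*} [AddCommGroup M] [Module R M]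

/-- `v` generates `M` at the prime `q`. -/
def GeneratesAt {M : Type*} [AddCommMonoid M] [Module R M] (q : Ideal R) (v : M) : Prop := ∀ w : M, ∃ s ∉ q, ∃ c : R, s • w = c • v

/-- The family `g` generates `M` at the prime `q`, with one denominator for all elements. -/
def SpansAt (q : Ideal R) {n : ℕ} (g : Fin n → M) : Prop :=
  ∃ s ∉ q, ∀ m : M, ∃ a : Fin n → R, s • m = ∑ i, a i • g i

theorem exists_smul_ιMulti {n : ℕ} {g : Fin n → M}
    {s : R} (hg : ∀ m : M, ∃ a : Fin n → R, s • m = ∑ i, a i • g i) {k : ℕ} (v : Fin k → M) :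
    ∃ a : (Fin k → Fin n) → R, s ^ k • ExteriorAlgebra.ιMulti R k v =
      ∑ σ : Fin k → Fin n, a σ • ExteriorAlgebra.ιMulti R k (g ∘ σ) := by
  choose a ha using hg
  refine ⟨fun σ => ∏ i, a (v i) (σ i), ?_⟩
  have h1 : s ^ k • ExteriorAlgebra.ιMulti R k v = ExteriorAlgebra.ιMulti R k (fun i => s • v i) := by
    have := (ExteriorAlgebra.ιMulti R k (M := M)).toMultilinearMap.map_smul_univ (fun _ => s) v
    simpa using this.symm
  rw [h1]
  simp_rw [ha]
  have := (ExteriorAlgebra.ιMulti R k (M := M)).toMultilinearMap.map_sum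
    (fun i (j : Fin n) => a (v i) j • g j)
  simp only [AlternatingMap.coe_multilinearMap] at this
  rw [this]
  refine Finset.sum_congr rfl fun σ _ => ?_
  have := (ExteriorAlgebra.ιMulti R k (M := M)).toMultilinearMap.map_smul_univ
    (fun i => a (v i) (σ i)) (g ∘ σ)
  simpa using this

/-- After multiplication by `s ^ n`, a wedge of `n` vectors expands into wedges of the `g (σ i)`.
These vanish or differ by a sign from the wedge of all the `g i`. -/
theorem SpansAt.generates {q : Ideal R} [q.IsPrime] {n : ℕ} {g : Fin n → M} (hg : SpansAt q g)
    {w : ExteriorAlgebra R M} (hw : w ∈ ⋀[R]^n M) :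
    ∃ s ∉ q, ∃ c : R, s • w = c • ExteriorAlgebra.ιMulti R n g := by
  obtain ⟨s, hs, hg⟩ := hg
  rw [← ExteriorAlgebra.ιMulti_span_fixedDegree] at hw
  refine ⟨s ^ n, fun h => hs (Ideal.IsPrime.mem_of_pow_mem ‹_› n h), ?_⟩
  induction hw using Submodule.span_induction with
  | mem x hx =>
    obtain ⟨v, rfl⟩ := hx
    obtain ⟨a, ha⟩ := exists_smul_ιMulti hg v
    rw [ha]
    have hex : ∀ σ : Fin n → Fin n, ∃ c : R, ExteriorAlgebra.ιMulti R n (g ∘ σ) =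
        c • ExteriorAlgebra.ιMulti R n g := by
      intro σ
      by_cases hσ : Function.Injective σ
      · refine ⟨((Equiv.Perm.sign (Equiv.ofBijective σ (Finite.injective_iff_bijective.1 hσ)) : ℤ) : R), ?_⟩
        have := (ExteriorAlgebra.ιMulti R n (M := M)).map_perm g
          (Equiv.ofBijective σ (Finite.injective_iff_bijective.1 hσ))
        rw [Int.cast_smul_eq_zsmul]
        exact this
      · refine ⟨0, ?_⟩
        rw [zero_smul]
        exact ExteriorAlgebra.ιMulti_eq_zero_of_not_inj fun h => hσ h.of_comp
    choose c hc using hex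
    refine ⟨∑ σ, a σ * c σ, ?_⟩
    rw [Finset.sum_smul]
    exact Finset.sum_congr rfl fun σ _ => by rw [hc, mul_smul]
  | zero => exact ⟨0, by simp⟩
  | add x y _ _ hx hy =>
    obtain ⟨c, hc⟩ := hx
    obtain ⟨d, hd⟩ := hy
    exact ⟨c + d, by rw [smul_add, hc, hd, add_smul]⟩
  | smul a x _ hx =>
    obtain ⟨c, hc⟩ := hx
    exact ⟨a * c, by rw [smul_comm, hc, mul_smul]⟩

/-- With more factors than spanning vectors, each term of the expansion repeats a vector. -/
theorem SpansAt.eq_zero_of_lt {q : Ideal R} [q.IsPrime] {n : ℕ} {g : Fin n → M} (hg : SpansAt q g)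
    {k : ℕ} (hk : n < k) {w : ExteriorAlgebra R M} (hw : w ∈ ⋀[R]^k M) : ∃ s ∉ q, s • w = 0 := by
  obtain ⟨s, hs, hg⟩ := hg
  rw [← ExteriorAlgebra.ιMulti_span_fixedDegree] at hw
  refine ⟨s ^ k, fun h => hs (Ideal.IsPrime.mem_of_pow_mem ‹_› k h), ?_⟩
  induction hw using Submodule.span_induction with
  | mem x hx =>
    obtain ⟨v, rfl⟩ := hx
    obtain ⟨a, ha⟩ := exists_smul_ιMulti hg v
    rw [ha]
    refine Finset.sum_eq_zero fun σ _ => ?_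
    have hσ : ¬ Function.Injective σ := fun h => by
      have := Fintype.card_le_of_injective σ h
      simp at this
      omega
    rw [ExteriorAlgebra.ιMulti_eq_zero_of_not_inj fun h => hσ h.of_comp, smul_zero]
  | zero => simp
  | add x y _ _ hx hy => rw [smul_add, hx, hy, add_zero]
  | smul a x _ hx => rw [smul_comm, hx, smul_zero]

end LocalGeneration

/-! ### The kernel of a map of exterior algebras. -/

section Kernel

variable {R : Type u} [CommRing R] {M N : Type*} [AddCommGroup M] [Module R M]
  [AddCommGroup N] [Module R N]

theorem ι_mul_eq_involute_mul_ι (w : ExteriorAlgebra R M) (z : M) :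
    w * ExteriorAlgebra.ι R z = ExteriorAlgebra.ι R z * CliffordAlgebra.involute w := by
  induction w using ExteriorAlgebra.induction with
  | algebraMap r =>
    rw [AlgHom.commutes]
    exact Algebra.commutes _ _
  | ι x =>
    have h1 : CliffordAlgebra.involute (ExteriorAlgebra.ι R x) = - ExteriorAlgebra.ι R x :=
      CliffordAlgebra.involute_ι x
    rw [h1, mul_neg, ← add_eq_zero_iff_eq_neg]
    exact ExteriorAlgebra.ι_add_mul_swap x z
  | mul a b ha hb => rw [mul_assoc, hb, ← mul_assoc, ha, map_mul, mul_assoc]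
  | add a b ha hb => rw [add_mul, ha, hb, map_add, mul_add]

/-- An algebra map out of `⋀ M` that kills `ker f` factors through `⋀ N`. This replaces a
description of the kernel of `⋀ f` by generators. -/
theorem lift_eq_zero_of_map_eq_zero {A : Type*} [Ring A] [Algebra R A] (f : M →ₗ[R] N)
    (hf : Function.Surjective f) (ρ : M →ₗ[R] A) (hsq : ∀ m, ρ m * ρ m = 0)
    (hρ : ∀ z, f z = 0 → ρ z = 0) {k : ExteriorAlgebra R M} (hk : ExteriorAlgebra.map f k = 0) :
    ExteriorAlgebra.lift R ⟨ρ, hsq⟩ k = 0 := by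
  let ρ' : N →ₗ[R] A :=
    ((LinearMap.ker f).liftQ ρ hρ) ∘ₗ (f.quotKerEquivOfSurjective hf).symm.toLinearMap
  have hρ' : ∀ m, ρ' (f m) = ρ m := by
    intro m
    have : (f.quotKerEquivOfSurjective hf).symm (f m) = Submodule.Quotient.mk m := by
      rw [LinearEquiv.symm_apply_eq]
      rfl
    simp only [ρ', LinearMap.comp_apply, LinearEquiv.coe_coe, this]
    exact Submodule.liftQ_apply _ _ _
  have hsq' : ∀ n, ρ' n * ρ' n = 0 := by
    intro n
    obtain ⟨m, rfl⟩ := hf n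
    rw [hρ', hsq]
  have hL : ExteriorAlgebra.lift R ⟨ρ, hsq⟩ =
      (ExteriorAlgebra.lift R ⟨ρ', hsq'⟩).comp (ExteriorAlgebra.map f) := by
    apply ExteriorAlgebra.hom_ext
    ext m
    simp only [LinearMap.comp_apply, AlgHom.toLinearMap_apply, AlgHom.comp_apply,
      ExteriorAlgebra.map_apply_ι, ExteriorAlgebra.lift_ι_apply, hρ']
  rw [hL, AlgHom.comp_apply, hk, map_zero]

/-- The two-sided ideal annihilating `W * ⋀ M` from the right. -/
def rightAnnihilator (W : ExteriorAlgebra R M) : Ideal (ExteriorAlgebra R M) where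
  carrier := {k | ∀ w, W * w * k = 0}
  zero_mem' := fun w => mul_zero _
  add_mem' := fun {a b} ha hb w => by rw [mul_add, ha w, hb w, add_zero]
  smul_mem' := fun c a ha w => by rw [smul_eq_mul, ← mul_assoc, mul_assoc W, ha]

instance (W : ExteriorAlgebra R M) : (rightAnnihilator W).IsTwoSided where
  mul_mem_of_left := fun {a} b ha w => by rw [← mul_assoc, ha w, zero_mul]

/-- If `W` is annihilated by `ker f` then it is annihilated by the kernel of `⋀ f`. -/
theorem mul_eq_zero_of_map_eq_zero (f : M →ₗ[R] N) (hf : Function.Surjective f)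
    {W : ExteriorAlgebra R M} (hW : ∀ z, f z = 0 → W * ExteriorAlgebra.ι R z = 0)
    {k : ExteriorAlgebra R M} (hk : ExteriorAlgebra.map f k = 0) : W * k = 0 := by
  -- In this quotient each `z ∈ ker f` dies: moving `z` to the left past `w` costs only the grade
  -- involution of `w`, and `W` kills `z`.
  let q : ExteriorAlgebra R M →ₐ[R] ExteriorAlgebra R M ⧸ rightAnnihilator W :=
    Ideal.Quotient.mkₐ R (rightAnnihilator W)
  have hsq : ∀ m, (q.toLinearMap ∘ₗ ExteriorAlgebra.ι R) m * (q.toLinearMap ∘ₗ ExteriorAlgebra.ι R) m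
      = 0 := fun m => ExteriorAlgebra.comp_ι_sq_zero q m
  have hρ : ∀ z, f z = 0 → (q.toLinearMap ∘ₗ ExteriorAlgebra.ι R) z = 0 := by
    intro z hz
    refine Ideal.Quotient.eq_zero_iff_mem.2 fun w => ?_
    rw [mul_assoc, ι_mul_eq_involute_mul_ι, ← mul_assoc, hW z hz, zero_mul]
  have h0 := lift_eq_zero_of_map_eq_zero f hf _ hsq hρ hk
  have h1 : q k = 0 := by
    rw [← h0, ExteriorAlgebra.lift_comp_ι]
  have h2 : k ∈ rightAnnihilator W := Ideal.Quotient.eq_zero_iff_mem.1 h1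
  simpa using h2 1

end Kernel

/-! ### Exterior powers of locally constant degree. -/

section ExtPow

variable {R : Type u} [CommRing R] {M N : Type u} [AddCommGroup M] [Module R M]
  [AddCommGroup N] [Module R N]

theorem eq_zero_of_locally {M : Type*} [AddCommGroup M] [Module R M] {x : M}
    (h : ∀ 𝔭 : PrimeSpectrum R, ∃ s ∉ 𝔭.asIdeal, s • x = 0) : x = 0 := by
  have hI : (LinearMap.ker (LinearMap.toSpanSingleton R M x) : Ideal R) = ⊤ := by
    by_contra hne
    obtain ⟨m, hm, hle⟩ := Ideal.exists_le_maximal _ hne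
    obtain ⟨s, hs, hsx⟩ := h ⟨m, hm.isPrime⟩
    exact hs (hle (by simpa using hsx))
  have : (1 : R) ∈ (LinearMap.ker (LinearMap.toSpanSingleton R M x) : Ideal R) :=
    hI ▸ Submodule.mem_top
  simpa using this

theorem map_mem_exteriorPower (f : M →ₗ[R] N) {n : ℕ} {x : ExteriorAlgebra R M} (hx : x ∈ ⋀[R]^n M) :
    ExteriorAlgebra.map f x ∈ ⋀[R]^n N := by
  rw [← ExteriorAlgebra.ιMulti_span_fixedDegree] at hx
  induction hx using Submodule.span_induction with
  | mem x hx =>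
    obtain ⟨v, rfl⟩ := hx
    rw [ExteriorAlgebra.map_apply_ιMulti, ← ExteriorAlgebra.ιMulti_span_fixedDegree]
    exact Submodule.subset_span ⟨_, rfl⟩
  | zero => rw [map_zero]; exact Submodule.zero_mem _
  | add x y _ _ hx hy => rw [map_add]; exact Submodule.add_mem _ hx hy
  | smul a x _ hx => rw [map_smul]; exact Submodule.smul_mem _ _ hx

theorem ιMulti_mem {n : ℕ} (v : Fin n → M) : ExteriorAlgebra.ιMulti R n v ∈ ⋀[R]^n M := by
  rw [← ExteriorAlgebra.ιMulti_span_fixedDegree]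
  exact Submodule.subset_span ⟨_, rfl⟩

theorem extPow_map (f : M →ₗ[R] N) {ρ : PrimeSpectrum R → ℕ} {x : ExteriorAlgebra R M}
    (hx : x ∈ extPow R M ρ) : ExteriorAlgebra.map f x ∈ extPow R N ρ := by
  intro 𝔭
  obtain ⟨s, hs, hsx⟩ := hx 𝔭
  exact ⟨s, hs, by rw [← map_smul]; exact map_mem_exteriorPower f hsx⟩

theorem extPow_mul {ρ σ τ : PrimeSpectrum R → ℕ} (hτ : ∀ 𝔭, ρ 𝔭 + σ 𝔭 = τ 𝔭)
    {x y : ExteriorAlgebra R M}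
    (hx : x ∈ extPow R M ρ) (hy : y ∈ extPow R M σ) : x * y ∈ extPow R M τ := by
  intro 𝔭
  obtain ⟨s, hs, hsx⟩ := hx 𝔭
  obtain ⟨t, ht, hty⟩ := hy 𝔭
  refine ⟨s * t, 𝔭.asIdeal.primeCompl.mul_mem hs ht, ?_⟩
  rw [← hτ, ← smul_mul_smul_comm]
  exact SetLike.GradedMul.mul_mem (A := fun i : ℕ => ⋀[R]^i M) hsx hty

theorem one_mem_extPow {ρ : PrimeSpectrum R → ℕ} (hρ : ∀ 𝔭, ρ 𝔭 = 0) :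
    (1 : ExteriorAlgebra R M) ∈ extPow R M ρ := by
  intro 𝔭
  refine ⟨1, 𝔭.asIdeal.primeCompl.one_mem, ?_⟩
  rw [one_smul, hρ]
  exact SetLike.GradedOne.one_mem (A := fun i : ℕ => ⋀[R]^i M)

/-- The fibres of `ρ` are clopen and, the spectrum being compact, finitely many are nonempty. The
product of two of the corresponding idempotents lies in every prime, hence is nilpotent and
idempotent, hence zero. -/
theorem exists_idempotents {ρ : PrimeSpectrum R → ℕ} (hρ : IsLocallyConstant ρ) :
    ∃ (e : ℕ → R) (s : Finset ℕ), (∀ k 𝔭, e k ∉ 𝔭.asIdeal ↔ ρ 𝔭 = k) ∧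
      (∀ k l, k ≠ l → e k * e l = 0) ∧ (∀ 𝔭, ρ 𝔭 ∈ s) ∧ ∀ k, e k * e k = e k := by
  have h : ∀ k : ℕ, ∃ e : R, IsIdempotentElem e ∧ ρ ⁻¹' {k} = PrimeSpectrum.basicOpen e := fun k =>
    PrimeSpectrum.exists_idempotent_basicOpen_eq_of_isClopen ⟨hρ.isClosed_fiber k, hρ.isOpen_fiber k⟩
  choose e he he' using h
  have hmem : ∀ k 𝔭, e k ∉ 𝔭.asIdeal ↔ ρ 𝔭 = k := by
    intro k 𝔭
    have : 𝔭 ∈ (PrimeSpectrum.basicOpen (e k) : Set (PrimeSpectrum R)) ↔ ρ 𝔭 = k := by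
      rw [← he' k]; rfl
    exact this
  refine ⟨e, hρ.range_finite.toFinset, hmem, fun k l hkl => ?_, fun 𝔭 => by simp, he⟩
  have hn : IsNilpotent (e k * e l) := by
    rw [nilpotent_iff_mem_prime]
    intro J hJ
    by_contra hmem'
    have h1 : e k ∉ J := fun h => hmem' (J.mul_mem_right _ h)
    have h2 : e l ∉ J := fun h => hmem' (J.mul_mem_left _ h)
    exact hkl (((hmem k ⟨J, hJ⟩).1 h1).symm.trans ((hmem l ⟨J, hJ⟩).1 h2))
  have hi : IsIdempotentElem (e k * e l) := (he k).mul (he l)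
  exact hi.eq_zero_of_isNilpotent hn

theorem proj_map (f : M →ₗ[R] N) (k : ℕ) (x : ExteriorAlgebra R M) :
    ExteriorAlgebra.map f (GradedAlgebra.proj (fun i : ℕ => ⋀[R]^i M) k x) =
      GradedAlgebra.proj (fun i : ℕ => ⋀[R]^i N) k (ExteriorAlgebra.map f x) := by
  have hx : x ∈ (⊤ : Submodule R (ExteriorAlgebra R M)) := trivial
  rw [← ExteriorAlgebra.ιMulti_span] at hx
  induction hx using Submodule.span_induction with
  | mem x hx =>
    obtain ⟨⟨n, v⟩, rfl⟩ := hx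
    simp only [GradedAlgebra.proj_apply]
    by_cases h : n = k
    · subst h
      rw [DirectSum.decompose_of_mem_same (fun i : ℕ => ⋀[R]^i M) (ιMulti_mem v),
        DirectSum.decompose_of_mem_same (fun i : ℕ => ⋀[R]^i N) (map_mem_exteriorPower f (ιMulti_mem v))]
    · rw [DirectSum.decompose_of_mem_ne (fun i : ℕ => ⋀[R]^i M) (ιMulti_mem v) h,
        DirectSum.decompose_of_mem_ne (fun i : ℕ => ⋀[R]^i N) (map_mem_exteriorPower f (ιMulti_mem v)) h, map_zero]
  | zero => simp only [map_zero]
  | add x y _ _ hx hy => simp only [map_add, hx, hy]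
  | smul a x _ hx => simp only [map_smul, hx]

open scoped Classical in
/-- The projection of the exterior algebra onto `extPow R M ρ`, for locally constant `ρ`
(and zero otherwise). -/
noncomputable def extProj (ρ : PrimeSpectrum R → ℕ) (M : Type u) [AddCommGroup M] [Module R M] :
    ExteriorAlgebra R M →ₗ[R] ExteriorAlgebra R M :=
  if h : IsLocallyConstant ρ then
    ∑ k ∈ (exists_idempotents h).choose_spec.choose,
      (exists_idempotents h).choose k • GradedAlgebra.proj (fun i : ℕ => ⋀[R]^i M) k
  else 0

theorem map_extProj (f : M →ₗ[R] N) (ρ : PrimeSpectrum R → ℕ) (x : ExteriorAlgebra R M) :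
    ExteriorAlgebra.map f (extProj ρ M x) = extProj ρ N (ExteriorAlgebra.map f x) := by
  unfold extProj
  split_ifs with h
  · simp only [LinearMap.sum_apply, LinearMap.smul_apply, map_sum, map_smul, proj_map]
  · simp

/-- The element `s` is the idempotent of the fibre of `ρ` through `𝔭`; it is orthogonal to the other
terms of the projection. -/
theorem smul_extProj {ρ : PrimeSpectrum R → ℕ} (hρ : IsLocallyConstant ρ) (𝔭 : PrimeSpectrum R) :
    ∃ s ∉ 𝔭.asIdeal, s * s = s ∧ ∀ x : ExteriorAlgebra R M, s • extProj ρ M x =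
      s • GradedAlgebra.proj (fun i : ℕ => ⋀[R]^i M) (ρ 𝔭) x := by
  have h := (exists_idempotents hρ).choose_spec.choose_spec
  set e := (exists_idempotents hρ).choose with he
  refine ⟨e (ρ 𝔭), (h.1 _ _).2 rfl, h.2.2.2 _, fun x => ?_⟩
  have : extProj ρ M x = ∑ k ∈ (exists_idempotents hρ).choose_spec.choose,
      e k • GradedAlgebra.proj (fun i : ℕ => ⋀[R]^i M) k x := by
    unfold extProj
    rw [dif_pos hρ]
    simp only [LinearMap.sum_apply, LinearMap.smul_apply]
    rfl
  rw [this, Finset.smul_sum, Finset.sum_eq_single (ρ 𝔭)]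
  · rw [smul_smul, h.2.2.2]
  · intro k _ hk
    rw [smul_smul, h.2.1 _ _ hk.symm, zero_smul]
  · intro hn
    exact absurd (h.2.2.1 𝔭) hn

theorem extProj_mem {ρ : PrimeSpectrum R → ℕ} (hρ : IsLocallyConstant ρ) (x : ExteriorAlgebra R M) :
    extProj ρ M x ∈ extPow R M ρ := by
  intro 𝔭
  obtain ⟨s, hs, -, h⟩ := smul_extProj (M := M) hρ 𝔭
  refine ⟨s, hs, ?_⟩
  rw [h x, GradedAlgebra.proj_apply]
  exact Submodule.smul_mem _ _ (SetLike.coe_mem _)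

theorem extProj_eq {ρ : PrimeSpectrum R → ℕ} (hρ : IsLocallyConstant ρ) {x : ExteriorAlgebra R M}
    (hx : x ∈ extPow R M ρ) : extProj ρ M x = x := by
  rw [← sub_eq_zero]
  refine eq_zero_of_locally (R := R) fun 𝔭 => ?_
  obtain ⟨s, hs, -, h⟩ := smul_extProj (M := M) hρ 𝔭
  obtain ⟨t, ht, htx⟩ := hx 𝔭
  refine ⟨t * s, 𝔭.asIdeal.primeCompl.mul_mem ht hs, ?_⟩
  rw [smul_sub, mul_smul, h, smul_comm, ← map_smul, GradedAlgebra.proj_apply,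
    DirectSum.decompose_of_mem_same (fun i : ℕ => ⋀[R]^i M) htx, mul_comm, mul_smul, sub_self]

/-- An element of `⋀^n M` with `n = ρ 𝔭` can be moved into `extPow R M ρ` by an idempotent
outside `𝔭`. -/
theorem exists_smul_mem_extPow {ρ : PrimeSpectrum R → ℕ} (hρ : IsLocallyConstant ρ)
    (𝔭 : PrimeSpectrum R) : ∃ e ∉ 𝔭.asIdeal, ∀ (M : Type u) [AddCommGroup M] [Module R M]
    (x : ExteriorAlgebra R M), x ∈ ⋀[R]^(ρ 𝔭) M → e • x ∈ extPow R M ρ := by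
  obtain ⟨e, s, h1, h2, -, -⟩ := exists_idempotents hρ
  refine ⟨e (ρ 𝔭), (h1 _ _).2 rfl, fun M _ _ x hx 𝔮 => ?_⟩
  refine ⟨e (ρ 𝔮), (h1 _ _).2 rfl, ?_⟩
  by_cases h : ρ 𝔮 = ρ 𝔭
  · rw [h]
    exact Submodule.smul_mem _ _ (Submodule.smul_mem _ _ hx)
  · rw [smul_smul, h2 _ _ h, zero_smul]
    exact Submodule.zero_mem _

theorem extPow_surjective (f : M →ₗ[R] N) (hf : Function.Surjective f) {ρ : PrimeSpectrum R → ℕ}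
    (hρ : IsLocallyConstant ρ) {η : ExteriorAlgebra R N} (hη : η ∈ extPow R N ρ) :
    ∃ y ∈ extPow R M ρ, ExteriorAlgebra.map f y = η := by
  obtain ⟨y, rfl⟩ := ExteriorAlgebra.map_surjective_iff.2 hf η
  -- An arbitrary lift can be projected to the right degree because the projections commute with the
  -- maps induced on exterior algebras.
  exact ⟨extProj ρ M y, extProj_mem hρ y, by rw [map_extProj, extProj_eq hρ hη]⟩

instance exteriorAlgebra_finite {M : Type*} [AddCommGroup M] [Module R M] [Module.Finite R M] :
    Module.Finite R (ExteriorAlgebra R M) := by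
  obtain ⟨n, f, hf⟩ := Module.Finite.exists_fin' R M
  have hfin : Module.Finite R (ExteriorAlgebra R (Fin n → R)) :=
    Module.Finite.of_basis (Pi.basisFun R (Fin n)).ExteriorAlgebra
  exact Module.Finite.of_surjective (ExteriorAlgebra.map f).toLinearMap
    (ExteriorAlgebra.map_surjective_iff.2 hf)

/-- By functoriality, a retract of a free module yields a retract of its exterior algebra, which has
a basis. -/
instance exteriorAlgebra_projective {M : Type*} [AddCommGroup M] [Module R M] [Module.Finite R M]
    [Module.Projective R M] : Module.Projective R (ExteriorAlgebra R M) := by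
  obtain ⟨n, f, hf⟩ := Module.Finite.exists_fin' R M
  obtain ⟨g, hg⟩ := Module.projective_lifting_property f LinearMap.id hf
  have hfree : Module.Free R (ExteriorAlgebra R (Fin n → R)) :=
    Module.Free.of_basis (Pi.basisFun R (Fin n)).ExteriorAlgebra
  refine Module.Projective.of_split (ExteriorAlgebra.map g).toLinearMap
    (ExteriorAlgebra.map f).toLinearMap ?_
  have : (ExteriorAlgebra.map f).comp (ExteriorAlgebra.map g) = AlgHom.id R _ := by
    rw [ExteriorAlgebra.map_comp_map, hg, ExteriorAlgebra.map_id]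
  exact congrArg AlgHom.toLinearMap this

/-- `extProj` with values in `extPow`. -/
noncomputable def extRetract {ρ : PrimeSpectrum R → ℕ} (hρ : IsLocallyConstant ρ) (M : Type u)
    [AddCommGroup M] [Module R M] : ExteriorAlgebra R M →ₗ[R] extPow R M ρ :=
  (extProj ρ M).codRestrict _ (extProj_mem hρ)

theorem extRetract_coe {ρ : PrimeSpectrum R → ℕ} (hρ : IsLocallyConstant ρ) (x : extPow R M ρ) :
    extRetract hρ M x = x := Subtype.ext (extProj_eq hρ x.2)

theorem extPow_finite {ρ : PrimeSpectrum R → ℕ} (hρ : IsLocallyConstant ρ) [Module.Finite R M] :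
    Module.Finite R (extPow R M ρ) :=
  Module.Finite.of_surjective (extRetract hρ M) fun x => ⟨x, extRetract_coe hρ x⟩

theorem extPow_projective {ρ : PrimeSpectrum R → ℕ} (hρ : IsLocallyConstant ρ) [Module.Finite R M]
    [Module.Projective R M] : Module.Projective R (extPow R M ρ) :=
  Module.Projective.of_split (extPow R M ρ).subtype (extRetract hρ M)
    (LinearMap.ext fun x => extRetract_coe hρ x)

end ExtPow

/-! ### Complexes over a local ring `A` for which `A/l` has depth zero, with `l` zero or regular. -/

section LocalRing

open IsLocalRing Module

variable {A : Type*} [CommRing A] [IsLocalRing A]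

theorem one_tmul_eq_zero_iff {P : Type*} [AddCommGroup P] [Module A P] (p : P) :
    (1 : ResidueField A) ⊗ₜ[A] p = 0 ↔ p ∈ (maximalIdeal A • ⊤ : Submodule A P) := by
  rw [← Submodule.Quotient.mk_eq_zero]
  have h := TensorProduct.quotTensorEquivQuotSMul_mk_tmul (M := P) (maximalIdeal A) 1 p
  rw [one_smul] at h
  rw [← h]
  exact ((TensorProduct.quotTensorEquivQuotSMul P (maximalIdeal A)).map_eq_zero_iff).symm

/-- If `α` is injective modulo `l`, and `A / l` has depth zero, then `α` is a split injection. -/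
theorem free_quotient_range {N F : Type*} [AddCommGroup N] [Module A N] [AddCommGroup F] [Module A F]
    [Module.Free A N] [Module.Finite A N] [Module.Free A F] [Module.Finite A F]
    {l t : A} (ht : ¬ l ∣ t) (hl : ∀ m ∈ maximalIdeal A, l ∣ t * m) (α : N →ₗ[A] F)
    (hα : ∀ v w, α v = l • w → ∃ v', v = l • v') : Module.Free A (F ⧸ LinearMap.range α) := by
  have hF : ∀ w ∈ (maximalIdeal A • ⊤ : Submodule A F), ∃ w', t • w = l • w' := by
    intro w hw
    induction hw using Submodule.smul_induction_on' with
    | smul r hr n hn =>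
      obtain ⟨c, hc⟩ := hl r hr
      exact ⟨c • n, by rw [smul_smul, hc, mul_smul]⟩
    | add x _ y _ hx hy =>
      obtain ⟨x', hx⟩ := hx
      obtain ⟨y', hy⟩ := hy
      exact ⟨x' + y', by rw [smul_add, hx, hy, smul_add]⟩
  -- If `α v` lies in `𝔪 F`, then `t • α v` is divisible by `l`, hence so is `t • v`. As `l ∤ t`, no
  -- coordinate of `v` can be a unit. So `α` is injective on residue fibres, which makes its
  -- cokernel free.
  have key : ∀ v : N, α v ∈ (maximalIdeal A • ⊤ : Submodule A F) →
      v ∈ (maximalIdeal A • ⊤ : Submodule A N) := by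
    intro v hv
    obtain ⟨w, hw⟩ := hF _ hv
    rw [← map_smul] at hw
    obtain ⟨v', hv'⟩ := hα _ _ hw
    let b := Module.Free.chooseBasis A N
    rw [← b.sum_repr v]
    refine Submodule.sum_mem _ fun i _ => Submodule.smul_mem_smul ?_ trivial
    by_contra hi
    have hu : IsUnit (b.repr v i) := by simpa using hi
    have h1 : t * b.repr v i = l * b.repr v' i := by
      have := congrArg (fun x => b.repr x i) hv'
      simpa using this
    exact ht ((hu.dvd_mul_right).1 (Dvd.intro _ h1.symm))
  refine Module.free_of_lTensor_residueField_injective α (LinearMap.range α).mkQ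
    (Submodule.mkQ_surjective _) α.exact_map_mkQ_range ?_
  rw [injective_iff_map_eq_zero]
  intro x hx
  obtain ⟨v, rfl⟩ := TensorProduct.mk_surjective A N (ResidueField A) residue_surjective x
  rw [TensorProduct.mk_apply] at hx ⊢
  rw [LinearMap.lTensor_tmul, one_tmul_eq_zero_iff] at hx
  exact (one_tmul_eq_zero_iff v).2 (key v hx)

theorem free_ker_of_free_range {M N : Type*} [AddCommGroup M] [Module A M] [AddCommGroup N] [Module A N]
    [Module.Free A M] [Module.Finite A M] (f : M →ₗ[A] N) (hf : Module.Free A (LinearMap.range f)) :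
    Module.Free A (LinearMap.ker f) ∧ Module.Finite A (LinearMap.ker f) ∧
      finrank A (LinearMap.ker f) + finrank A (LinearMap.range f) = finrank A M := by
  obtain ⟨g, hg⟩ := Module.projective_lifting_property f.rangeRestrict LinearMap.id
    f.surjective_rangeRestrict
  have hg' : ∀ y, f.rangeRestrict (g y) = y := fun y => LinearMap.congr_fun hg y
  have hg'' : ∀ y, f (g y) = y := fun y => congrArg Subtype.val (hg' y)
  let p : M →ₗ[A] LinearMap.ker f :=
    (LinearMap.id - g ∘ₗ f.rangeRestrict).codRestrict _ fun x => by
      simp [hg'']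
  have hp : p ∘ₗ (LinearMap.ker f).subtype = LinearMap.id := by
    ext ⟨x, hx⟩
    have : f.rangeRestrict x = 0 := Subtype.ext hx
    simp [p, this]
  have hfin : Module.Finite A (LinearMap.ker f) :=
    Module.Finite.of_surjective p fun x => ⟨x, LinearMap.congr_fun hp x⟩
  have hproj : Module.Projective A (LinearMap.ker f) := Module.Projective.of_split _ _ hp
  have hfree : Module.Free A (LinearMap.ker f) := Module.free_of_flat_of_isLocalRing
  refine ⟨hfree, hfin, ?_⟩
  let e : M ≃ₗ[A] LinearMap.ker f × LinearMap.range f :=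
    { (p.prod f.rangeRestrict) with
      invFun := fun x => x.1 + g x.2
      left_inv := fun x => by simp [p]
      right_inv := fun x => by
        have : f.rangeRestrict x.1 = 0 := Subtype.ext x.1.2
        refine Prod.ext (Subtype.ext ?_) (Subtype.ext ?_) <;> simp [p, hg', this] }
  rw [e.finrank_eq, finrank_prod]

/-- By exactness `d₁` induces an injection of the free module `M₁ / range d₀` into `M₂`; the last
hypothesis says that it stays injective modulo `l`. -/
theorem free_quotient_step {M₀ M₁ M₂ : Type*} [AddCommGroup M₀] [Module A M₀] [AddCommGroup M₁]
    [Module A M₁] [AddCommGroup M₂] [Module A M₂] [Module.Finite A M₁] [Module.Free A M₂]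
    [Module.Finite A M₂] {l t : A} (ht : ¬ l ∣ t) (hl : ∀ m ∈ maximalIdeal A, l ∣ t * m)
    (d₀ : M₀ →ₗ[A] M₁) (d₁ : M₁ →ₗ[A] M₂) (hker : LinearMap.ker d₁ = LinearMap.range d₀)
    (hfree : Module.Free A (M₁ ⧸ LinearMap.range d₀))
    (h : ∀ v w, d₁ v = l • w → ∃ w', d₁ v = l • d₁ w') :
    Module.Free A (M₂ ⧸ LinearMap.range d₁) := by
  let α := (LinearMap.range d₀).liftQ d₁ hker.ge
  have hα : LinearMap.range α = LinearMap.range d₁ := Submodule.range_liftQ _ _ _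
  rw [← hα]
  refine free_quotient_range ht hl α fun v w hvw => ?_
  obtain ⟨v, rfl⟩ := Submodule.Quotient.mk_surjective _ v
  obtain ⟨w', hw'⟩ := h v w hvw
  refine ⟨Submodule.Quotient.mk w', ?_⟩
  rw [← Submodule.Quotient.mk_smul, Submodule.Quotient.eq, ← hker, LinearMap.mem_ker, map_sub,
    map_smul, hw', sub_self]

/-! ### Bounded free complexes exact outside degree one. -/

section Complex

variable {M : ℤ → Type*} [∀ i, AddCommGroup (M i)] [∀ i, Module A (M i)] [∀ i, Module.Free A (M i)]
  [∀ i, Module.Finite A (M i)] {D : ∀ i j, M i →ₗ[A] M j}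
  (hDD : ∀ i j k (x : M i), D j k (D i j x) = 0)
  (hex : ∀ i, i ≠ 1 → ∀ x : M i, D i (i + 1) x = 0 → ∃ w, D (i - 1) i w = x)

omit [IsLocalRing A] [∀ i, Module.Free A (M i)] [∀ i, Module.Finite A (M i)] in
include hDD hex in
theorem ker_eq_range (i : ℤ) (hi : i ≠ 1) :
    LinearMap.ker (D i (i + 1)) = LinearMap.range (D (i - 1) i) := by
  ext x
  constructor
  · intro hx
    exact hex i hi x hx
  · rintro ⟨w, rfl⟩
    exact hDD _ _ _ w

variable {a b : ℤ} (ha : ∀ i < a, Subsingleton (M i)) (hb : ∀ i > b, Subsingleton (M i))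
  {l t : A} (ht : ¬ l ∣ t) (hl : ∀ m ∈ maximalIdeal A, l ∣ t * m)
  (hreg : l = 0 ∨ ∀ i (v : M i), l • v = 0 → v = 0)

include hDD hex ha ht hl hreg in
-- Induction upwards from the zero terms below degree `a`, stopping at degree `0`, where exactness
-- is still available.
theorem free_quotient_left (n : ℕ) : ∀ i : ℤ, i < a + n → i ≤ 0 →
    Module.Free A (M i ⧸ LinearMap.range (D (i - 1) i)) := by
  induction n with
  | zero =>
    intro i hi _
    have := ha i (by simpa using hi)
    have : Subsingleton (M i ⧸ LinearMap.range (D (i - 1) i)) :=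
      (Submodule.mkQ_surjective (LinearMap.range (D (i - 1) i))).subsingleton
    infer_instance
  | succ n ih =>
    intro i hi hi0
    have h1 := ker_eq_range hDD hex (i - 1) (by omega)
    rw [sub_add_cancel] at h1
    refine free_quotient_step ht hl (D (i - 1 - 1) (i - 1)) (D (i - 1) i) h1
      (ih (i - 1) (by push_cast at hi; omega) (by omega)) fun v w hvw => ?_
    rcases hreg with rfl | hreg
    · exact ⟨0, by rw [hvw]; simp⟩
    -- For regular `l`, the equation `d v = l w` gives `l d w = 0`, so `w` is a cocycle and
    -- therefore a coboundary.
    · have h2 : D i (i + 1) w = 0 := hreg _ _ (by rw [← map_smul, ← hvw, hDD])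
      obtain ⟨w', rfl⟩ := hex i (by omega) w h2
      exact ⟨w', hvw⟩

include hDD hex ha ht hl hreg in
theorem free_quotient_of_nonpos (i : ℤ) (hi : i ≤ 0) :
    Module.Free A (M i ⧸ LinearMap.range (D (i - 1) i)) :=
  free_quotient_left hDD hex ha ht hl hreg (i - a + 1).toNat i (by omega) hi

include hDD hex hb in
-- Induction downwards from degree `b`: a surjection onto a free image splits, so its kernel is
-- free, and by exactness this kernel is the preceding image.
theorem free_range_right (n : ℕ) : ∀ i : ℤ, b - n ≤ i → 1 ≤ i →
    Module.Free A (LinearMap.range (D i (i + 1))) := by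
  induction n with
  | zero =>
    intro i hi _
    have := hb (i + 1) (by push_cast at hi; omega)
    infer_instance
  | succ n ih =>
    intro i hi h1
    have h2 := ih (i + 1) (by push_cast at hi; omega) (by omega)
    have h3 := ker_eq_range hDD hex (i + 1) (by omega)
    rw [add_sub_cancel_right] at h3
    rw [← h3]
    exact (free_ker_of_free_range _ h2).1

include hDD hex ha hb ht hl hreg in
theorem free_range (i : ℤ) : Module.Free A (LinearMap.range (D i (i + 1))) := by
  rcases le_or_gt i 0 with hi | hi
  · have h1 := free_quotient_of_nonpos hDD hex ha ht hl hreg i hi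
    rw [← ker_eq_range hDD hex i (by omega)] at h1
    exact Module.Free.of_equiv (D i (i + 1)).quotKerEquivRange
  · exact free_range_right hDD hex hb (b - i).toNat i (by omega) (by omega)

include hDD hex ha hb ht hl hreg in
theorem finrank_range_add (i : ℤ) (hi : i ≠ 1) :
    finrank A (LinearMap.range (D (i - 1) i)) + finrank A (LinearMap.range (D i (i + 1))) =
      finrank A (M i) := by
  rw [← ker_eq_range hDD hex i hi]
  exact (free_ker_of_free_range _ (free_range hDD hex ha hb ht hl hreg i)).2.2

include hDD hex ha hb ht hl hreg in
-- The hypothesis `h` carries the freeness of cokernels one step further, to `M 1 / range (D 0 1)`.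
-- Then `H¹`, the kernel of a map from this module onto a free image, is free, and `z` lifts a basis
-- of it.
theorem exists_H1_generators
    (h : ∀ (v : M 0) (w : M 1), D 0 1 v = l • w → ∃ w', D 0 1 v = l • D 0 1 w') :
    ∃ n : ℕ, finrank A (LinearMap.range (D 0 1)) + n + finrank A (LinearMap.range (D 1 2)) =
      finrank A (M 1) ∧ ∃ z : Fin n → M 1, (∀ j, D 1 2 (z j) = 0) ∧
        ∀ x, D 1 2 x = 0 → ∃ w, ∃ c : Fin n → A, x = D 0 1 w + ∑ j, c j • z j := by
  have h0 : Module.Free A (M 1 ⧸ LinearMap.range (D 0 1)) :=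
    free_quotient_step ht hl (D (0 - 1) 0) (D 0 1) (ker_eq_range hDD hex 0 (by decide))
      (free_quotient_of_nonpos hDD hex ha ht hl hreg 0 le_rfl) h
  have hle : LinearMap.range (D 0 1) ≤ LinearMap.ker (D 1 2) := by
    rintro _ ⟨w, rfl⟩
    exact hDD _ _ _ w
  let q := (LinearMap.range (D 0 1)).liftQ (D 1 2) hle
  have hq : LinearMap.range q = LinearMap.range (D 1 2) := Submodule.range_liftQ _ _ _
  obtain ⟨k1, k2, k3⟩ := free_ker_of_free_range q
    (by rw [hq]; exact free_range hDD hex ha hb ht hl hreg 1)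
  obtain ⟨-, -, m3⟩ := free_ker_of_free_range (LinearMap.range (D 0 1)).mkQ (by
    rw [Submodule.range_mkQ]
    exact Module.Free.of_equiv Submodule.topEquiv.symm)
  rw [Submodule.ker_mkQ, Submodule.range_mkQ, finrank_top] at m3
  rw [hq] at k3
  refine ⟨finrank A (LinearMap.ker q), by omega, ?_⟩
  let bs := Module.finBasis A (LinearMap.ker q)
  have hz : ∀ j, ∃ z : M 1, Submodule.Quotient.mk z = (bs j : M 1 ⧸ LinearMap.range (D 0 1)) :=
    fun j => Submodule.Quotient.mk_surjective _ _
  choose z hz using hz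
  refine ⟨z, fun j => ?_, fun x hx => ?_⟩
  · have : q (bs j : M 1 ⧸ LinearMap.range (D 0 1)) = 0 := (bs j).2
    rw [← hz j] at this
    exact this
  · let x' : LinearMap.ker q := ⟨Submodule.Quotient.mk x, hx⟩
    have h1 : Submodule.Quotient.mk x = ∑ j, bs.repr x' j •
        (Submodule.Quotient.mk (z j) : M 1 ⧸ LinearMap.range (D 0 1)) := by
      have := congrArg Subtype.val (bs.sum_repr x').symm
      simp only [Submodule.coe_sum, Submodule.coe_smul, ← hz] at this
      exact this
    have h2 : x - ∑ j, bs.repr x' j • z j ∈ LinearMap.range (D 0 1) := by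
      rw [← Submodule.Quotient.mk_eq_zero, Submodule.Quotient.mk_sub, h1, sub_eq_zero]
      exact (map_sum (LinearMap.range (D 0 1)).mkQ _ _).symm
    obtain ⟨w, hw⟩ := h2
    exact ⟨w, bs.repr x', by rw [hw, sub_add_cancel]⟩

end Complex

end LocalRing

/-! ### Primes of height at most one have depth at most one. -/

section Depth

variable {R : Type u} [CommRing R] [IsNoetherianRing R]

open IsLocalRing in
/-- A prime `q` of height at most one is minimal over an element `l` which is zero or regular. -/
theorem SerreTwo.exists_minimal_over (hR : SerreTwo R) (q : Ideal R) [q.IsPrime] (hq : q.height ≤ 1) :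
    ∃ l ∈ q, (q ∈ minimalPrimes R → l = 0) ∧ (l = 0 ∨ l ∈ nonZeroDivisors R) ∧
      ∃ t : Localization.AtPrime q, ¬ algebraMap R _ l ∣ t ∧
        ∀ m ∈ maximalIdeal (Localization.AtPrime q), algebraMap R _ l ∣ t * m := by
  -- For minimal `q` take `l = 0`. Otherwise take a non-zero-divisor in `q`; a smaller prime
  -- containing it would be minimal, which is impossible.
  obtain ⟨l, hl, h1, h2, h3⟩ : ∃ l ∈ q, (q ∈ minimalPrimes R → l = 0) ∧
      (l = 0 ∨ l ∈ nonZeroDivisors R) ∧ ∀ p : Ideal R, p.IsPrime → p ≤ q → l ∈ p → p = q := by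
    by_cases hmin : q ∈ minimalPrimes R
    · exact ⟨0, q.zero_mem, fun _ => rfl, Or.inl rfl, fun p hp hpq _ =>
        le_antisymm hpq (hmin.2 ⟨hp, bot_le⟩ hpq)⟩
    · obtain ⟨l, hl, hl'⟩ := hR.exists_mem_nonZeroDivisors q fun p hp => by
        by_contra! hle
        have : p.IsPrime := hp.1.1
        exact hmin ((le_antisymm hle (hp.2 ⟨‹q.IsPrime›, bot_le⟩ hle)) ▸ hp)
      refine ⟨l, hl, fun h => absurd h hmin, Or.inr hl', fun p hp hpq hlp => ?_⟩
      by_contra hne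
      have h1 := (Ideal.height_add_one_le_of_lt_of_isPrime (lt_of_le_of_ne hpq hne)).trans hq
      have h2 : p.height + 1 ≤ 0 + 1 := by simpa using h1
      have h3 := (ENat.add_le_add_iff_right (ENat.natCast_ne_top 1)).1 h2
      exact notMem_minimalPrimes_of_mem_nonZeroDivisors hl'
        (Ideal.height_eq_zero_iff.1 (le_zero_iff.1 h3)) hlp
  refine ⟨l, hl, h1, h2, ?_⟩
  set A := Localization.AtPrime q
  have hunder : (maximalIdeal A).comap (algebraMap R A) = q := IsLocalization.AtPrime.under_maximalIdeal A q
  -- Every prime of `A` containing `l` contracts to a prime inside `q` containing `l`, that is to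
  -- `q` itself.
  have hrad : maximalIdeal A ≤ (Ideal.span {algebraMap R A l}).radical := by
    rw [Ideal.radical_eq_sInf]
    refine le_sInf fun J hJ => ?_
    have hJp : J.IsPrime := hJ.2
    have hlJ : algebraMap R A l ∈ J := hJ.1 (Ideal.mem_span_singleton_self _)
    have hle : J.comap (algebraMap R A) ≤ q :=
      (Ideal.comap_mono (le_maximalIdeal hJp.ne_top)).trans hunder.le
    have h4 := h3 _ (Ideal.IsPrime.comap (algebraMap R A)) hle hlJ
    have h5 := IsLocalization.map_under q.primeCompl A J
    have h6 := IsLocalization.map_under q.primeCompl A (maximalIdeal A)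
    have h7 : (J.under R) = (maximalIdeal A).under R := h4.trans hunder.symm
    rw [← h6, ← h7, h5]
  obtain ⟨n, hn⟩ := Ideal.exists_radical_pow_le_of_fg (Ideal.span {algebraMap R A l})
    (IsNoetherian.noetherian _)
  have hex : ∃ n, maximalIdeal A ^ n ≤ Ideal.span {algebraMap R A l} :=
    ⟨n, (Ideal.pow_right_mono hrad n).trans hn⟩
  classical
  have hspec := Nat.find_spec hex
  -- With `k + 1` the least power of the maximal ideal lying in `(l)`, any `t` in the `k`-th power
  -- outside `(l)` gives a nonzero socle element of `A/l`. The least exponent is positive because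
  -- `l` is not a unit.
  obtain ⟨k, hk⟩ : ∃ k, Nat.find hex = k + 1 := by
    refine Nat.exists_eq_succ_of_ne_zero fun h0 => ?_
    rw [h0, pow_zero, Ideal.one_eq_top] at hspec
    have hu : IsUnit (algebraMap R A l) := Ideal.span_singleton_eq_top.1 (top_le_iff.1 hspec)
    exact (IsLocalization.AtPrime.isUnit_to_map_iff A q l).1 hu hl
  have hmin := Nat.find_min hex (m := k) (by omega)
  obtain ⟨t, ht, htl⟩ := SetLike.not_le_iff_exists.1 hmin
  refine ⟨t, fun h => htl (Ideal.mem_span_singleton.2 h), fun m hm => ?_⟩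
  rw [← Ideal.mem_span_singleton]
  rw [hk, pow_succ] at hspec
  exact hspec (Ideal.mul_mem_mul ht hm)

end Depth

/-! ### Clearing denominators. -/

section Clearing

variable {R : Type u} [CommRing R] {M N : Type*} [AddCommGroup M] [Module R M]
  [AddCommGroup N] [Module R N]

theorem exists_smul_mem_of_mk_mem_span {q : Ideal R} [q.IsPrime] (L : Submodule R M) {x : M}
    (hx : LocalizedModule.mk x (1 : q.primeCompl) ∈ Submodule.span (Localization.AtPrime q)
      ((fun m => LocalizedModule.mk m (1 : q.primeCompl)) '' (L : Set M))) :
    ∃ s ∉ q, s • x ∈ L := by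
  have key : ∀ y ∈ Submodule.span (Localization.AtPrime q)
      ((fun m => LocalizedModule.mk m (1 : q.primeCompl)) '' (L : Set M)),
      ∃ m ∈ L, ∃ s : q.primeCompl, y = LocalizedModule.mk m s := by
    intro y hy
    induction hy using Submodule.span_induction with
    | mem y hy =>
      obtain ⟨m, hm, rfl⟩ := hy
      exact ⟨m, hm, 1, rfl⟩
    | zero => exact ⟨0, L.zero_mem, 1, (LocalizedModule.zero_mk 1).symm⟩
    | add y z _ _ hy hz =>
      obtain ⟨m, hm, s, rfl⟩ := hy
      obtain ⟨n, hn, t, rfl⟩ := hz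
      exact ⟨_, L.add_mem (L.smul_mem _ hm) (L.smul_mem _ hn), _, LocalizedModule.mk_add_mk⟩
    | smul a y _ hy =>
      obtain ⟨m, hm, s, rfl⟩ := hy
      obtain ⟨r, t, rfl⟩ := IsLocalization.exists_mk'_eq q.primeCompl a
      refine ⟨r • m, L.smul_mem _ hm, t * s, ?_⟩
      rw [← Localization.mk_eq_mk', LocalizedModule.mk_smul_mk]
  obtain ⟨m, hm, s, h⟩ := key _ hx
  obtain ⟨u, hu⟩ := LocalizedModule.mk_eq.1 h
  refine ⟨u * s, q.primeCompl.mul_mem u.2 s.2, ?_⟩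
  have : ((u : R) * (s : R)) • x = (u : R) • m := by
    rw [mul_smul]
    simpa [Submonoid.smul_def] using hu
  rw [this]
  exact L.smul_mem _ hm

theorem exists_uniform_smul_mem {M N : Type*} [AddCommMonoid M] [Module R M] [AddCommMonoid N]
    [Module R N] {q : Ideal R} [q.IsPrime] [Module.Finite R M] (φ : M →ₗ[R] N)
    (L : Submodule R N) (h : ∀ x, ∃ s ∉ q, s • φ x ∈ L) : ∃ s ∉ q, ∀ x, s • φ x ∈ L := by
  have key : ∀ S : Finset M, ∃ s ∉ q, ∀ x ∈ Submodule.span R (S : Set M), s • φ x ∈ L := by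
    classical
    intro S
    induction S using Finset.induction_on with
    | empty =>
      refine ⟨1, q.primeCompl.one_mem, fun x hx => ?_⟩
      simp only [Finset.coe_empty, Submodule.span_empty, Submodule.mem_bot] at hx
      simp [hx]
    | insert a S _ ih =>
      obtain ⟨s, hs, ih⟩ := ih
      obtain ⟨t, ht, hat⟩ := h a
      refine ⟨s * t, q.primeCompl.mul_mem hs ht, fun x hx => ?_⟩
      rw [Finset.coe_insert, Submodule.mem_span_insert] at hx
      obtain ⟨c, y, hy, rfl⟩ := hx
      rw [map_add, smul_add, map_smul]
      refine L.add_mem ?_ ?_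
      · rw [mul_smul, smul_comm t c]
        exact L.smul_mem _ (L.smul_mem _ hat)
      · rw [mul_comm, mul_smul]
        exact L.smul_mem _ (ih y hy)
  obtain ⟨S, hS⟩ := (Module.Finite.fg_top : (⊤ : Submodule R M).FG)
  obtain ⟨s, hs, h⟩ := key S
  exact ⟨s, hs, fun x => h x (hS ▸ trivial)⟩

end Clearing

/-! ### Localization of the complex at primes of height at most one. -/

section PerfectComplex

variable {R : Type u} [CommRing R] {X : ℤ → Type u} [∀ i, AddCommGroup (X i)]
  [∀ i, Module R (X i)]

/-- A bounded complex in degrees `a, …, b` whose localizations at primes of height at most one are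
exact except in degree `1`. -/
structure CodimOneExact (d : ∀ i j, X i →ₗ[R] X j) (a b : ℤ) : Prop where
  a_le : a ≤ 1
  le_b : 1 ≤ b
  dd : ∀ i j k (x : X i), d j k (d i j x) = 0
  subsingleton : ∀ i ∉ Finset.Icc a b, Subsingleton (X i)
  exact : ∀ q : Ideal R, q.IsPrime → q.height ≤ 1 → ∀ i ≠ 1, ∀ x : X i, d i (i + 1) x = 0 →
    ∃ s ∉ q, ∃ w, d (i - 1) i w = s • x

/-- `H¹` is torsion free at `q`. -/
def H1TorsionFreeAt (d : ∀ i j, X i →ₗ[R] X j) (q : Ideal R) : Prop :=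
  ∀ l ∈ nonZeroDivisors R, ∀ (w : X 0) (z : X 1), d 0 1 w = l • z →
    ∃ s ∉ q, ∃ w', d 0 1 w' = s • z

/-- The rank of the image of `d i (i + 1)` at `q`. -/
noncomputable def imageRank (d : ∀ i j, X i →ₗ[R] X j) (q : Ideal R) [q.IsPrime] (i : ℤ) : ℕ :=
  Module.finrank (Localization.AtPrime q)
    (LinearMap.range (LocalizedModule.map q.primeCompl (d i (i + 1))))

variable {d : ∀ i j, X i →ₗ[R] X j} {a b : ℤ}

theorem imageRank_eq (q : Ideal R) [q.IsPrime] {i j : ℤ} (hij : i + 1 = j) :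
    imageRank d q i = Module.finrank (Localization.AtPrime q)
      (LinearMap.range (LocalizedModule.map q.primeCompl (d i j))) := by
  subst hij
  rfl

theorem CodimOneExact.localized_dd (h : CodimOneExact d a b) (q : Ideal R) [q.IsPrime] (i j k : ℤ)
    (x : LocalizedModule q.primeCompl (X i)) : LocalizedModule.map q.primeCompl (d j k)
      (LocalizedModule.map q.primeCompl (d i j) x) = 0 := by
  induction x using LocalizedModule.induction_on with
  | _ m s => rw [LocalizedModule.map_mk, LocalizedModule.map_mk, h.dd, LocalizedModule.zero_mk]

theorem CodimOneExact.localized_exact (h : CodimOneExact d a b) (q : Ideal R) [q.IsPrime]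
    (hq : q.height ≤ 1) (i : ℤ) (hi : i ≠ 1) (x : LocalizedModule q.primeCompl (X i))
    (hx : LocalizedModule.map q.primeCompl (d i (i + 1)) x = 0) :
    ∃ w, LocalizedModule.map q.primeCompl (d (i - 1) i) w = x := by
  induction x using LocalizedModule.induction_on with
  | _ m s =>
    rw [LocalizedModule.map_mk, ← LocalizedModule.zero_mk s, LocalizedModule.mk_eq] at hx
    obtain ⟨u, hu⟩ := hx
    have h1 : d i (i + 1) (((u : R) * (s : R)) • m) = 0 := by
      rw [map_smul, mul_smul]
      simpa [Submonoid.smul_def] using hu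
    obtain ⟨t, ht, w, hw⟩ := h.exact q ‹_› hq i hi _ h1
    refine ⟨LocalizedModule.mk w ((⟨t, ht⟩ : q.primeCompl) * u * s * s), ?_⟩
    rw [LocalizedModule.map_mk, hw, LocalizedModule.mk_eq]
    refine ⟨1, ?_⟩
    simp only [Submonoid.smul_def, smul_smul, Submonoid.coe_mul, Submonoid.coe_one]
    congr 1
    ring

theorem CodimOneExact.localized_subsingleton (h : CodimOneExact d a b) (q : Ideal R) [q.IsPrime]
    (i : ℤ) (hi : i ∉ Finset.Icc a b) : Subsingleton (LocalizedModule q.primeCompl (X i)) := by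
  have := h.subsingleton i hi
  refine ⟨fun x y => ?_⟩
  induction x, y using LocalizedModule.induction_on₂ with
  | _ m n s t =>
    rw [Subsingleton.elim m 0, Subsingleton.elim n 0, LocalizedModule.zero_mk, LocalizedModule.zero_mk]

section

variable [IsNoetherianRing R] [∀ i, Module.Finite R (X i)] [∀ i, Module.Projective R (X i)]

instance localized_free (q : Ideal R) [q.IsPrime] (M : Type*) [AddCommGroup M] [Module R M]
    [Module.Finite R M] [Module.Projective R M] :
    Module.Free (Localization.AtPrime q) (LocalizedModule q.primeCompl M) :=
  Module.free_of_flat_of_isLocalRing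

omit [IsNoetherianRing R] in
-- Elements of a projective module are detected by functionals, so a non-zero-divisor acts
-- injectively on it and on its localizations.
theorem smul_eq_zero_of_localized {l : R} (hl : l ∈ nonZeroDivisors R) (q : Ideal R) [q.IsPrime]
    (M : Type*) [AddCommGroup M] [Module R M] [Module.Projective R M]
    (v : LocalizedModule q.primeCompl M) (hv : algebraMap R (Localization.AtPrime q) l • v = 0) :
    v = 0 := by
  induction v using LocalizedModule.induction_on with
  | _ m s =>
    rw [algebraMap_smul, LocalizedModule.smul'_mk, ← LocalizedModule.zero_mk s,
      LocalizedModule.mk_eq] at hv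
    obtain ⟨u, hu⟩ := hv
    rw [← LocalizedModule.zero_mk s, LocalizedModule.mk_eq]
    refine ⟨u, ?_⟩
    simp only [smul_zero, Submonoid.smul_def] at hu ⊢
    refine (Module.forall_dual_apply_eq_zero_iff R _).1 fun φ => ?_
    refine mem_nonZeroDivisors_iff_left.1 hl _ ?_
    have := congrArg φ hu
    simp only [map_smul, smul_eq_mul, map_zero] at this ⊢
    linear_combination this

theorem CodimOneExact.imageRank_add (h : CodimOneExact d a b) (hR : SerreTwo R) (q : Ideal R)
    [q.IsPrime] (hq : q.height ≤ 1) (i : ℤ) (hi : i ≠ 1) :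
    imageRank d q (i - 1) + imageRank d q i =
      Module.rankAtStalk (R := R) (X i) ⟨q, ‹_›⟩ := by
  obtain ⟨l, hlq, -, hl, t, ht, hlt⟩ := hR.exists_minimal_over q hq
  have := finrank_range_add (a := a) (b := b) (D := fun i j => LocalizedModule.map q.primeCompl (d i j))
    (h.localized_dd q) (h.localized_exact q hq)
    (fun i hi => h.localized_subsingleton q i (by simp; omega))
    (fun i hi => h.localized_subsingleton q i (by simp; omega)) ht hlt
    (hl.imp (fun h => by rw [h, map_zero]) fun hl i v hv => smul_eq_zero_of_localized hl q _ v hv)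
    i hi
  rw [imageRank_eq q (sub_add_cancel i 1)]
  exact this

omit [IsNoetherianRing R] [∀ i, Module.Finite R (X i)] [∀ i, Module.Projective R (X i)] in
theorem CodimOneExact.imageRank_eq_zero (h : CodimOneExact d a b) (q : Ideal R)
    [q.IsPrime] (i : ℤ) (hi : i ∉ Finset.Ico a b) : imageRank d q i = 0 := by
  rcases lt_or_ge i a with hia | hia
  · have := h.localized_subsingleton q i (by simp; omega)
    have : Subsingleton (LinearMap.range (LocalizedModule.map q.primeCompl (d i (i + 1)))) :=
      (LinearMap.surjective_rangeRestrict _).subsingleton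
    exact Module.finrank_zero_of_subsingleton
  · have := h.localized_subsingleton q (i + 1) (by simp at hi ⊢; omega)
    exact Module.finrank_zero_of_subsingleton

/-- Elements of `X i` whose images generate the image of `d i (i + 1)` at `q`. -/
theorem CodimOneExact.exists_image_generators (h : CodimOneExact d a b) (hR : SerreTwo R) (q : Ideal R)
    [q.IsPrime] (hq : q.height ≤ 1) (i : ℤ) :
    ∃ f : Fin (imageRank d q i) → X i, ∃ s ∉ q, ∀ x, ∃ c : Fin (imageRank d q i) → R,
      s • d i (i + 1) x = ∑ j, c j • d i (i + 1) (f j) := by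
  obtain ⟨l, hlq, -, hl, t, ht, hlt⟩ := hR.exists_minimal_over q hq
  have hfree := free_range (a := a) (b := b) (D := fun i j => LocalizedModule.map q.primeCompl (d i j))
    (h.localized_dd q) (h.localized_exact q hq)
    (fun i hi => h.localized_subsingleton q i (by simp; omega))
    (fun i hi => h.localized_subsingleton q i (by simp; omega)) ht hlt
    (hl.imp (fun h => by rw [h, map_zero]) fun hl i v hv => smul_eq_zero_of_localized hl q _ v hv)
    i
  let D := LocalizedModule.map q.primeCompl (d i (i + 1))
  let bs := Module.finBasis (Localization.AtPrime q) (LinearMap.range D)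
  have hf : ∀ j, ∃ f : X i, ∃ s : q.primeCompl, D (LocalizedModule.mk f s) = bs j := by
    intro j
    obtain ⟨y, hy⟩ := (bs j).2
    induction y using LocalizedModule.induction_on with
    | _ f s => exact ⟨f, s, hy⟩
  choose f s hfs using hf
  have hlocal : ∀ x : X i, ∃ r ∉ q, r • d i (i + 1) x ∈
      Submodule.span R (Set.range fun j => d i (i + 1) (f j)) := by
    intro x
    apply exists_smul_mem_of_mk_mem_span
    have h1 : LocalizedModule.mk (d i (i + 1) x) (1 : q.primeCompl) =
        ∑ j, bs.repr ⟨_, LocalizedModule.mk x 1, rfl⟩ j • D (LocalizedModule.mk (f j) (s j)) := by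
      have := congrArg Subtype.val (bs.sum_repr ⟨_, LocalizedModule.mk x 1, rfl⟩)
      simp only [Submodule.coe_sum, Submodule.coe_smul, ← hfs] at this
      rw [this, LocalizedModule.map_mk]
    rw [h1]
    refine Submodule.sum_mem _ fun j _ => Submodule.smul_mem _ _ ?_
    have h2 : D (LocalizedModule.mk (f j) (s j)) =
        Localization.mk 1 (s j) • LocalizedModule.mk (d i (i + 1) (f j)) (1 : q.primeCompl) := by
      rw [LocalizedModule.mk_smul_mk, LocalizedModule.map_mk, one_smul, mul_one]
    rw [h2]
    exact Submodule.smul_mem _ _ (Submodule.subset_span ⟨_, Submodule.subset_span ⟨j, rfl⟩, rfl⟩)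
  obtain ⟨r, hr, hr'⟩ := exists_uniform_smul_mem (d i (i + 1)) _ hlocal
  refine ⟨f, r, hr, fun x => ?_⟩
  obtain ⟨c, hc⟩ := (Submodule.mem_span_range_iff_exists_fun R).1 (hr' x)
  exact ⟨c, hc.symm⟩

/-- If `H¹` is torsion free at `q`, or `q` is minimal, then `H¹` is free at `q`. -/
theorem CodimOneExact.exists_H1_generators (h : CodimOneExact d a b) (hR : SerreTwo R) (q : Ideal R)
    [q.IsPrime] (hq : q.height ≤ 1) (hgood : q ∈ minimalPrimes R ∨ H1TorsionFreeAt d q) :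
    ∃ n : ℕ, imageRank d q 0 + n + imageRank d q 1 = Module.rankAtStalk (R := R) (X 1) ⟨q, ‹_›⟩ ∧
      ∃ z : Fin n → LinearMap.ker (d 1 2), ∃ s ∉ q, ∀ x : LinearMap.ker (d 1 2), ∃ w, ∃ c : Fin n → R,
        s • (x : X 1) = d 0 1 w + ∑ j, c j • (z j : X 1) := by
  obtain ⟨l, hlq, hl0, hl, t, ht, hlt⟩ := hR.exists_minimal_over q hq
  obtain ⟨n, hn, z, hz, hspan⟩ := PerfectDet.exists_H1_generators (a := a) (b := b)
    (D := fun i j => LocalizedModule.map q.primeCompl (d i j))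
    (h.localized_dd q) (h.localized_exact q hq)
    (fun i hi => h.localized_subsingleton q i (by simp; omega))
    (fun i hi => h.localized_subsingleton q i (by simp; omega)) ht hlt
    (hl.imp (fun h => by rw [h, map_zero]) fun hl i v hv => smul_eq_zero_of_localized hl q _ v hv)
    (fun v w hvw => by
      rcases hl with rfl | hl
      · exact ⟨0, by rw [hvw]; simp⟩
      -- At a minimal prime `l` was chosen to be zero, so a regular `l` leaves only the torsion free
      -- alternative.
      have htf : H1TorsionFreeAt d q := hgood.resolve_left fun hm => by
        have hc := hl0 hm
        subst hc
        exact notMem_minimalPrimes_of_mem_nonZeroDivisors hl hm hlq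
      induction v using LocalizedModule.induction_on with
      | _ v s =>
      induction w using LocalizedModule.induction_on with
      | _ w s' =>
        have hvw' := hvw
        rw [algebraMap_smul, LocalizedModule.map_mk, LocalizedModule.smul'_mk,
          LocalizedModule.mk_eq] at hvw
        obtain ⟨u, hu⟩ := hvw
        have h1 : d 0 1 (((u : R) * s') • v) = l • (((u : R) * s) • w) := by
          rw [map_smul]
          simp only [Submonoid.smul_def] at hu
          rw [mul_smul, hu, smul_smul, smul_smul, smul_smul]
          congr 1
          ring
        obtain ⟨r, hr, w', hw'⟩ := htf l hl _ _ h1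
        refine ⟨LocalizedModule.mk w' ((⟨r, hr⟩ : q.primeCompl) * u * s * s'), ?_⟩
        rw [hvw']
        congr 1
        rw [LocalizedModule.map_mk, hw', LocalizedModule.mk_eq]
        refine ⟨1, ?_⟩
        simp only [Submonoid.smul_def, smul_smul, Submonoid.coe_mul, Submonoid.coe_one]
        congr 1
        ring)
  refine ⟨n, hn, ?_⟩
  have hz' : ∀ j, ∃ z' : LinearMap.ker (d 1 2), ∃ s : q.primeCompl,
      z j = LocalizedModule.mk (z' : X 1) s := by
    intro j
    have := hz j
    generalize z j = y at this
    induction y using LocalizedModule.induction_on with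
    | _ y s =>
      rw [LocalizedModule.map_mk, ← LocalizedModule.zero_mk s, LocalizedModule.mk_eq] at this
      obtain ⟨u, hu⟩ := this
      -- Multiplying by `u * s` turns a cocycle of the localization into a cocycle of the complex;
      -- the new denominator compensates.
      refine ⟨⟨((u : R) * (s : R)) • y, ?_⟩, u * s * s, ?_⟩
      · rw [LinearMap.mem_ker, map_smul, mul_smul]
        simpa [Submonoid.smul_def] using hu
      · rw [LocalizedModule.mk_eq]
        refine ⟨1, ?_⟩
        simp only [Submonoid.smul_def, smul_smul, Submonoid.coe_mul, Submonoid.coe_one]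
        congr 1
        ring
  choose z' s hzs using hz'
  have hlocal : ∀ x : LinearMap.ker (d 1 2), ∃ r ∉ q, r • (LinearMap.ker (d 1 2)).subtype x ∈
      LinearMap.range (d 0 1) ⊔ Submodule.span R (Set.range fun j => (z' j : X 1)) := by
    intro x
    apply exists_smul_mem_of_mk_mem_span
    obtain ⟨w, c, hw⟩ := hspan (LocalizedModule.mk (x : X 1) (1 : q.primeCompl)) (by
      rw [LocalizedModule.map_mk, x.2, LocalizedModule.zero_mk])
    rw [Submodule.subtype_apply, hw]
    have hmk : ∀ (y : X 1) (s : q.primeCompl), y ∈ LinearMap.range (d 0 1) ⊔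
        Submodule.span R (Set.range fun j => (z' j : X 1)) →
        LocalizedModule.mk y s ∈ Submodule.span (Localization.AtPrime q)
      ((fun m => LocalizedModule.mk m (1 : q.primeCompl)) '' ((LinearMap.range (d 0 1) ⊔
        Submodule.span R (Set.range fun j => (z' j : X 1)) : Submodule R (X 1)) : Set (X 1))) := by
      intro y s hy
      have h2 : LocalizedModule.mk y s =
          Localization.mk 1 s • LocalizedModule.mk y (1 : q.primeCompl) := by
        rw [LocalizedModule.mk_smul_mk, one_smul, mul_one]
      rw [h2]
      exact Submodule.smul_mem _ _ (Submodule.subset_span ⟨_, hy, rfl⟩)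
    refine Submodule.add_mem _ ?_ (Submodule.sum_mem _ fun j _ => Submodule.smul_mem _ _ ?_)
    · induction w using LocalizedModule.induction_on with
      | _ w s =>
        rw [LocalizedModule.map_mk]
        exact hmk _ _ (Submodule.mem_sup_left ⟨_, rfl⟩)
    · rw [hzs]
      exact hmk _ _ (Submodule.mem_sup_right (Submodule.subset_span ⟨j, rfl⟩))
  obtain ⟨r, hr, hr'⟩ := exists_uniform_smul_mem _ _ hlocal
  refine ⟨z', r, hr, fun x => ?_⟩
  obtain ⟨_, ⟨w, rfl⟩, y, hy, hsum⟩ := Submodule.mem_sup.1 (hr' x)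
  obtain ⟨c, rfl⟩ := (Submodule.mem_span_range_iff_exists_fun R).1 hy
  exact ⟨w, c, hsum.symm⟩

end

end PerfectComplex

/-! ### The rank functions and the Euler characteristic. -/

section Ranks

variable {R : Type u} [CommRing R] {X : ℤ → Type u} [∀ i, AddCommGroup (X i)]
  [∀ i, Module R (X i)]

/-- The function `l` in degree `1`, and `0` in all other degrees. -/
def degOne (l : PrimeSpectrum R → ℕ) (i : ℤ) (𝔭 : PrimeSpectrum R) : ℕ := if i = 1 then l 𝔭 else 0

variable (R X) in
/-- `r i` is the generic rank of the `i`-th differential and `l` is the generic rank of `H¹`. -/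
structure RankData (a b : ℤ) (r : ℤ → PrimeSpectrum R → ℕ) (l : PrimeSpectrum R → ℕ) : Prop where
  eq_zero : ∀ i ∉ Finset.Ico a b, ∀ 𝔭, r i 𝔭 = 0
  add : ∀ i 𝔭, r (i - 1) 𝔭 + degOne l i 𝔭 + r i 𝔭 = Module.rankAtStalk (R := R) (X i) 𝔭
  loc : ∀ i, IsLocallyConstant (r i)
  loc_l : IsLocallyConstant l

/-- The relations determine `r` recursively, upwards from `a` to degree `0` and downwards from `b`
to degree `1`; the relation in degree `1` is not needed. -/
theorem rank_unique {a b : ℤ} {n : ℤ → ℕ} {r r' : ℤ → ℕ}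
    (hr : ∀ i ∉ Finset.Ico a b, r i = 0) (hr' : ∀ i ∉ Finset.Ico a b, r' i = 0)
    (h : ∀ i ≠ 1, r (i - 1) + r i = n i) (h' : ∀ i ≠ 1, r' (i - 1) + r' i = n i) (i : ℤ) :
    r i = r' i := by
  have h1 : ∀ k : ℕ, ∀ i : ℤ, i < a + k → i ≤ 0 → r i = r' i := by
    intro k
    induction k with
    | zero =>
      intro i hi _
      rw [hr i (by simp; push_cast at hi; omega), hr' i (by simp; push_cast at hi; omega)]
    | succ k ih =>
      intro i hi hi0
      have := ih (i - 1) (by push_cast at hi; omega) (by omega)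
      have := h i (by omega)
      have := h' i (by omega)
      omega
  have h2 : ∀ k : ℕ, ∀ i : ℤ, b - k ≤ i → 1 ≤ i → r i = r' i := by
    intro k
    induction k with
    | zero =>
      intro i hi _
      rw [hr i (by simp; push_cast at hi; omega), hr' i (by simp; push_cast at hi; omega)]
    | succ k ih =>
      intro i hi hi0
      have := ih (i + 1) (by push_cast at hi; omega) (by omega)
      have h3 := h (i + 1) (by omega)
      have h4 := h' (i + 1) (by omega)
      rw [add_sub_cancel_right] at h3 h4
      omega
  rcases le_or_gt i 0 with hi | hi
  · exact h1 (i - a + 1).toNat i (by omega) hi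
  · exact h2 (b - i).toNat i (by omega) (by omega)

theorem sum_Icc_telescope (g : ℤ → ℤ) (a : ℤ) (n : ℕ) :
    ∑ i ∈ Finset.Icc a (a + n), (g (i - 1) - g i) = g (a - 1) - g (a + n) := by
  induction n with
  | zero => simp
  | succ n ih =>
    have : Finset.Icc a (a + (n + 1 : ℕ)) = insert (a + (n + 1 : ℕ)) (Finset.Icc a (a + n)) := by
      ext i
      simp only [Finset.mem_Icc, Finset.mem_insert]
      push_cast
      omega
    rw [this, Finset.sum_insert (by simp), ih]
    have h : a + ((n + 1 : ℕ) : ℤ) - 1 = a + n := by push_cast; ring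
    rw [h]
    ring

/-- Substituting `r (i - 1) + r i` for the ranks makes the sum telescope; only the extra `l` in
degree `1` survives. -/
theorem alternating_sum_eq {a b : ℤ} (ha : a ≤ 1) (hb : 1 ≤ b) {r n : ℤ → ℕ} {l : ℤ}
    (hr : ∀ i ∉ Finset.Ico a b, r i = 0) (h : ∀ i ≠ 1, r (i - 1) + r i = n i)
    (h1 : (r 0 : ℤ) + l + r 1 = n 1) :
    ∑ i ∈ Finset.Icc a b, ((i - 1).negOnePow : ℤ) * n i = l := by
  have hterm : ∀ i ∈ Finset.Icc a b, ((i - 1).negOnePow : ℤ) * n i =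
      ((fun j : ℤ => (j.negOnePow : ℤ) * r j) (i - 1) - (fun j : ℤ => (j.negOnePow : ℤ) * r j) i) +
        if i = 1 then l else 0 := by
    intro i _
    have hs : (i.negOnePow : ℤ) = - ((i - 1).negOnePow : ℤ) := by
      have := Int.negOnePow_succ (i - 1)
      rw [sub_add_cancel] at this
      rw [this]
      simp
    dsimp only
    rw [hs]
    split_ifs with hi
    · subst hi
      rw [← h1]
      simp
      ring
    · rw [← h i hi]
      push_cast
      ring
  rw [Finset.sum_congr rfl hterm, Finset.sum_add_distrib, Finset.sum_ite_eq' _ _ (fun _ => l),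
    if_pos (by simp [ha, hb])]
  obtain ⟨m, rfl⟩ : ∃ m : ℕ, b = a + m := ⟨(b - a).toNat, by omega⟩
  have := sum_Icc_telescope (fun j : ℤ => (j.negOnePow : ℤ) * r j) a m
  rw [this, hr (a - 1) (by simp), hr (a + m) (by simp)]
  simp

variable [IsNoetherianRing R] [∀ i, Module.Finite R (X i)] [∀ i, Module.Projective R (X i)]
  {d : ∀ i j, X i →ₗ[R] X j} {a b : ℤ} {r : ℤ → PrimeSpectrum R → ℕ} {l : PrimeSpectrum R → ℕ}

omit [IsNoetherianRing R] [∀ i, Module.Finite R (X i)] [∀ i, Module.Projective R (X i)] in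
theorem RankData.add_of_ne (hr : RankData R X a b r l) (i : ℤ) (hi : i ≠ 1) (𝔭 : PrimeSpectrum R) :
    r (i - 1) 𝔭 + r i 𝔭 = Module.rankAtStalk (R := R) (X i) 𝔭 := by
  simpa [degOne, hi] using hr.add i 𝔭

omit [IsNoetherianRing R] [∀ i, Module.Finite R (X i)] [∀ i, Module.Projective R (X i)] in
theorem RankData.add_one (hr : RankData R X a b r l) (𝔭 : PrimeSpectrum R) :
    r 0 𝔭 + l 𝔭 + r 1 𝔭 = Module.rankAtStalk (R := R) (X 1) 𝔭 := by
  simpa [degOne] using hr.add 1 𝔭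

/-- Image ranks satisfy the same recursion at every prime of height at most one, so they must agree
with the given rank functions. -/
theorem RankData.eq_imageRank (hr : RankData R X a b r l) (h : CodimOneExact d a b)
    (hR : SerreTwo R) (q : Ideal R) [hqp : q.IsPrime] (hq : q.height ≤ 1) (i : ℤ) :
    r i ⟨q, hqp⟩ = imageRank d q i :=
  rank_unique (a := a) (b := b) (n := fun i => Module.rankAtStalk (R := R) (X i) ⟨q, hqp⟩)
    (r := fun i => r i ⟨q, hqp⟩) (r' := imageRank d q)
    (fun i hi => hr.eq_zero i hi _) (fun i hi => h.imageRank_eq_zero q i hi)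
    (fun i hi => hr.add_of_ne i hi _) (fun i hi => h.imageRank_add hR q hq i hi) i

/-- A minimal prime below a given prime. -/
noncomputable def minPrime (𝔭 : PrimeSpectrum R) : PrimeSpectrum R :=
  ⟨(Ideal.exists_minimalPrimes_le (I := ⊥) (J := 𝔭.asIdeal) bot_le).choose,
    (Ideal.exists_minimalPrimes_le (I := ⊥) (J := 𝔭.asIdeal) bot_le).choose_spec.1.1.1⟩

omit [IsNoetherianRing R] in
theorem minPrime_mem (𝔭 : PrimeSpectrum R) : (minPrime 𝔭).asIdeal ∈ minimalPrimes R :=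
  (Ideal.exists_minimalPrimes_le (I := ⊥) (J := 𝔭.asIdeal) bot_le).choose_spec.1

omit [IsNoetherianRing R] in
theorem minPrime_le (𝔭 : PrimeSpectrum R) : minPrime 𝔭 ≤ 𝔭 :=
  (Ideal.exists_minimalPrimes_le (I := ⊥) (J := 𝔭.asIdeal) bot_le).choose_spec.2

omit [IsNoetherianRing R] in
theorem height_le_one_of_mem_minimalPrimes {p : Ideal R} (hp : p ∈ minimalPrimes R) :
    p.height ≤ 1 := by
  have : p.IsPrime := hp.1.1
  rw [Ideal.height_eq_zero_iff.2 hp]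
  exact zero_le_one

theorem CodimOneExact.exists_rankData (h : CodimOneExact d a b) (hR : SerreTwo R) :
    ∃ r l, RankData R X a b r l := by
  -- Additivity of image ranks is known only in height at most one, so the rank at `𝔭` is read off
  -- at a minimal prime below it; ranks of projective modules do not change along specialization.
  -- Local constancy is inherited recursively from the ranks of the `X i`.
  let r : ℤ → PrimeSpectrum R → ℕ := fun i 𝔭 => imageRank d (minPrime 𝔭).asIdeal i
  have hrk : ∀ i 𝔭, Module.rankAtStalk (R := R) (X i) (minPrime 𝔭) =
      Module.rankAtStalk (R := R) (X i) 𝔭 := fun i 𝔭 =>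
    Module.rankAtStalk_eq_of_le_of_finite_of_flat (X i) (minPrime_le 𝔭)
  have hht : ∀ 𝔭 : PrimeSpectrum R, (minPrime 𝔭).asIdeal.height ≤ 1 := fun 𝔭 =>
    height_le_one_of_mem_minimalPrimes (minPrime_mem 𝔭)
  have hzero : ∀ i ∉ Finset.Ico a b, ∀ 𝔭, r i 𝔭 = 0 := fun i hi 𝔭 => h.imageRank_eq_zero _ i hi
  have hadd : ∀ i ≠ 1, ∀ 𝔭, r (i - 1) 𝔭 + r i 𝔭 = Module.rankAtStalk (R := R) (X i) 𝔭 :=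
    fun i hi 𝔭 => (h.imageRank_add hR _ (hht 𝔭) i hi).trans (hrk i 𝔭)
  have hl : ∀ 𝔭, ∃ n, r 0 𝔭 + n + r 1 𝔭 = Module.rankAtStalk (R := R) (X 1) 𝔭 := by
    intro 𝔭
    obtain ⟨n, hn, -⟩ := h.exists_H1_generators hR _ (hht 𝔭) (Or.inl (minPrime_mem 𝔭))
    exact ⟨n, hn.trans (hrk 1 𝔭)⟩
  have hloc : ∀ i, IsLocallyConstant (Module.rankAtStalk (R := R) (X i)) := fun i =>
    have := Module.finitePresentation_of_projective R (X i)
    Module.isLocallyConstant_rankAtStalk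
  have hz : ∀ i ∉ Finset.Ico a b, IsLocallyConstant (r i) := fun i hi => by
    rw [show r i = fun _ => 0 from funext (hzero i hi)]
    exact IsLocallyConstant.const 0
  have h1 : ∀ k : ℕ, ∀ i : ℤ, i < a + k → i ≤ 0 → IsLocallyConstant (r i) := by
    intro k
    induction k with
    | zero => exact fun i hi _ => hz i (by simp; push_cast at hi; omega)
    | succ k ih =>
      intro i hi hi0
      have h2 := (hloc i).sub (ih (i - 1) (by push_cast at hi; omega) (by omega))
      convert h2 using 1
      funext 𝔭
      have := hadd i (by omega) 𝔭
      simp only [Pi.sub_apply]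
      omega
  have h2 : ∀ k : ℕ, ∀ i : ℤ, b - k ≤ i → 1 ≤ i → IsLocallyConstant (r i) := by
    intro k
    induction k with
    | zero => exact fun i hi _ => hz i (by simp; push_cast at hi; omega)
    | succ k ih =>
      intro i hi hi0
      have h2 := (hloc (i + 1)).sub (ih (i + 1) (by push_cast at hi; omega) (by omega))
      convert h2 using 1
      funext 𝔭
      have := hadd (i + 1) (by omega) 𝔭
      rw [add_sub_cancel_right] at this
      simp only [Pi.sub_apply]
      omega
  have hrloc : ∀ i, IsLocallyConstant (r i) := fun i => by
    rcases le_or_gt i 0 with hi | hi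
    · exact h1 (i - a + 1).toNat i (by omega) hi
    · exact h2 (b - i).toNat i (by omega) (by omega)
  choose l hl using hl
  refine ⟨r, l, hzero, fun i 𝔭 => ?_, hrloc, ?_⟩
  · by_cases hi : i = 1
    · subst hi
      simpa [degOne] using hl 𝔭
    · simpa [degOne, hi] using hadd i hi 𝔭
  · have := ((hloc 1).sub (hrloc 0)).sub (hrloc 1)
    convert this using 1
    funext 𝔭
    have := hl 𝔭
    simp only [Pi.sub_apply]
    omega

/-- The elements `d (f j)` generate the image of `d` in degree `i` at `q`. -/
def ImageSpansAt (d : ∀ i j, X i →ₗ[R] X j) (q : Ideal R) (i : ℤ) {n : ℕ} (f : Fin n → X i) : Prop :=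
  ∃ s ∉ q, ∀ x, ∃ c : Fin n → R, s • d i (i + 1) x = ∑ j, c j • d i (i + 1) (f j)

omit [IsNoetherianRing R] [∀ i, Module.Finite R (X i)] [∀ i, Module.Projective R (X i)] in
theorem ImageSpansAt.shift {q : Ideal R} {i : ℤ} {n : ℕ} {f : Fin n → X i}
    (hf : ImageSpansAt d q i f) {k : ℤ} (hk : k = i + 1) :
    ∃ s ∉ q, ∀ x, ∃ c : Fin n → R, s • d i k x = ∑ j, c j • d i k (f j) := by
  subst hk
  exact hf

omit [IsNoetherianRing R] [∀ i, Module.Finite R (X i)] [∀ i, Module.Projective R (X i)] in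
theorem ImageSpansAt.range {q : Ideal R} {i : ℤ} {n : ℕ} {f : Fin n → X i}
    (hf : ImageSpansAt d q i f) : SpansAt q fun j => (d i (i + 1)).rangeRestrict (f j) := by
  obtain ⟨t, ht, hf⟩ := hf
  refine ⟨t, ht, fun m => ?_⟩
  obtain ⟨v, rfl⟩ := LinearMap.surjective_rangeRestrict _ m
  obtain ⟨c, hc⟩ := hf v
  refine ⟨c, Subtype.ext ?_⟩
  simp only [Submodule.coe_smul, Submodule.coe_sum]
  exact hc

/-- Elements of `ker (d 1 2)` whose classes generate `H¹` at `q`. -/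
def H1SpansAt (d : ∀ i j, X i →ₗ[R] X j) (q : Ideal R) {n : ℕ}
    (z : Fin n → LinearMap.ker (d 1 2)) : Prop :=
  ∃ s ∉ q, ∀ x : LinearMap.ker (d 1 2), ∃ w, ∃ c : Fin n → R,
    s • (x : X 1) = d 0 1 w + ∑ j, c j • (z j : X 1)

omit [∀ i, Module.Projective R (X i)] in
-- Exactness writes each cocycle as a coboundary up to a denominator, and the cocycle module is
-- finitely generated, so a single denominator suffices.
theorem CodimOneExact.ker_spansAt (h : CodimOneExact d a b) {q : Ideal R} [hqp : q.IsPrime]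
    (hq : q.height ≤ 1) {i : ℤ} (hi : i ≠ 1) {n : ℕ} {f : Fin n → X (i - 1)}
    (hf : ImageSpansAt d q (i - 1) f) :
    SpansAt q fun j => (⟨d (i - 1) i (f j), h.dd _ _ _ _⟩ : LinearMap.ker (d i (i + 1))) := by
  obtain ⟨s, hs, hf'⟩ := hf.shift (show i = i - 1 + 1 by ring)
  have hloc : ∀ x : LinearMap.ker (d i (i + 1)), ∃ t ∉ q,
      t • (LinearMap.ker (d i (i + 1))).subtype x ∈
        Submodule.span R (Set.range fun j => d (i - 1) i (f j)) := by
    intro x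
    obtain ⟨t, ht, w, hw⟩ := h.exact q hqp hq i hi x x.2
    obtain ⟨c, hc⟩ := hf' w
    refine ⟨s * t, q.primeCompl.mul_mem hs ht, ?_⟩
    rw [mul_smul, Submodule.subtype_apply, ← hw, hc]
    exact Submodule.sum_mem _ fun j _ => Submodule.smul_mem _ _ (Submodule.subset_span ⟨j, rfl⟩)
  obtain ⟨t, ht, ht'⟩ := exists_uniform_smul_mem _ _ hloc
  refine ⟨t, ht, fun m => ?_⟩
  obtain ⟨c, hc⟩ := (Submodule.mem_span_range_iff_exists_fun R).1 (ht' m)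
  refine ⟨c, Subtype.ext ?_⟩
  simp only [Submodule.coe_sum, Submodule.coe_smul]
  exact hc.symm

omit [IsNoetherianRing R] [∀ i, Module.Finite R (X i)] [∀ i, Module.Projective R (X i)] in
theorem CodimOneExact.ker_spansAt_one (h : CodimOneExact d a b) {q : Ideal R} [hqp : q.IsPrime]
    {m n : ℕ} {f : Fin m → X 0} (hf : ImageSpansAt d q 0 f) {z : Fin n → LinearMap.ker (d 1 2)}
    (hz : H1SpansAt d q z) :
    SpansAt q (Fin.append (fun j => (⟨d 0 1 (f j), h.dd _ _ _ _⟩ : LinearMap.ker (d 1 2))) z) := by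
  obtain ⟨s, hs, hf'⟩ := hf
  obtain ⟨t, ht, hz⟩ := hz
  refine ⟨s * t, q.primeCompl.mul_mem hs ht, fun m => ?_⟩
  obtain ⟨w, c, hw⟩ := hz m
  obtain ⟨c', hc'⟩ := hf' w
  refine ⟨Fin.append c' (s • c), Subtype.ext ?_⟩
  rw [Fin.sum_univ_add]
  simp only [Fin.append_left, Fin.append_right, Submodule.coe_add, Submodule.coe_sum,
    Submodule.coe_smul, Pi.smul_apply, smul_assoc]
  rw [mul_smul, hw, smul_add, Finset.smul_sum]
  exact congrArg (· + _) hc'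

theorem RankData.exists_imageSpansAt (hr : RankData R X a b r l) (h : CodimOneExact d a b)
    (hR : SerreTwo R) (q : Ideal R) [hqp : q.IsPrime] (hq : q.height ≤ 1) (i : ℤ) :
    ∃ f : Fin (r i ⟨q, hqp⟩) → X i, ImageSpansAt d q i f := by
  rw [hr.eq_imageRank h hR q hq]
  exact h.exists_image_generators hR q hq i

theorem RankData.exists_H1SpansAt (hr : RankData R X a b r l) (h : CodimOneExact d a b)
    (hR : SerreTwo R) (q : Ideal R) [hqp : q.IsPrime] (hq : q.height ≤ 1)
    (hgood : q ∈ minimalPrimes R ∨ H1TorsionFreeAt d q) :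
    ∃ z : Fin (l ⟨q, hqp⟩) → LinearMap.ker (d 1 2), H1SpansAt d q z := by
  obtain ⟨n, hn, z, hz⟩ := h.exists_H1_generators hR q hq hgood
  have h1 := hr.add_one ⟨q, hqp⟩
  rw [hr.eq_imageRank h hR q hq, hr.eq_imageRank h hR q hq] at h1
  have hln : l ⟨q, hqp⟩ = n := by omega
  rw [hln]
  exact ⟨z, hz⟩

/-- The kernel in degree `i` is generated at a minimal prime by `r (i - 1) + degOne l i` elements. -/
theorem RankData.exists_ker_spansAt (hr : RankData R X a b r l) (h : CodimOneExact d a b)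
    (hR : SerreTwo R) {p : Ideal R} [hpp : p.IsPrime] (hp : p ∈ minimalPrimes R) (i : ℤ) :
    ∃ g : Fin (r (i - 1) ⟨p, hpp⟩ + degOne l i ⟨p, hpp⟩) → LinearMap.ker (d i (i + 1)),
      SpansAt p g := by
  have hht := height_le_one_of_mem_minimalPrimes hp
  obtain ⟨f, hf⟩ := hr.exists_imageSpansAt h hR p hht (i - 1)
  by_cases hi : i = 1
  · subst hi
    obtain ⟨z, hz⟩ := hr.exists_H1SpansAt h hR p hht (Or.inl hp)
    exact ⟨_, h.ker_spansAt_one hf hz⟩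
  · have h0 : degOne l i ⟨p, hpp⟩ = 0 := if_neg hi
    rw [h0]
    exact ⟨_, h.ker_spansAt hht hi hf⟩

end Ranks

/-! ### The exchange relation between two admissible families. -/

section Swap

variable {R : Type u} [CommRing R]

/-- Functionals separate the points of a projective module, so S₁ for `R` transfers to it. -/
theorem SerreTwo.eq_zero_of_projective (hR : SerreTwo R) {N : Type*} [AddCommGroup N] [Module R N]
    [Module.Projective R N] {n : N}
    (h : ∀ p : Ideal R, p ∈ minimalPrimes R → ∃ s ∉ p, s • n = 0) : n = 0 := by
  rw [← Module.forall_dual_apply_eq_zero_iff R]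
  intro f
  refine hR.eq_zero _ fun p hp => ?_
  obtain ⟨s, hs, hsn⟩ := h p hp
  exact ⟨s, hs, by rw [← smul_eq_mul, ← map_smul, hsn, map_zero]⟩

variable {X : ℤ → Type u} [∀ i, AddCommGroup (X i)] [∀ i, Module R (X i)]

/-- The family which is the image of `y` in degree `1`, and `1` in all other degrees. -/
noncomputable def insOne (d : ∀ i j, X i →ₗ[R] X j) (y : ExteriorAlgebra R (LinearMap.ker (d 1 2)))
    (i : ℤ) : ExteriorAlgebra R (X i) :=
  Function.update (fun i => (1 : ExteriorAlgebra R (X i))) 1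
    (ExteriorAlgebra.map (LinearMap.ker (d 1 2)).subtype y) i

theorem insOne_one (d : ∀ i j, X i →ₗ[R] X j) (y : ExteriorAlgebra R (LinearMap.ker (d 1 2))) :
    insOne d y 1 = ExteriorAlgebra.map (LinearMap.ker (d 1 2)).subtype y := by
  simp [insOne]

theorem insOne_of_ne (d : ∀ i j, X i →ₗ[R] X j) (y : ExteriorAlgebra R (LinearMap.ker (d 1 2)))
    {i : ℤ} (hi : i ≠ 1) : insOne d y i = 1 := by
  simp [insOne, hi]

/-- The element `d x ∧ y ∧ x'` in degree `i`, where `y` is present only for `i = 1`. -/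
noncomputable def wedge (d : ∀ i j, X i →ₗ[R] X j) (y : ExteriorAlgebra R (LinearMap.ker (d 1 2)))
    (x : ∀ i, ExteriorAlgebra R (X i)) (i : ℤ) : ExteriorAlgebra R (X i) :=
  ExteriorAlgebra.map (d (i - 1) i) (x (i - 1)) * insOne d y i * x i

variable [IsNoetherianRing R] [∀ i, Module.Finite R (X i)] [∀ i, Module.Projective R (X i)]
  {d : ∀ i j, X i →ₗ[R] X j} {a b : ℤ} {r : ℤ → PrimeSpectrum R → ℕ} {l : PrimeSpectrum R → ℕ}

omit [IsNoetherianRing R] [∀ i, Module.Finite R (X i)] [∀ i, Module.Projective R (X i)] in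
theorem exists_map_eq_insOne {y : ExteriorAlgebra R (LinearMap.ker (d 1 2))}
    (hy : y ∈ extPow R (LinearMap.ker (d 1 2)) l) (i : ℤ) :
    ∃ w ∈ extPow R (LinearMap.ker (d i (i + 1))) (degOne l i),
      ExteriorAlgebra.map (LinearMap.ker (d i (i + 1))).subtype w = insOne d y i := by
  by_cases hi : i = 1
  · subst hi
    exact ⟨y, hy, (insOne_one d y).symm⟩
  · exact ⟨1, one_mem_extPow fun 𝔭 => if_neg hi, by rw [insOne_of_ne d y hi, map_one]⟩

omit [IsNoetherianRing R] [∀ i, Module.Finite R (X i)] [∀ i, Module.Projective R (X i)] in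
theorem insOne_mem {y : ExteriorAlgebra R (LinearMap.ker (d 1 2))}
    (hy : y ∈ extPow R (LinearMap.ker (d 1 2)) l) (i : ℤ) :
    insOne d y i ∈ extPow R (X i) (degOne l i) := by
  obtain ⟨w, hw, hw'⟩ := exists_map_eq_insOne hy i
  rw [← hw']
  exact extPow_map _ hw

omit [IsNoetherianRing R] in
theorem ι_mem_extPow {M : Type u} [AddCommGroup M] [Module R M] (z : M) :
    ExteriorAlgebra.ι R z ∈ extPow R M fun _ => 1 := by
  rw [extPow_const]
  change _ ∈ LinearMap.range (ExteriorAlgebra.ι R : M →ₗ[R] ExteriorAlgebra R M) ^ 1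
  rw [pow_one]
  exact ⟨z, rfl⟩

/-- `d x ∧ y` is killed by all cocycles. -/
theorem RankData.mul_ι_eq_zero (hr : RankData R X a b r l) (h : CodimOneExact d a b)
    (hR : SerreTwo R) {i : ℤ} {x : ExteriorAlgebra R (X (i - 1))}
    (hx : x ∈ extPow R (X (i - 1)) (r (i - 1))) {y : ExteriorAlgebra R (LinearMap.ker (d 1 2))}
    (hy : y ∈ extPow R (LinearMap.ker (d 1 2)) l) {z : X i} (hz : d i (i + 1) z = 0) :
    ExteriorAlgebra.map (d (i - 1) i) x * insOne d y i * ExteriorAlgebra.ι R z = 0 := by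
  refine hR.eq_zero_of_projective fun p hp => ?_
  have hpp : p.IsPrime := hp.1.1
  obtain ⟨w, hw, hw'⟩ := exists_map_eq_insOne hy i
  let d' : X (i - 1) →ₗ[R] LinearMap.ker (d i (i + 1)) :=
    (d (i - 1) i).codRestrict _ fun v => h.dd _ _ _ v
  have hd : (LinearMap.ker (d i (i + 1))).subtype ∘ₗ d' = d (i - 1) i := rfl
  obtain ⟨g, hg⟩ := hr.exists_ker_spansAt h hR hp i
  -- Lifted to the exterior algebra of the cocycles, the product has degree one more than the number
  -- of elements spanning the cocycles at `p`.
  have hm := extPow_mul (τ := fun 𝔭 => r (i - 1) 𝔭 + degOne l i 𝔭 + 1) (fun 𝔭 => rfl)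
    (extPow_mul (fun 𝔭 => rfl) (extPow_map d' hx) hw)
    (ι_mem_extPow (R := R) (⟨z, hz⟩ : LinearMap.ker (d i (i + 1))))
  obtain ⟨s, hs, hsm⟩ := hm ⟨p, hpp⟩
  obtain ⟨t, ht, h0⟩ := hg.eq_zero_of_lt (Nat.lt_succ_self _) hsm
  refine ⟨t * s, p.primeCompl.mul_mem ht hs, ?_⟩
  have := congrArg (ExteriorAlgebra.map (LinearMap.ker (d i (i + 1))).subtype) h0
  rw [map_zero, map_smul, map_smul, map_mul, map_mul, hw', ExteriorAlgebra.map_apply_ι,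
    ← AlgHom.comp_apply, ExteriorAlgebra.map_comp_map, hd] at this
  rw [mul_smul]
  exact this

/-- Locally at a minimal prime the image of `⋀^(r i)` under the differential has rank one. -/
theorem RankData.exists_common (hr : RankData R X a b r l) (h : CodimOneExact d a b)
    (hR : SerreTwo R) {p : Ideal R} (hp : p ∈ minimalPrimes R) {i : ℤ}
    {x x' : ExteriorAlgebra R (X i)} (hx : x ∈ extPow R (X i) (r i))
    (hx' : x' ∈ extPow R (X i) (r i)) {W : ExteriorAlgebra R (X i)}
    (hW : ∀ z, d i (i + 1) z = 0 → W * ExteriorAlgebra.ι R z = 0) :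
    ∃ s ∉ p, ∃ c c' : R, ∃ g : ExteriorAlgebra R (X (i + 1)),
      s • ExteriorAlgebra.map (d i (i + 1)) x = c • g ∧
      s • ExteriorAlgebra.map (d i (i + 1)) x' = c' • g ∧
      s • c' • (W * x) = s • c • (W * x') := by
  have hpp : p.IsPrime := hp.1.1
  have hht := height_le_one_of_mem_minimalPrimes hp
  obtain ⟨f, hf⟩ := hr.exists_imageSpansAt h hR p hht i
  set D := (d i (i + 1)).rangeRestrict with hD
  have hg : SpansAt p fun j => D (f j) := hf.range
  have hsub : (LinearMap.range (d i (i + 1))).subtype ∘ₗ D = d i (i + 1) := rfl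
  have key : ∀ {x}, x ∈ extPow R (X i) (r i) → ∃ s ∉ p, ∃ c : R,
      s • ExteriorAlgebra.map D x = c • ExteriorAlgebra.ιMulti R _ fun j => D (f j) := by
    intro x hx
    obtain ⟨s, hs, hsx⟩ := extPow_map D hx ⟨p, hpp⟩
    obtain ⟨s', hs', c, hc⟩ := hg.generates hsx
    exact ⟨s' * s, p.primeCompl.mul_mem hs' hs, c, by rw [mul_smul, hc]⟩
  obtain ⟨s, hs, c, hc⟩ := key hx
  obtain ⟨s', hs', c', hc'⟩ := key hx'
  set g := ExteriorAlgebra.ιMulti R _ fun j => D (f j)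
  have hmap : ∀ v, ExteriorAlgebra.map (LinearMap.range (d i (i + 1))).subtype
      (ExteriorAlgebra.map D v) = ExteriorAlgebra.map (d i (i + 1)) v := fun v => by
    rw [← AlgHom.comp_apply, ExteriorAlgebra.map_comp_map, hsub]
  refine ⟨s * s', p.primeCompl.mul_mem hs hs', s' * c, s * c',
    ExteriorAlgebra.map (LinearMap.range (d i (i + 1))).subtype g, ?_, ?_, ?_⟩
  · have := congrArg (fun v => s' • ExteriorAlgebra.map
      (LinearMap.range (d i (i + 1))).subtype v) hc
    simp only [map_smul, hmap, smul_smul] at this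
    rw [mul_comm s s', this]
  · have := congrArg (fun v => s • ExteriorAlgebra.map
      (LinearMap.range (d i (i + 1))).subtype v) hc'
    simp only [map_smul, hmap, smul_smul] at this
    exact this
  -- With `D` the differential onto its image, the suitable combination of `x` and `x'` is killed by
  -- `⋀ D`, while `W` is killed by `ker D`. Hence `W` annihilates that combination.
  · have h0 := mul_eq_zero_of_map_eq_zero (W := W) (k := (s * c') • x - (s' * c) • x') D
      (LinearMap.surjective_rangeRestrict _)
      (fun z hz => hW z (by simpa [hD] using congrArg Subtype.val hz)) (by
        rw [map_sub, map_smul, map_smul, mul_comm s, mul_comm s', mul_smul, mul_smul, hc, hc',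
          smul_smul, smul_smul, mul_comm c', sub_self])
    rw [mul_sub, mul_smul_comm, mul_smul_comm, sub_eq_zero] at h0
    rw [h0]

/-- The exchange relation between the factors in degrees `i` and `i + 1`. -/
theorem RankData.swap (hr : RankData R X a b r l) (h : CodimOneExact d a b) (hR : SerreTwo R)
    {i : ℤ} {x x' : ExteriorAlgebra R (X i)} (hx : x ∈ extPow R (X i) (r i))
    (hx' : x' ∈ extPow R (X i) (r i)) {W : ExteriorAlgebra R (X i)}
    (hW : ∀ z, d i (i + 1) z = 0 → W * ExteriorAlgebra.ι R z = 0)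
    (V : ExteriorAlgebra R (X (i + 1))) (Θ : ExteriorAlgebra R (X i) →ₗ[R] R)
    (Θ' : ExteriorAlgebra R (X (i + 1)) →ₗ[R] R) :
    Θ (W * x) * Θ' (ExteriorAlgebra.map (d i (i + 1)) x' * V) =
      Θ (W * x') * Θ' (ExteriorAlgebra.map (d i (i + 1)) x * V) := by
  rw [← sub_eq_zero]
  refine hR.eq_zero _ fun p hp => ?_
  have hpp : p.IsPrime := hp.1.1
  obtain ⟨s, hs, c, c', g, h1, h2, h3⟩ := hr.exists_common h hR hp hx hx' hW
  refine ⟨s * s, p.primeCompl.mul_mem hs hs, ?_⟩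
  have e1 : s * Θ' (ExteriorAlgebra.map (d i (i + 1)) x * V) = c * Θ' (g * V) := by
    rw [← smul_eq_mul, ← map_smul, ← smul_mul_assoc, h1, smul_mul_assoc, map_smul, smul_eq_mul]
  have e2 : s * Θ' (ExteriorAlgebra.map (d i (i + 1)) x' * V) = c' * Θ' (g * V) := by
    rw [← smul_eq_mul, ← map_smul, ← smul_mul_assoc, h2, smul_mul_assoc, map_smul, smul_eq_mul]
  have e3 : s * (c' * Θ (W * x)) = s * (c * Θ (W * x')) := by
    simpa only [map_smul, smul_eq_mul] using congrArg Θ h3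
  -- Both sides become multiples of `Θ' (g * V)`, and their coefficients agree by `e3`.
  linear_combination (s * Θ (W * x)) * e2 - (s * Θ (W * x')) * e1 + Θ' (g * V) * e3

variable (R X) in
/-- The families of elements entering the explicit description of `Ψ`. -/
structure Admissible (a b : ℤ) (r : ℤ → PrimeSpectrum R → ℕ) (x : ∀ i, ExteriorAlgebra R (X i)) :
    Prop where
  mem : ∀ i, x i ∈ extPow R (X i) (r i)
  eq_one : ∀ i ∉ Finset.Ico a b, x i = 1

/-- The alternating choice of two families, in a product over all degrees. -/
noncomputable def mixedProd (d : ∀ i j, X i →ₗ[R] X j) (a b : ℤ)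
    (y : ExteriorAlgebra R (LinearMap.ker (d 1 2))) (Θ : ∀ i, ExteriorAlgebra R (X i) →ₗ[R] R)
    (α β : ∀ i, ExteriorAlgebra R (X i)) : R :=
  ∏ j ∈ Finset.Icc a b, Θ j (wedge d y (if Even j then α else β) j)

omit [IsNoetherianRing R] [∀ i, Module.Finite R (X i)] [∀ i, Module.Projective R (X i)] in
theorem wedge_congr {y : ExteriorAlgebra R (LinearMap.ker (d 1 2))}
    {x x' : ∀ i, ExteriorAlgebra R (X i)} {j : ℤ} (h1 : x (j - 1) = x' (j - 1)) (h2 : x j = x' j) :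
    wedge d y x j = wedge d y x' j := by
  rw [wedge, wedge, h1, h2]

omit [IsNoetherianRing R] [∀ i, Module.Finite R (X i)] [∀ i, Module.Projective R (X i)] in
theorem wedge_succ {y : ExteriorAlgebra R (LinearMap.ker (d 1 2))}
    {x : ∀ i, ExteriorAlgebra R (X i)} {i : ℤ} :
    wedge d y x (i + 1) =
      ExteriorAlgebra.map (d i (i + 1)) (x i) * (insOne d y (i + 1) * x (i + 1)) := by
  have : ∀ k, k = i → ExteriorAlgebra.map (d k (i + 1)) (x k) =
      ExteriorAlgebra.map (d i (i + 1)) (x i) := by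
    rintro _ rfl; rfl
  rw [wedge, this _ (by ring), mul_assoc]

theorem RankData.swap_wedge (hr : RankData R X a b r l) (h : CodimOneExact d a b) (hR : SerreTwo R)
    {y : ExteriorAlgebra R (LinearMap.ker (d 1 2))} (hy : y ∈ extPow R (LinearMap.ker (d 1 2)) l)
    (Θ : ∀ i, ExteriorAlgebra R (X i) →ₗ[R] R) {γ δ : ∀ i, ExteriorAlgebra R (X i)}
    (hγ : Admissible R X a b r γ) (hδ : Admissible R X a b r δ) (i : ℤ) :
    Θ i (wedge d y γ i) * Θ (i + 1) (wedge d y δ (i + 1)) =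
      Θ i (wedge d y (Function.update γ i (δ i)) i) *
        Θ (i + 1) (wedge d y (Function.update δ i (γ i)) (i + 1)) := by
  rw [wedge_succ, wedge_succ]
  simp only [wedge, Function.update_self]
  rw [Function.update_of_ne (by omega), Function.update_of_ne (by omega)]
  exact hr.swap h hR (hγ.mem i) (hδ.mem i)
    (fun z hz => hr.mul_ι_eq_zero h hR (hγ.mem (i - 1)) hy hz) _ _ _

/-- The entries in degree `i` occur only in the factors `i` and `i + 1`. These have opposite parity,
so they involve different families and the exchange relation applies. -/
theorem RankData.mixedProd_update (hr : RankData R X a b r l) (h : CodimOneExact d a b)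
    (hR : SerreTwo R) {y : ExteriorAlgebra R (LinearMap.ker (d 1 2))}
    (hy : y ∈ extPow R (LinearMap.ker (d 1 2)) l)
    (Θ : ∀ i, ExteriorAlgebra R (X i) →ₗ[R] R) {γ δ : ∀ i, ExteriorAlgebra R (X i)}
    (hγ : Admissible R X a b r γ) (hδ : Admissible R X a b r δ) {i : ℤ} (hi : i ∈ Finset.Ico a b) :
    mixedProd d a b y Θ γ δ =
      mixedProd d a b y Θ (Function.update γ i (δ i)) (Function.update δ i (γ i)) := by
  have h1 : i ∈ Finset.Icc a b := by simp at hi ⊢; omega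
  have h2 : i + 1 ∈ (Finset.Icc a b).erase i := by simp at hi ⊢; omega
  unfold mixedProd
  rw [← Finset.mul_prod_erase _ _ h1, ← Finset.mul_prod_erase _ _ h2,
    ← Finset.mul_prod_erase _ _ h1, ← Finset.mul_prod_erase _ _ h2, ← mul_assoc, ← mul_assoc]
  congr 1
  · rcases Int.even_or_odd i with he | ho
    · have ho' : ¬ Even (i + 1) := by simpa using he.add_one
      rw [if_pos he, if_pos he, if_neg ho', if_neg ho']
      exact hr.swap_wedge h hR hy Θ hγ hδ i
    · have he : ¬ Even i := by simpa using ho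
      have ho' : Even (i + 1) := ho.add_one
      rw [if_neg he, if_neg he, if_pos ho', if_pos ho']
      exact hr.swap_wedge h hR hy Θ hδ hγ i
  · refine Finset.prod_congr rfl fun j hj => ?_
    have hj1 : j ≠ i := by simp at hj; omega
    have hj2 : j - 1 ≠ i := by simp at hj; omega
    congr 1
    split_ifs
    · exact wedge_congr (Function.update_of_ne hj2 _ _).symm (Function.update_of_ne hj1 _ _).symm
    · exact wedge_congr (Function.update_of_ne hj2 _ _).symm (Function.update_of_ne hj1 _ _).symm

omit [IsNoetherianRing R] [∀ i, Module.Finite R (X i)] [∀ i, Module.Projective R (X i)] in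
theorem Admissible.update {γ δ : ∀ i, ExteriorAlgebra R (X i)} (hγ : Admissible R X a b r γ)
    (hδ : Admissible R X a b r δ) (i : ℤ) : Admissible R X a b r (Function.update γ i (δ i)) := by
  constructor
  · intro j
    by_cases hj : j = i
    · subst hj; simpa using hδ.mem j
    · simpa [hj] using hγ.mem j
  · intro j hj'
    by_cases hj : j = i
    · subst hj; simpa using hδ.eq_one j hj'
    · simpa [hj] using hγ.eq_one j hj'

/-- The two families can be exchanged. -/
theorem RankData.mixedProd_comm (hr : RankData R X a b r l) (h : CodimOneExact d a b)
    (hR : SerreTwo R) {y : ExteriorAlgebra R (LinearMap.ker (d 1 2))}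
    (hy : y ∈ extPow R (LinearMap.ker (d 1 2)) l)
    (Θ : ∀ i, ExteriorAlgebra R (X i) →ₗ[R] R) {α β : ∀ i, ExteriorAlgebra R (X i)}
    (hα : Admissible R X a b r α) (hβ : Admissible R X a b r β) :
    mixedProd d a b y Θ α β = mixedProd d a b y Θ β α := by
  -- The degrees are exchanged one at a time. Outside `[a, b)` both families equal `1`, so nothing
  -- remains to be exchanged there.
  have key : ∀ s ⊆ Finset.Ico a b, ∃ γ δ, Admissible R X a b r γ ∧ Admissible R X a b r δ ∧
      (∀ i, γ i = if i ∈ s then β i else α i) ∧ (∀ i, δ i = if i ∈ s then α i else β i) ∧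
      mixedProd d a b y Θ α β = mixedProd d a b y Θ γ δ := by
    intro s
    induction s using Finset.induction_on with
    | empty => exact fun _ => ⟨α, β, hα, hβ, by simp, by simp, rfl⟩
    | insert i s his ih =>
      intro hs
      obtain ⟨γ, δ, hγ, hδ, h1, h2, h3⟩ := ih fun j hj => hs (Finset.mem_insert_of_mem hj)
      refine ⟨_, _, hγ.update hδ i, hδ.update hγ i, fun j => ?_, fun j => ?_,
        h3.trans (hr.mixedProd_update h hR hy Θ hγ hδ (hs (Finset.mem_insert_self i s)))⟩
      · by_cases hj : j = i
        · subst hj; simp [h2, his]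
        · simp [hj, h1]
      · by_cases hj : j = i
        · subst hj; simp [h1, his]
        · simp [hj, h2]
  obtain ⟨γ, δ, -, -, h1, h2, h3⟩ := key _ subset_rfl
  rw [h3]
  congr 1
  · funext i
    rw [h1]
    split_ifs with hi
    · rfl
    · rw [hα.eq_one i hi, hβ.eq_one i hi]
  · funext i
    rw [h2]
    split_ifs with hi
    · rfl
    · rw [hα.eq_one i hi, hβ.eq_one i hi]

end Swap

/-! ### Adapted families and local generators of the determinants. -/

section Generation

variable {R : Type u} [CommRing R]

theorem generatesAt_extPow {M : Type u} [AddCommGroup M] [Module R M] {ρ : PrimeSpectrum R → ℕ}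
    {q : Ideal R} [hq : q.IsPrime] {n : ℕ} (hn : n = ρ ⟨q, hq⟩) {g : Fin n → M} (hg : SpansAt q g)
    {v : extPow R M ρ} {e : R} (he : e ∉ q)
    (hv : (v : ExteriorAlgebra R M) = e • ExteriorAlgebra.ιMulti R n g) : GeneratesAt q v := by
  subst hn
  intro w
  obtain ⟨s, hs, hsw⟩ := w.2 ⟨q, hq⟩
  obtain ⟨t, ht, c, hc⟩ := hg.generates hsw
  refine ⟨e * (t * s), q.primeCompl.mul_mem he (q.primeCompl.mul_mem ht hs), c, Subtype.ext ?_⟩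
  rw [Submodule.coe_smul, Submodule.coe_smul, hv, mul_smul, mul_smul, hc, smul_comm]

theorem ιMulti_zero_of_eq {M : Type*} [AddCommGroup M] [Module R M] {n : ℕ} (hn : n = 0)
    (v : Fin n → M) : ExteriorAlgebra.ιMulti R n v = 1 := by
  subst hn
  exact ExteriorAlgebra.ιMulti_zero_apply v

variable {X : ℤ → Type u} [∀ i, AddCommGroup (X i)] [∀ i, Module R (X i)]
  {d : ∀ i j, X i →ₗ[R] X j} {a b : ℤ} {r : ℤ → PrimeSpectrum R → ℕ} {l : PrimeSpectrum R → ℕ}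

/-- Subtracting a combination of the lifts `f` from a multiple of `x` leaves a cocycle, which `g`
spans. -/
theorem spansAt_append {q : Ideal R} [q.IsPrime] {i : ℤ} {m n : ℕ}
    {g : Fin m → LinearMap.ker (d i (i + 1))} (hg : SpansAt q g) {f : Fin n → X i}
    (hf : ImageSpansAt d q i f) : SpansAt q (Fin.append (fun j => (g j : X i)) f) := by
  obtain ⟨s, hs, hg⟩ := hg
  obtain ⟨t, ht, hf⟩ := hf
  refine ⟨s * t, q.primeCompl.mul_mem hs ht, fun x => ?_⟩
  obtain ⟨c, hc⟩ := hf x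
  obtain ⟨c', hc'⟩ := hg ⟨t • x - ∑ j, c j • f j, by
    simp [LinearMap.mem_ker, map_sub, map_sum, hc]⟩
  refine ⟨Fin.append c' (s • c), ?_⟩
  rw [Fin.sum_univ_add]
  simp only [Fin.append_left, Fin.append_right, Pi.smul_apply, smul_assoc]
  rw [← Finset.smul_sum, mul_smul]
  have h1 := congrArg Subtype.val hc'
  simp only [Submodule.coe_smul, Submodule.coe_sum, smul_sub] at h1
  rw [← h1]
  abel

variable [IsNoetherianRing R] [∀ i, Module.Finite R (X i)] [∀ i, Module.Projective R (X i)]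

variable (R X) in
omit [IsNoetherianRing R] in
theorem isLocallyConstant_rank (i : ℤ) :
    IsLocallyConstant (Module.rankAtStalk (R := R) (X i)) :=
  have := Module.finitePresentation_of_projective R (X i)
  Module.isLocallyConstant_rankAtStalk

/-- The element `d x ∧ y ∧ x'` of `det (X i)`. -/
noncomputable def wedgeDet (d : ∀ i j, X i →ₗ[R] X j) (y : ExteriorAlgebra R (LinearMap.ker (d 1 2)))
    (x : ∀ i, ExteriorAlgebra R (X i)) (i : ℤ) : detMod R (X i) :=
  extRetract (isLocallyConstant_rank R X i) (X i) (wedge d y x i)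

omit [IsNoetherianRing R] in
theorem RankData.coe_wedgeDet (hr : RankData R X a b r l)
    {y : ExteriorAlgebra R (LinearMap.ker (d 1 2))} (hy : y ∈ extPow R (LinearMap.ker (d 1 2)) l)
    {x : ∀ i, ExteriorAlgebra R (X i)} (hx : Admissible R X a b r x) (i : ℤ) :
    (wedgeDet d y x i : ExteriorAlgebra R (X i)) = wedge d y x i := by
  refine extProj_eq (isLocallyConstant_rank R X i) ?_
  exact extPow_mul (hr.add i) (extPow_mul (fun 𝔭 => rfl) (extPow_map _ (hx.mem (i - 1)))
    (insOne_mem hy i)) (hx.mem i)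

omit [IsNoetherianRing R] in
theorem wedgeDet_of_ne (y y' : ExteriorAlgebra R (LinearMap.ker (d 1 2)))
    (x : ∀ i, ExteriorAlgebra R (X i)) {i : ℤ} (hi : i ≠ 1) :
    wedgeDet d y x i = wedgeDet d y' x i := by
  rw [wedgeDet, wedgeDet, wedge, wedge, insOne_of_ne d y hi, insOne_of_ne d y' hi]

/-- An admissible family of pure wedges adapted to the complex at `q`. -/
theorem RankData.exists_adapted (hr : RankData R X a b r l) (h : CodimOneExact d a b)
    (hR : SerreTwo R) (q : Ideal R) [hqp : q.IsPrime] (hq : q.height ≤ 1) :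
    ∃ x, Admissible R X a b r x ∧ ∃ (e : ℤ → R) (f : ∀ i, Fin (r i ⟨q, hqp⟩) → X i), ∀ i,
      e i ∉ q ∧ ImageSpansAt d q i (f i) ∧ x i = e i • ExteriorAlgebra.ιMulti R _ (f i) := by
  choose f hf using fun i => hr.exists_imageSpansAt h hR q hq i
  choose e he he' using fun i => exists_smul_mem_extPow (hr.loc i) ⟨q, hqp⟩
  -- Outside `[a, b)` the wedge is empty and equals `1`; the default `1` keeps the family
  -- admissible.
  let e' : ℤ → R := fun i => if i ∈ Finset.Ico a b then e i else 1
  have hone : ∀ i ∉ Finset.Ico a b, e' i • ExteriorAlgebra.ιMulti R _ (f i) = 1 := by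
    intro i hi
    simp only [e', if_neg hi, one_smul]
    exact ιMulti_zero_of_eq (hr.eq_zero i hi _) _
  refine ⟨fun i => e' i • ExteriorAlgebra.ιMulti R _ (f i), ⟨fun i => ?_, hone⟩, e', f, fun i =>
    ⟨?_, hf i, rfl⟩⟩
  · by_cases hi : i ∈ Finset.Ico a b
    · simp only [e', if_pos hi]
      exact he' i _ _ (ιMulti_mem _)
    · rw [hone i hi]
      exact one_mem_extPow (hr.eq_zero i hi)
  · by_cases hi : i ∈ Finset.Ico a b
    · simpa only [e', if_pos hi] using he i
    · simp only [e', if_neg hi]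
      exact q.primeCompl.one_mem

/-- Outside degree `1` the coboundaries of `f (i - 1)` span the cocycles at `q`. Together with `f i`
they are as many spanning vectors as the rank, and their wedge is the element in question up to a
factor outside `q`. -/
theorem RankData.generatesAt_of_ne (hr : RankData R X a b r l) (h : CodimOneExact d a b)
    (q : Ideal R) [hqp : q.IsPrime] (hq : q.height ≤ 1)
    {x : ∀ i, ExteriorAlgebra R (X i)} (hx : Admissible R X a b r x) {e : ℤ → R}
    {f : ∀ i, Fin (r i ⟨q, hqp⟩) → X i} (hf : ∀ i, e i ∉ q ∧ ImageSpansAt d q i (f i) ∧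
      x i = e i • ExteriorAlgebra.ιMulti R _ (f i)) {i : ℤ} (hi : i ≠ 1)
    (y : ExteriorAlgebra R (LinearMap.ker (d 1 2))) : GeneratesAt q (wedgeDet d y x i) := by
  rw [wedgeDet_of_ne y 0 x hi]
  refine generatesAt_extPow (hr.add_of_ne i hi ⟨q, hqp⟩)
    (spansAt_append (h.ker_spansAt hq hi (hf (i - 1)).2.1) (hf i).2.1)
    (q.primeCompl.mul_mem (hf (i - 1)).1 (hf i).1) ?_
  rw [hr.coe_wedgeDet (Submodule.zero_mem _) hx, wedge, insOne_of_ne d _ hi, mul_one,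
    (hf (i - 1)).2.2, (hf i).2.2, map_smul, smul_mul_smul_comm, ExteriorAlgebra.map_apply_ιMulti,
    ExteriorAlgebra.ιMulti_mul_ιMulti]
  rfl

/-- In degree `1` the cocycles also need lifts `z` of generators of `H¹`, whose number is right only
when `H¹` is free at `q`; `y` is their wedge. -/
theorem RankData.exists_generatesAt_one (hr : RankData R X a b r l) (h : CodimOneExact d a b)
    (hR : SerreTwo R) (q : Ideal R) [hqp : q.IsPrime] (hq : q.height ≤ 1)
    (hgood : q ∈ minimalPrimes R ∨ H1TorsionFreeAt d q)
    {x : ∀ i, ExteriorAlgebra R (X i)} (hx : Admissible R X a b r x) {e : ℤ → R}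
    {f : ∀ i, Fin (r i ⟨q, hqp⟩) → X i} (hf : ∀ i, e i ∉ q ∧ ImageSpansAt d q i (f i) ∧
      x i = e i • ExteriorAlgebra.ιMulti R _ (f i)) :
    ∃ y ∈ extPow R (LinearMap.ker (d 1 2)) l, GeneratesAt q (wedgeDet d y x 1) ∧
      ∃ t ∉ q, ∃ z : Fin (l ⟨q, hqp⟩) → LinearMap.ker (d 1 2), H1SpansAt d q z ∧
        y = t • ExteriorAlgebra.ιMulti R _ z := by
  obtain ⟨z, hz⟩ := hr.exists_H1SpansAt h hR q hq hgood
  obtain ⟨t, ht, ht'⟩ := exists_smul_mem_extPow hr.loc_l ⟨q, hqp⟩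
  have hy := ht' (LinearMap.ker (d 1 2)) _ (ιMulti_mem z)
  refine ⟨_, hy, ?_, t, ht, z, hz, rfl⟩
  refine generatesAt_extPow (hr.add_one ⟨q, hqp⟩)
    (spansAt_append (i := 1) (h.ker_spansAt_one (hf 0).2.1 hz) (hf 1).2.1)
    (e := e 0 * t * e 1)
    (q.primeCompl.mul_mem (q.primeCompl.mul_mem (hf 0).1 ht) (hf 1).1) ?_
  have happ : (fun j => ((Fin.append (fun j => (⟨d 0 1 (f 0 j), h.dd _ _ _ _⟩ :
      LinearMap.ker (d 1 2))) z j : LinearMap.ker (d 1 2)) : X 1)) =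
      Fin.append (d 0 1 ∘ f 0) ((LinearMap.ker (d 1 2)).subtype ∘ z) := by
    funext j
    refine Fin.addCases (fun j => ?_) (fun j => ?_) j <;> simp
  rw [hr.coe_wedgeDet hy hx, wedge, insOne_one, (hf 1).2.2]
  have h0 : ExteriorAlgebra.map (d (1 - 1) 1) (x (1 - 1)) =
      e 0 • ExteriorAlgebra.ιMulti R _ (d 0 1 ∘ f 0) := by
    rw [show (1 - 1 : ℤ) = 0 from rfl, (hf 0).2.2, map_smul, ExteriorAlgebra.map_apply_ιMulti]
  rw [h0, map_smul, smul_mul_smul_comm, smul_mul_smul_comm, ExteriorAlgebra.map_apply_ιMulti,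
    ExteriorAlgebra.ιMulti_mul_ιMulti, ExteriorAlgebra.ιMulti_mul_ιMulti]
  congr 2
  exact congrArg (fun v => Fin.append v (f 1)) happ.symm

end Generation

/-! ### Local coordinates on projective modules. -/

section Coordinates

variable {R : Type u} [CommRing R] {F : Type u} [AddCommGroup F] [Module R F] [Module.Finite R F]
  [Module.Projective R F]

/-- Coordinates on a projective module at a prime. -/
theorem exists_coordinates (q : Ideal R) [hq : q.IsPrime] {n : ℕ}
    (hn : Module.rankAtStalk (R := R) F ⟨q, hq⟩ = n) :
    ∃ (g : Fin n → F) (κ : Fin n → Module.Dual R F) (σ : Fin n → R), SpansAt q g ∧ (∀ j, σ j ∉ q) ∧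
      ∀ j k, κ j (g k) = if j = k then σ j else 0 := by
  have hfp := Module.finitePresentation_of_projective R F
  have hfree : Module.Free (Localization.AtPrime q) (LocalizedModule q.primeCompl F) :=
    Module.free_of_flat_of_isLocalRing
  let B : Module.Basis (Fin n) (Localization.AtPrime q) (LocalizedModule q.primeCompl F) :=
    Module.finBasisOfFinrankEq _ _ hn
  let φ := LocalizedModule.mkLinearMap q.primeCompl F
  have hg : ∀ k, ∃ (g : F) (s : q.primeCompl), s • B k = φ g := fun k => by
    obtain ⟨⟨g, s⟩, h⟩ := IsLocalizedModule.surj q.primeCompl φ (B k)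
    exact ⟨g, s, h⟩
  choose g s hgs using hg
  have hκ : ∀ j, ∃ (κ : Module.Dual R F) (t : q.primeCompl), ∀ v,
      algebraMap R (Localization.AtPrime q) (κ v) = (t : R) • B.coord j (φ v) := fun j => by
    obtain ⟨κ, t, h⟩ := Module.FinitePresentation.exists_lift_of_isLocalizedModule q.primeCompl
      (Algebra.linearMap R (Localization.AtPrime q)) (((B.coord j).restrictScalars R).comp φ)
    exact ⟨κ, t, fun v => congrArg (fun f => f v) h⟩
  choose κ t hκt using hκ
  have hval : ∀ j k, ∃ w : q.primeCompl, (w : R) * κ j (g k) =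
      w * if j = k then (t j : R) * s k else 0 := by
    intro j k
    have : algebraMap R (Localization.AtPrime q) (κ j (g k)) =
        algebraMap R (Localization.AtPrime q) (if j = k then (t j : R) * s k else 0) := by
      rw [hκt, ← hgs, Submonoid.smul_def, ← Algebra.algebraMap_self_apply (R := R) (s k : R),
        LinearMap.map_smul_of_tower]
      simp only [Module.Basis.coord_apply, Module.Basis.repr_self, Algebra.algebraMap_self_apply]
      by_cases hjk : j = k
      · subst hjk
        simp [Algebra.smul_def]
      · simp [hjk]
    obtain ⟨w, hw⟩ := (IsLocalization.eq_iff_exists q.primeCompl _).1 this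
    exact ⟨w, hw⟩
  choose w hw using hval
  -- One common multiplier turns the local duality relations into identities in `R`.
  let W : q.primeCompl := ∏ j, ∏ k, w j k
  have hW : ∀ j k, (W : R) * κ j (g k) = if j = k then W * ((t j : R) * s j) else 0 := by
    intro j k
    obtain ⟨c, hc⟩ : w j k ∣ W := (Finset.dvd_prod_of_mem (fun k => w j k) (Finset.mem_univ k)).trans
      (Finset.dvd_prod_of_mem (fun j => ∏ k, w j k) (Finset.mem_univ j))
    have := congrArg (fun x => (c : R) * x) (hw j k)
    rw [hc]
    push_cast
    split_ifs with hjk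
    · subst hjk
      rw [if_pos rfl] at this
      linear_combination this
    · rw [if_neg hjk] at this
      linear_combination this
  refine ⟨g, fun j => (W : R) • κ j, fun j => W * ((t j : R) * s j), ?_, fun j =>
    (W * (t j * s j)).2, hW⟩
  have hspan : ∀ x : F, ∃ s ∉ q, s • (LinearMap.id : F →ₗ[R] F) x ∈
      Submodule.span R (Set.range g) := by
    intro x
    refine exists_smul_mem_of_mk_mem_span _ ?_
    have h1 : (LocalizedModule.mk x 1 : LocalizedModule q.primeCompl F) = _ :=
      (B.sum_repr (LocalizedModule.mk x 1)).symm
    rw [LinearMap.id_apply, h1]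
    refine Submodule.sum_mem _ fun k _ => Submodule.smul_mem _ _ ?_
    have h2 : B k = Localization.mk 1 (s k) • φ (g k) := by
      rw [← hgs, Submonoid.smul_def, ← algebraMap_smul (Localization.AtPrime q) (s k : R), smul_smul,
        ← Localization.mk_one_eq_algebraMap, Localization.mk_mul, one_mul, mul_one,
        Localization.mk_self, one_smul]
    rw [h2]
    exact Submodule.smul_mem _ _ (Submodule.subset_span ⟨_, Submodule.subset_span ⟨k, rfl⟩, rfl⟩)
  obtain ⟨s', hs', h'⟩ := exists_uniform_smul_mem _ _ hspan
  refine ⟨s', hs', fun m => ?_⟩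
  obtain ⟨c, hc⟩ := (Submodule.mem_span_range_iff_exists_fun R).1 (h' m)
  exact ⟨c, hc.symm⟩

end Coordinates

/-! ### Cramer's rule and functionals on determinants. -/

section Determinants

variable {R : Type u} [CommRing R] {F : Type u} [AddCommGroup F] [Module R F]

/-- Cramer's rule: elements on which an alternating form does not vanish at `q` generate at `q`. -/
theorem SpansAt.of_notMem {q : Ideal R} [hq : q.IsPrime] {n : ℕ} {g : Fin n → F}
    (hg : SpansAt q g) (A : F [⋀^Fin n]→ₗ[R] R) {e : Fin n → F} (he : A e ∉ q) : SpansAt q e := by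
  obtain ⟨s, hs, hg⟩ := hg
  choose c hc using hg
  let a : Matrix (Fin n) (Fin n) R := fun k => c (e k)
  let G : (Fin n → R) →ₗ[R] F := Fintype.linearCombination R g
  have hG : ∀ k, G (a k) = s • e k := fun k => by
    rw [hc, Fintype.linearCombination_apply]
  -- The rows of `a` express `s • e k` through `g`, and an alternating form in `n` vectors of `R^n`
  -- is a multiple of the determinant. Hence `a.det ∉ q`, and the adjugate inverts `a` up to that
  -- factor.
  have hdet : a.det * A g = s ^ n * A e := by
    have h1 := congrArg (fun f => f a) ((A.compLinearMap G).eq_smul_basis_det (Pi.basisFun R (Fin n)))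
    simp only [Pi.basisFun_det, AlternatingMap.compLinearMap_apply] at h1
    have h2 : A (fun k => G (a k)) = s ^ n * A e := by
      simp_rw [hG]
      have := A.toMultilinearMap.map_smul_univ (fun _ => s) e
      simpa using this
    have h3 : A (fun k => G (Pi.basisFun R (Fin n) k)) = A g := by
      congr 1
      funext k
      simp [G, Fintype.linearCombination_apply, Pi.single_apply]
    rw [← h2, ← h3, mul_comm]
    exact h1.symm
  have hsn : s ^ n * A e ∉ q :=
    q.primeCompl.mul_mem (fun h => hs (hq.mem_of_pow_mem n h)) he
  have hda : a.det ∉ q := fun h => hsn (hdet ▸ q.mul_mem_right _ h)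
  refine ⟨a.det * s, q.primeCompl.mul_mem hda hs, fun m => ?_⟩
  refine ⟨fun k => Matrix.vecMul (c m) a.adjugate k * s, ?_⟩
  have h1 : G (Matrix.vecMul (Matrix.vecMul (c m) a.adjugate) a) = a.det • G (c m) := by
    rw [Matrix.vecMul_vecMul, Matrix.adjugate_mul, Matrix.vecMul_smul, Matrix.vecMul_one, map_smul]
  rw [Matrix.vecMul_eq_sum, map_sum] at h1
  have h2 : G (c m) = s • m := by rw [hc, Fintype.linearCombination_apply]
  rw [mul_smul, ← h2, ← h1]
  refine Finset.sum_congr rfl fun k _ => ?_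
  rw [map_smul, hG, mul_smul]

variable [Module.Finite R F] [Module.Projective R F]

/-- The determinant of local coordinate functionals, evaluated on the wedge of the coordinate
vectors, is a product of elements outside `q`. -/
theorem exists_dual_notMem (q : Ideal R) [hq : q.IsPrime] :
    ∃ (θ : Module.Dual R (detMod R F)) (v : detMod R F), θ v ∉ q := by
  have hfp := Module.finitePresentation_of_projective R F
  obtain ⟨g, κ, σ, -, hσ, hκ⟩ := exists_coordinates (F := F) q rfl
  obtain ⟨e, he, he'⟩ := exists_smul_mem_extPow
    (Module.isLocallyConstant_rankAtStalk (R := R) (M := F)) ⟨q, hq⟩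
  let D := (Matrix.detRowAlternating (R := R)
    (n := Fin (Module.rankAtStalk (R := R) F ⟨q, hq⟩))).compLinearMap (LinearMap.pi κ)
  refine ⟨ExteriorAlgebra.liftAlternating (Pi.single _ D) ∘ₗ (detMod R F).subtype,
    ⟨_, he' F _ (ιMulti_mem g)⟩, ?_⟩
  rw [LinearMap.comp_apply, Submodule.subtype_apply, map_smul,
    ExteriorAlgebra.liftAlternating_apply_ιMulti, Pi.single_eq_same]
  have hD : D g = ∏ j, σ j := by
    have : D g = (Matrix.diagonal σ).det := by
      rw [← Matrix.det_transpose]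
      refine congrArg Matrix.det (Matrix.ext fun j k => ?_)
      simp [Matrix.diagonal_apply, hκ, Matrix.transpose_apply]
    rw [this, Matrix.det_diagonal]
  rw [hD, smul_eq_mul]
  exact q.primeCompl.mul_mem he (q.primeCompl.prod_mem fun j _ => hσ j)

theorem GeneratesAt.exists_dual_notMem {q : Ideal R} [hq : q.IsPrime] {u : detMod R F}
    (hu : GeneratesAt q u) : ∃ θ : Module.Dual R (detMod R F), θ u ∉ q := by
  obtain ⟨θ, v, hv⟩ := PerfectDet.exists_dual_notMem (F := F) q
  obtain ⟨s, hs, c, hc⟩ := hu v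
  refine ⟨θ, fun h => q.primeCompl.mul_mem hs hv ?_⟩
  rw [← smul_eq_mul, ← map_smul, hc, map_smul]
  exact q.mul_mem_left _ h

end Determinants

/-! ### Generators and functionals on tensor products. -/

section Tensor

variable {R : Type u} [CommRing R]

theorem GeneratesAt.uniform {M : Type*} [AddCommMonoid M] [Module R M] [Module.Finite R M]
    {q : Ideal R} [q.IsPrime] {u : M} (hu : GeneratesAt q u) :
    ∃ s ∉ q, ∀ w, ∃ c : R, s • w = c • u := by
  obtain ⟨s, hs, h⟩ := exists_uniform_smul_mem (q := q) LinearMap.id (Submodule.span R {u})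
    fun x => by
      obtain ⟨s, hs, c, hc⟩ := hu x
      exact ⟨s, hs, Submodule.mem_span_singleton.2 ⟨c, hc.symm⟩⟩
  refine ⟨s, hs, fun w => ?_⟩
  obtain ⟨c, hc⟩ := Submodule.mem_span_singleton.1 (h w)
  exact ⟨c, hc.symm⟩

/-- A functional not vanishing at `q` on a generator at `q` generates the dual at `q`. -/
theorem GeneratesAt.dual {M : Type*} [AddCommMonoid M] [Module R M] [Module.Finite R M]
    {q : Ideal R} [q.IsPrime] {u : M} (hu : GeneratesAt q u) {θ : Module.Dual R M} (hθ : θ u ∉ q) :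
    GeneratesAt q θ := by
  obtain ⟨s, hs, h⟩ := hu.uniform
  intro φ
  refine ⟨θ u * s, q.primeCompl.mul_mem hθ hs, s * φ u, LinearMap.ext fun w => ?_⟩
  obtain ⟨c, hc⟩ := h w
  have h1 := congrArg θ hc
  have h2 := congrArg φ hc
  simp only [map_smul, smul_eq_mul] at h1 h2
  simp only [LinearMap.smul_apply, smul_eq_mul]
  linear_combination θ u * h2 - φ u * h1

theorem GeneratesAt.tmul {M N : Type*} [AddCommMonoid M] [Module R M] [AddCommMonoid N] [Module R N]
    {q : Ideal R} [q.IsPrime] {u : M} {v : N} (hu : GeneratesAt q u) (hv : GeneratesAt q v) :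
    GeneratesAt q (u ⊗ₜ[R] v) := by
  intro w
  induction w with
  | zero => exact ⟨1, q.primeCompl.one_mem, 0, by simp⟩
  | tmul x y =>
    obtain ⟨s, hs, c, hc⟩ := hu x
    obtain ⟨t, ht, c', hc'⟩ := hv y
    refine ⟨s * t, q.primeCompl.mul_mem hs ht, c * c', ?_⟩
    rw [← TensorProduct.smul_tmul_smul, hc, hc', TensorProduct.smul_tmul_smul]
  | add x y hx hy =>
    obtain ⟨s, hs, c, hc⟩ := hx
    obtain ⟨t, ht, c', hc'⟩ := hy
    refine ⟨s * t, q.primeCompl.mul_mem hs ht, t * c + s * c', ?_⟩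
    rw [smul_add, add_smul, mul_smul t, mul_smul s c', ← hc, ← hc', smul_smul, smul_smul, mul_comm t]

theorem GeneratesAt.exists_smul_eq_tmul {M N : Type*} [AddCommMonoid M] [Module R M]
    [AddCommMonoid N] [Module R N] {q : Ideal R} [q.IsPrime] {u : M} (hu : GeneratesAt q u)
    (w : M ⊗[R] N) : ∃ s ∉ q, ∃ n : N, s • w = u ⊗ₜ[R] n := by
  induction w with
  | zero => exact ⟨1, q.primeCompl.one_mem, 0, by simp⟩
  | tmul x y =>
    obtain ⟨s, hs, c, hc⟩ := hu x
    exact ⟨s, hs, c • y, by rw [TensorProduct.smul_tmul', hc, TensorProduct.smul_tmul]⟩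
  | add x y hx hy =>
    obtain ⟨s, hs, m, hm⟩ := hx
    obtain ⟨t, ht, n, hn⟩ := hy
    refine ⟨s * t, q.primeCompl.mul_mem hs ht, t • m + s • n, ?_⟩
    rw [smul_add, TensorProduct.tmul_add, TensorProduct.tmul_smul, TensorProduct.tmul_smul, ← hm,
      ← hn, smul_smul, smul_smul, mul_comm t]

theorem GeneratesAt.tprod {ι : Type*} [Fintype ι] {M : ι → Type*} [∀ i, AddCommGroup (M i)]
    [∀ i, Module R (M i)] {q : Ideal R} [q.IsPrime] {u : ∀ i, M i} (hu : ∀ i, GeneratesAt q (u i)) :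
    GeneratesAt q (PiTensorProduct.tprod R u) := by
  intro w
  induction w using PiTensorProduct.induction_on with
  | smul_tprod a x =>
    choose s hs c hc using fun i => hu i (x i)
    refine ⟨∏ i, s i, q.primeCompl.prod_mem fun i _ => hs i, a * ∏ i, c i, ?_⟩
    rw [smul_comm, mul_smul]
    congr 1
    rw [← MultilinearMap.map_smul_univ, ← MultilinearMap.map_smul_univ]
    simp only [hc]
  | add x y hx hy =>
    obtain ⟨s, hs, c, hc⟩ := hx
    obtain ⟨t, ht, c', hc'⟩ := hy
    refine ⟨s * t, q.primeCompl.mul_mem hs ht, t * c + s * c', ?_⟩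
    rw [smul_add, add_smul, mul_smul t, mul_smul s c', ← hc, ← hc', smul_smul, smul_smul, mul_comm t]

/-- The tensor product is a retract of a tensor product of finite free modules. -/
theorem piTensorProduct_projective {ι : Type*} [Finite ι] (M : ι → Type*)
    [∀ i, AddCommGroup (M i)] [∀ i, Module R (M i)] [∀ i, Module.Finite R (M i)]
    [∀ i, Module.Projective R (M i)] : Module.Projective R (⨂[R] i, M i) := by
  have key : ∀ i, ∃ (n : ℕ) (f : (Fin n → R) →ₗ[R] M i) (g : M i →ₗ[R] (Fin n → R)),
      f ∘ₗ g = LinearMap.id := fun i => by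
    obtain ⟨n, f, hf⟩ := Module.Finite.exists_fin' R (M i)
    obtain ⟨g, hg⟩ := Module.projective_lifting_property f LinearMap.id hf
    exact ⟨n, f, g, hg⟩
  choose n f g hfg using key
  have hfree : Module.Free R (⨂[R] i, (Fin (n i) → R)) :=
    Module.Free.of_basis (Basis.piTensorProduct fun i => Pi.basisFun R (Fin (n i)))
  refine Module.Projective.of_split (PiTensorProduct.map g) (PiTensorProduct.map f) ?_
  rw [← PiTensorProduct.map_comp]
  simp only [hfg]
  exact PiTensorProduct.map_id

/-- The functional `⨂ θ i ↦ ∏ θ i (u i)` on a tensor product of dual modules. -/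
noncomputable def dualEv {ι : Type*} [Fintype ι] {M : ι → Type*} [∀ i, AddCommGroup (M i)]
    [∀ i, Module R (M i)] (u : ∀ i, M i) : (⨂[R] i, Module.Dual R (M i)) →ₗ[R] R :=
  PiTensorProduct.lift ((MultilinearMap.mkPiAlgebra R ι R).compLinearMap
    fun i => Module.Dual.eval R (M i) (u i))

/-- The functional `⨂ w i ↦ ∏ θ i (w i)` on a tensor product. -/
noncomputable def prodEv {ι : Type*} [Fintype ι] {M : ι → Type*} [∀ i, AddCommGroup (M i)]
    [∀ i, Module R (M i)] (θ : ∀ i, Module.Dual R (M i)) : (⨂[R] i, M i) →ₗ[R] R :=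
  PiTensorProduct.lift ((MultilinearMap.mkPiAlgebra R ι R).compLinearMap θ)

variable {ι : Type*} [Fintype ι] {M : ι → Type*} [∀ i, AddCommGroup (M i)] [∀ i, Module R (M i)]

theorem dualEv_tprod (u : ∀ i, M i) (θ : ∀ i, Module.Dual R (M i)) :
    dualEv u (PiTensorProduct.tprod R θ) = ∏ i, θ i (u i) := by
  simp [dualEv, PiTensorProduct.lift.tprod]

theorem prodEv_tprod (u : ∀ i, M i) (θ : ∀ i, Module.Dual R (M i)) :
    prodEv θ (PiTensorProduct.tprod R u) = ∏ i, θ i (u i) := by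
  simp [prodEv, PiTensorProduct.lift.tprod]

theorem apply_tmul_eq_dualEv {N : Type*} [AddCommMonoid N] [Module R N]
    {Φ : N ⊗[R] (⨂[R] i, Module.Dual R (M i)) →ₗ[R] R} {n : N} {u : ∀ i, M i}
    (hΦ : ∀ θ, Φ (n ⊗ₜ PiTensorProduct.tprod R θ) = ∏ i, θ i (u i))
    (ε : ⨂[R] i, Module.Dual R (M i)) : Φ (n ⊗ₜ ε) = dualEv u ε := by
  have : Φ ∘ₗ TensorProduct.mk R _ _ n = dualEv u :=
    PiTensorProduct.ext (MultilinearMap.ext fun θ => by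
      simp only [LinearMap.compMultilinearMap_apply, dualEv_tprod]
      exact hΦ θ)
  exact congrArg (fun f => f ε) this

theorem dualEv_add {u u' u'' : ∀ i, M i} (i : ι) (h : u i = u' i + u'' i)
    (h' : ∀ j ≠ i, u j = u' j) (h'' : ∀ j ≠ i, u j = u'' j) :
    dualEv (R := R) u = dualEv u' + dualEv u'' := by
  classical
  refine PiTensorProduct.ext (MultilinearMap.ext fun θ => ?_)
  simp only [LinearMap.compMultilinearMap_apply, LinearMap.add_apply, dualEv_tprod]
  rw [← Finset.mul_prod_erase _ _ (Finset.mem_univ i), ← Finset.mul_prod_erase _ _ (Finset.mem_univ i),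
    ← Finset.mul_prod_erase _ _ (Finset.mem_univ i), h, map_add, add_mul]
  congr 2
  · exact Finset.prod_congr rfl fun j hj => by rw [h' j (Finset.ne_of_mem_erase hj)]
  · exact Finset.prod_congr rfl fun j hj => by rw [h'' j (Finset.ne_of_mem_erase hj)]

theorem dualEv_smul {u u' : ∀ i, M i} (i : ι) (c : R) (h : u i = c • u' i)
    (h' : ∀ j ≠ i, u j = u' j) : dualEv (R := R) u = c • dualEv u' := by
  classical
  refine PiTensorProduct.ext (MultilinearMap.ext fun θ => ?_)
  simp only [LinearMap.compMultilinearMap_apply, LinearMap.smul_apply, dualEv_tprod]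
  rw [← Finset.mul_prod_erase _ _ (Finset.mem_univ i), ← Finset.mul_prod_erase _ _ (Finset.mem_univ i),
    h, map_smul, smul_mul_assoc]
  congr 2
  exact Finset.prod_congr rfl fun j hj => by rw [h' j (Finset.ne_of_mem_erase hj)]

end Tensor

/-! ### Construction of the canonical map by gluing. -/

section Construction

variable {R : Type u} [CommRing R] {X : ℤ → Type u} [∀ i, AddCommGroup (X i)]
  [∀ i, Module R (X i)]
  {d : ∀ i j, X i →ₗ[R] X j} {a b : ℤ} {r : ℤ → PrimeSpectrum R → ℕ} {l : PrimeSpectrum R → ℕ}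
  {H : Type u} [AddCommGroup H] [Module R H] {π : LinearMap.ker (d 1 2) →ₗ[R] H}

theorem prod_Icc_eq_even_mul_odd (a b : ℤ) (F : ℤ → R) :
    ∏ i ∈ Finset.Icc a b, F i = (∏ i : (Finset.Icc a b).filter Even, F i) *
      ∏ i : (Finset.Icc a b).filter Odd, F i := by
  rw [Finset.prod_coe_sort _ F, Finset.prod_coe_sort _ F,
    ← Finset.prod_filter_mul_prod_filter_not _ Even]
  simp only [Int.not_even_iff_odd]

variable [IsNoetherianRing R] [∀ i, Module.Finite R (X i)] [∀ i, Module.Projective R (X i)]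

/-- `d x ∧ y` depends only on the class of `y` modulo coboundaries. -/
theorem RankData.mul_eq_zero_of_map_eq_zero (hr : RankData R X a b r l) (h : CodimOneExact d a b)
    (hR : SerreTwo R) (hπ : Function.Surjective π)
    (hker : ∀ z, π z = 0 → ∃ w, d 0 1 w = (z : X 1)) {x : ExteriorAlgebra R (X 0)}
    (hx : x ∈ extPow R (X 0) (r 0)) {k : ExteriorAlgebra R (LinearMap.ker (d 1 2))}
    (hk : ExteriorAlgebra.map π k = 0) :
    ExteriorAlgebra.map (d 0 1) x * ExteriorAlgebra.map (LinearMap.ker (d 1 2)).subtype k = 0 := by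
  refine hR.eq_zero_of_projective fun p hp => ?_
  have hpp : p.IsPrime := hp.1.1
  have hht := height_le_one_of_mem_minimalPrimes hp
  obtain ⟨f, hf⟩ := hr.exists_imageSpansAt h hR p hht 0
  let d' : X 0 →ₗ[R] LinearMap.ker (d 1 2) := (d 0 1).codRestrict _ fun v => h.dd _ _ _ v
  let j : LinearMap.range (d 0 1) →ₗ[R] LinearMap.ker (d 1 2) :=
    Submodule.inclusion (by rintro _ ⟨v, rfl⟩; exact h.dd _ _ _ v)
  have hjd : j ∘ₗ (d 0 1).rangeRestrict = d' := rfl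
  let W := ExteriorAlgebra.map d' x
  let φ : LinearMap.ker π →ₗ[R] ExteriorAlgebra R (LinearMap.ker (d 1 2)) :=
    LinearMap.mulLeft R W ∘ₗ ExteriorAlgebra.ι R ∘ₗ (LinearMap.ker π).subtype
  have hloc : ∀ z, ∃ s ∉ p, s • φ z ∈ (⊥ : Submodule R _) := by
    intro z
    obtain ⟨w, hw⟩ := hker z z.2
    have hm := extPow_mul (τ := fun 𝔭 => r 0 𝔭 + 1) (fun 𝔭 => rfl)
      (extPow_map (d 0 1).rangeRestrict hx) (ι_mem_extPow (R := R) ((d 0 1).rangeRestrict w))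
    obtain ⟨s, hs, hsm⟩ := hm ⟨p, hpp⟩
    obtain ⟨t, ht, h0⟩ := hf.range.eq_zero_of_lt (Nat.lt_succ_self _) hsm
    refine ⟨t * s, p.primeCompl.mul_mem ht hs, (Submodule.mem_bot R).2 ?_⟩
    have := congrArg (ExteriorAlgebra.map j) h0
    rw [map_zero, map_smul, map_smul, map_mul, ExteriorAlgebra.map_apply_ι,
      ← AlgHom.comp_apply, ExteriorAlgebra.map_comp_map, hjd] at this
    rw [mul_smul, ← this]
    have hz : (z : LinearMap.ker (d 1 2)) = d' w := Subtype.ext hw.symm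
    simp only [φ, W, LinearMap.comp_apply, Submodule.subtype_apply, LinearMap.mulLeft_apply, hz]
    rfl
  -- Each coboundary annihilates `W` only up to its own factor outside `p`. As `ker π` is finitely
  -- generated, one factor serves all of them and can be absorbed into `W`.
  obtain ⟨s, hs, hφ⟩ := exists_uniform_smul_mem φ ⊥ hloc
  have h0 := PerfectDet.mul_eq_zero_of_map_eq_zero (W := s • W) π hπ (fun z hz => by
    rw [smul_mul_assoc]
    exact (Submodule.mem_bot R).1 (hφ ⟨z, hz⟩)) hk
  refine ⟨s, hs, ?_⟩
  have := congrArg (ExteriorAlgebra.map (LinearMap.ker (d 1 2)).subtype) h0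
  rw [map_zero, map_mul, map_smul, smul_mul_assoc, ← AlgHom.comp_apply,
    ExteriorAlgebra.map_comp_map] at this
  exact this

theorem RankData.wedgeDet_add (hr : RankData R X a b r l) (h : CodimOneExact d a b)
    (hR : SerreTwo R) (hπ : Function.Surjective π)
    (hker : ∀ z, π z = 0 → ∃ w, d 0 1 w = (z : X 1)) {x : ∀ i, ExteriorAlgebra R (X i)}
    (hx : Admissible R X a b r x) {y y' y'' : ExteriorAlgebra R (LinearMap.ker (d 1 2))}
    (hy : ExteriorAlgebra.map π y = ExteriorAlgebra.map π y' + ExteriorAlgebra.map π y'') :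
    wedgeDet d y x 1 = wedgeDet d y' x 1 + wedgeDet d y'' x 1 := by
  have h0 := hr.mul_eq_zero_of_map_eq_zero h hR hπ hker (hx.mem 0) (k := y - (y' + y''))
    (by rw [map_sub, map_add, hy, sub_self])
  rw [map_sub, map_add, mul_sub, sub_eq_zero] at h0
  rw [wedgeDet, wedgeDet, wedgeDet, ← map_add]
  congr 1
  simp only [wedge, insOne_one]
  rw [← add_mul, ← mul_add]
  congr 1

theorem RankData.wedgeDet_smul (hr : RankData R X a b r l) (h : CodimOneExact d a b)
    (hR : SerreTwo R) (hπ : Function.Surjective π)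
    (hker : ∀ z, π z = 0 → ∃ w, d 0 1 w = (z : X 1)) {x : ∀ i, ExteriorAlgebra R (X i)}
    (hx : Admissible R X a b r x) {y y' : ExteriorAlgebra R (LinearMap.ker (d 1 2))} (c : R)
    (hy : ExteriorAlgebra.map π y = c • ExteriorAlgebra.map π y') :
    wedgeDet d y x 1 = c • wedgeDet d y' x 1 := by
  have h0 := hr.mul_eq_zero_of_map_eq_zero h hR hπ hker (hx.mem 0) (k := y - c • y')
    (by rw [map_sub, map_smul, hy, sub_self])
  rw [map_sub, map_smul, mul_sub, sub_eq_zero, mul_smul_comm] at h0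
  rw [wedgeDet, wedgeDet, ← map_smul]
  congr 1
  simp only [wedge, insOne_one]
  rw [← smul_mul_assoc]
  congr 1

variable (R X) in
/-- The determinant of a complex with terms `X i`. -/
abbrev DetMod (a b : ℤ) : Type u :=
  (⨂[R] i : (Finset.Icc a b).filter Even, detMod R (X i)) ⊗[R]
    (⨂[R] i : (Finset.Icc a b).filter Odd, Module.Dual R (detMod R (X i)))

/-- The elements `wedgeDet d y x i` in even degrees; they do not depend on `y`. -/
noncomputable abbrev evenWedge (d : ∀ i j, X i →ₗ[R] X j) (a b : ℤ)
    (x : ∀ i, ExteriorAlgebra R (X i)) : ∀ i : (Finset.Icc a b).filter Even, detMod R (X i) :=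
  fun i => wedgeDet d 0 x i

/-- The elements `wedgeDet d y x i` in odd degrees. -/
noncomputable abbrev oddWedge (d : ∀ i j, X i →ₗ[R] X j) (a b : ℤ)
    (y : ExteriorAlgebra R (LinearMap.ker (d 1 2))) (x : ∀ i, ExteriorAlgebra R (X i)) :
    ∀ i : (Finset.Icc a b).filter Odd, detMod R (X i) :=
  fun i => wedgeDet d y x i

/-- The product of the values of functionals in even degrees. -/
noncomputable def evenCoeff (d : ∀ i j, X i →ₗ[R] X j) (a b : ℤ) (x : ∀ i, ExteriorAlgebra R (X i))
    (θ : ∀ i : (Finset.Icc a b).filter Even, Module.Dual R (detMod R (X i))) : R :=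
  ∏ i, θ i (evenWedge d a b x i)

/-- The functional on `DetMod` given by functionals in even degrees and elements in odd degrees. -/
noncomputable def detEv (d : ∀ i j, X i →ₗ[R] X j) (a b : ℤ)
    (y : ExteriorAlgebra R (LinearMap.ker (d 1 2))) (x : ∀ i, ExteriorAlgebra R (X i))
    (θ : ∀ i : (Finset.Icc a b).filter Even, Module.Dual R (detMod R (X i))) :
    DetMod R X a b →ₗ[R] R :=
  LinearMap.mul' R R ∘ₗ TensorProduct.map (prodEv θ)
    (dualEv (oddWedge d a b y x))

omit [IsNoetherianRing R] in
theorem detEv_tmul (y : ExteriorAlgebra R (LinearMap.ker (d 1 2))) (x : ∀ i, ExteriorAlgebra R (X i))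
    (θ : ∀ i : (Finset.Icc a b).filter Even, Module.Dual R (detMod R (X i)))
    (w : ⨂[R] i : (Finset.Icc a b).filter Even, detMod R (X i))
    (ε : ⨂[R] i : (Finset.Icc a b).filter Odd, Module.Dual R (detMod R (X i))) :
    detEv d a b y x θ (w ⊗ₜ ε) = prodEv θ w * dualEv (oddWedge d a b y x) ε := rfl

omit [IsNoetherianRing R] in
theorem wedgeDet_even (y : ExteriorAlgebra R (LinearMap.ker (d 1 2)))
    (x : ∀ i, ExteriorAlgebra R (X i)) (i : (Finset.Icc a b).filter Even) :
    wedgeDet d y x i = wedgeDet d 0 x i := by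
  refine wedgeDet_of_ne y 0 x fun hi => ?_
  have := (Finset.mem_filter.1 i.2).2
  rw [hi] at this
  exact absurd this (by decide)

/-- This is the exchange of two families, split into even and odd degrees: the odd part divided by
the even part does not depend on the family. -/
theorem RankData.prod_comm (hr : RankData R X a b r l) (h : CodimOneExact d a b) (hR : SerreTwo R)
    {y : ExteriorAlgebra R (LinearMap.ker (d 1 2))} (hy : y ∈ extPow R (LinearMap.ker (d 1 2)) l)
    {x x' : ∀ i, ExteriorAlgebra R (X i)} (hx : Admissible R X a b r x)
    (hx' : Admissible R X a b r x')
    (θ : ∀ i : (Finset.Icc a b).filter Even, Module.Dual R (detMod R (X i)))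
    (ψ : ∀ i : (Finset.Icc a b).filter Odd, Module.Dual R (detMod R (X i))) :
    evenCoeff d a b x θ * ∏ j, ψ j (oddWedge d a b y x' j) =
      evenCoeff d a b x' θ * ∏ j, ψ j (oddWedge d a b y x j) := by
  let ω : ∀ i, Module.Dual R (detMod R (X i)) := fun i =>
    if hi : i ∈ (Finset.Icc a b).filter Even then θ ⟨i, hi⟩ else
      if hi : i ∈ (Finset.Icc a b).filter Odd then ψ ⟨i, hi⟩ else 0
  have hω : ∀ i : (Finset.Icc a b).filter Even, ω i = θ i := fun i => dif_pos i.2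
  have hne : ∀ i : (Finset.Icc a b).filter Odd, ¬ Even (i : ℤ) := fun i =>
    Int.not_even_iff_odd.2 (Finset.mem_filter.1 i.2).2
  have hω' : ∀ i : (Finset.Icc a b).filter Odd, ω i = ψ i := fun i => by
    have : (i : ℤ) ∉ (Finset.Icc a b).filter Even := fun hi => hne i (Finset.mem_filter.1 hi).2
    simp only [ω, dif_neg this]
    exact dif_pos i.2
  have key : ∀ α β : ∀ i, ExteriorAlgebra R (X i), mixedProd d a b y
      (fun i => ω i ∘ₗ extRetract (isLocallyConstant_rank R X i) (X i)) α β =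
      evenCoeff d a b α θ * ∏ j, ψ j (oddWedge d a b y β j) := by
    intro α β
    rw [mixedProd, prod_Icc_eq_even_mul_odd]
    congr 1
    · refine Finset.prod_congr rfl fun i _ => ?_
      rw [if_pos (Finset.mem_filter.1 i.2).2, ← hω]
      exact congrArg (ω i) (wedgeDet_even y α i)
    · refine Finset.prod_congr rfl fun i _ => ?_
      rw [if_neg (hne i), ← hω']
      rfl
  rw [← key, ← key]
  exact hr.mixedProd_comm h hR hy _ hx hx'

/-- Compatibility of the linear system: the value prescribed by the family `x` satisfies the
equation belonging to any other family `x'`. -/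
theorem RankData.detEv_tprod_tmul (hr : RankData R X a b r l) (h : CodimOneExact d a b)
    (hR : SerreTwo R) {y : ExteriorAlgebra R (LinearMap.ker (d 1 2))}
    (hy : y ∈ extPow R (LinearMap.ker (d 1 2)) l)
    {x x' : ∀ i, ExteriorAlgebra R (X i)} (hx : Admissible R X a b r x)
    (hx' : Admissible R X a b r x')
    (θ : ∀ i : (Finset.Icc a b).filter Even, Module.Dual R (detMod R (X i)))
    (ε : ⨂[R] i : (Finset.Icc a b).filter Odd, Module.Dual R (detMod R (X i))) :
    detEv d a b y x' θ (PiTensorProduct.tprod R (evenWedge d a b x) ⊗ₜ ε) =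
      evenCoeff d a b x' θ * dualEv (oddWedge d a b y x) ε := by
  have : evenCoeff d a b x θ • dualEv (R := R) (oddWedge d a b y x') =
      evenCoeff d a b x' θ • dualEv (R := R) (oddWedge d a b y x) := by
    refine PiTensorProduct.ext (MultilinearMap.ext fun ψ => ?_)
    simp only [LinearMap.compMultilinearMap_apply, LinearMap.smul_apply, dualEv_tprod, smul_eq_mul]
    exact hr.prod_comm h hR hy hx hx' θ ψ
  rw [detEv_tmul, prodEv_tprod]
  exact congrArg (fun f => f ε) this

/-- An adapted family, with functionals whose coefficient does not vanish at `q`. -/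
theorem RankData.exists_evenCoeff_notMem (hr : RankData R X a b r l) (h : CodimOneExact d a b)
    (hR : SerreTwo R) (q : Ideal R) [hqp : q.IsPrime] (hq : q.height ≤ 1) :
    ∃ x, Admissible R X a b r x ∧ ∃ θ, evenCoeff d a b x θ ∉ q ∧
      ∃ (e : ℤ → R) (f : ∀ i, Fin (r i ⟨q, hqp⟩) → X i), ∀ i,
        e i ∉ q ∧ ImageSpansAt d q i (f i) ∧ x i = e i • ExteriorAlgebra.ιMulti R _ (f i) := by
  obtain ⟨x, hx, e, f, hf⟩ := hr.exists_adapted h hR q hq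
  have hgen : ∀ i : (Finset.Icc a b).filter Even, GeneratesAt q (wedgeDet d 0 x i) := fun i =>
    hr.generatesAt_of_ne h q hq hx hf (fun hi => by
      have := (Finset.mem_filter.1 i.2).2
      rw [hi] at this
      exact absurd this (by decide)) 0
  choose θ hθ using fun i => (hgen i).exists_dual_notMem
  exact ⟨x, hx, θ, q.primeCompl.prod_mem fun i _ => hθ i, e, f, hf⟩

/-- At each minimal prime an adapted family has a coefficient that does not vanish there. -/
theorem RankData.evenCoeff_cancel (hr : RankData R X a b r l) (h : CodimOneExact d a b)
    (hR : SerreTwo R) {v v' : R} (hv : ∀ x, Admissible R X a b r x → ∀ θ,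
      evenCoeff d a b x θ * v = evenCoeff d a b x θ * v') : v = v' := by
  rw [← sub_eq_zero]
  refine hR.eq_zero _ fun p hp => ?_
  have hpp : p.IsPrime := hp.1.1
  obtain ⟨x, hx, θ, hθ, -⟩ :=
    hr.exists_evenCoeff_notMem h hR p (height_le_one_of_mem_minimalPrimes hp)
  exact ⟨_, hθ, by rw [mul_sub, hv x hx θ, sub_self]⟩

/-- The value at `δ` solves a linear system with one equation per pair `(x, θ)`, to which the gluing
principle for S₂ rings applies. -/
theorem RankData.exists_value (hr : RankData R X a b r l) (h : CodimOneExact d a b)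
    (hR : SerreTwo R) {y : ExteriorAlgebra R (LinearMap.ker (d 1 2))}
    (hy : y ∈ extPow R (LinearMap.ker (d 1 2)) l) (δ : DetMod R X a b) :
    ∃ v : R, ∀ x, Admissible R X a b r x → ∀ θ,
      evenCoeff d a b x θ * v = detEv d a b y x θ δ := by
  obtain ⟨v, hv, -⟩ := hR.exists_glue
    (K := {x // Admissible R X a b r x} ×
      (∀ i : (Finset.Icc a b).filter Even, Module.Dual R (detMod R (X i))))
    (fun k => evenCoeff d a b k.1 k.2) (fun k => detEv d a b y k.1 k.2 δ) (fun p hp => by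
      have hpp : p.IsPrime := hp.1.1
      obtain ⟨x, hx, θ, hθ, -⟩ :=
        hr.exists_evenCoeff_notMem h hR p (height_le_one_of_mem_minimalPrimes hp)
      exact ⟨⟨⟨x, hx⟩, θ⟩, hθ⟩) (fun q hqp hq => by
      obtain ⟨x, hx, e, f, hf⟩ := hr.exists_adapted h hR q hq
      have hgen : GeneratesAt q (PiTensorProduct.tprod R (evenWedge d a b x)) :=
        GeneratesAt.tprod fun i => hr.generatesAt_of_ne h q hq hx hf (fun hi => by
          have := (Finset.mem_filter.1 i.2).2
          rw [hi] at this
          exact absurd this (by decide)) 0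
      -- The even parts of an adapted family generate their determinants at `q`, so a multiple of
      -- `δ` is a pure tensor on them, and the explicit formula gives its value.
      obtain ⟨s, hs, ε, hε⟩ := hgen.exists_smul_eq_tmul δ
      refine ⟨s, hs, dualEv (oddWedge d a b y x) ε, fun k => ?_⟩
      rw [← smul_eq_mul s, ← map_smul, hε]
      exact (hr.detEv_tprod_tmul h hR hy hx k.1.2 k.2 ε).symm)
  exact ⟨v, fun x hx θ => hv ⟨⟨x, hx⟩, θ⟩⟩

/-- Linearity is forced: both sides of each identity solve the same cancellable system. -/
theorem RankData.exists_functional (hr : RankData R X a b r l) (h : CodimOneExact d a b)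
    (hR : SerreTwo R) {y : ExteriorAlgebra R (LinearMap.ker (d 1 2))}
    (hy : y ∈ extPow R (LinearMap.ker (d 1 2)) l) :
    ∃ φ : Module.Dual R (DetMod R X a b), ∀ x, Admissible R X a b r x → ∀ θ δ,
      evenCoeff d a b x θ * φ δ = detEv d a b y x θ δ := by
  choose φ hφ using hr.exists_value h hR hy
  refine ⟨{ toFun := φ, map_add' := fun δ δ' => ?_, map_smul' := fun c δ => ?_ },
    fun x hx θ δ => hφ δ x hx θ⟩
  · refine hr.evenCoeff_cancel h hR fun x hx θ => ?_
    rw [hφ _ x hx θ, mul_add, hφ _ x hx θ, hφ _ x hx θ, map_add]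
  · refine hr.evenCoeff_cancel h hR fun x hx θ => ?_
    rw [hφ _ x hx θ, RingHom.id_apply, smul_eq_mul, mul_left_comm, hφ _ x hx θ, map_smul, smul_eq_mul]

variable (d r π) in
/-- The defining relation of the canonical map, with denominators cleared. -/
def IsCanonical (a b : ℤ) (l : PrimeSpectrum R → ℕ)
    (Ψ : extPow R H l →ₗ[R] Module.Dual R (DetMod R X a b)) : Prop :=
  ∀ y (hy : y ∈ extPow R (LinearMap.ker (d 1 2)) l) x, Admissible R X a b r x → ∀ θ δ,
    evenCoeff d a b x θ * Ψ ⟨ExteriorAlgebra.map π y, extPow_map π hy⟩ δ = detEv d a b y x θ δ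

theorem RankData.detEv_add (hr : RankData R X a b r l) (h : CodimOneExact d a b)
    (hR : SerreTwo R) (hπ : Function.Surjective π)
    (hker : ∀ z, π z = 0 → ∃ w, d 0 1 w = (z : X 1)) {x : ∀ i, ExteriorAlgebra R (X i)}
    (hx : Admissible R X a b r x) {y y' y'' : ExteriorAlgebra R (LinearMap.ker (d 1 2))}
    (hy : ExteriorAlgebra.map π y = ExteriorAlgebra.map π y' + ExteriorAlgebra.map π y'')
    (θ : ∀ i : (Finset.Icc a b).filter Even, Module.Dual R (detMod R (X i))) :
    detEv d a b y x θ = detEv d a b y' x θ + detEv d a b y'' x θ := by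
  have hO : (1 : ℤ) ∈ (Finset.Icc a b).filter Odd := by simp [h.a_le, h.le_b]
  rw [detEv, detEv, detEv, dualEv_add (u' := oddWedge d a b y' x)
    (u'' := oddWedge d a b y'' x) ⟨1, hO⟩ (hr.wedgeDet_add h hR hπ hker hx hy)
    (fun j hj => wedgeDet_of_ne _ _ _ fun hj' => hj (Subtype.ext hj'))
    (fun j hj => wedgeDet_of_ne _ _ _ fun hj' => hj (Subtype.ext hj')), TensorProduct.map_add_right,
    LinearMap.comp_add]

theorem RankData.detEv_smul (hr : RankData R X a b r l) (h : CodimOneExact d a b)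
    (hR : SerreTwo R) (hπ : Function.Surjective π)
    (hker : ∀ z, π z = 0 → ∃ w, d 0 1 w = (z : X 1)) {x : ∀ i, ExteriorAlgebra R (X i)}
    (hx : Admissible R X a b r x) {y y' : ExteriorAlgebra R (LinearMap.ker (d 1 2))} (c : R)
    (hy : ExteriorAlgebra.map π y = c • ExteriorAlgebra.map π y')
    (θ : ∀ i : (Finset.Icc a b).filter Even, Module.Dual R (detMod R (X i))) :
    detEv d a b y x θ = c • detEv d a b y' x θ := by
  have hO : (1 : ℤ) ∈ (Finset.Icc a b).filter Odd := by simp [h.a_le, h.le_b]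
  rw [detEv, detEv, dualEv_smul (u' := oddWedge d a b y' x) ⟨1, hO⟩ c
    (hr.wedgeDet_smul h hR hπ hker hx c hy)
    (fun j hj => wedgeDet_of_ne _ _ _ fun hj' => hj (Subtype.ext hj')), TensorProduct.map_smul_right,
    LinearMap.comp_smul]

theorem RankData.exists_isCanonical (hr : RankData R X a b r l) (h : CodimOneExact d a b)
    (hR : SerreTwo R) (hπ : Function.Surjective π)
    (hker : ∀ z, π z = 0 → ∃ w, d 0 1 w = (z : X 1)) :
    ∃ Ψ : extPow R H l →ₗ[R] Module.Dual R (DetMod R X a b), IsCanonical d r π a b l Ψ := by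
  choose Y hY hYη using fun η : extPow R H l => extPow_surjective π hπ hr.loc_l η.2
  choose φ hφ using fun η => hr.exists_functional h hR (hY η)
  refine ⟨{ toFun := φ, map_add' := fun η η' => ?_, map_smul' := fun c η => ?_ },
    fun y hy x hx θ δ => ?_⟩
  · refine LinearMap.ext fun δ => hr.evenCoeff_cancel h hR fun x hx θ => ?_
    rw [LinearMap.add_apply, mul_add, hφ _ x hx, hφ _ x hx, hφ _ x hx,
      hr.detEv_add h hR hπ hker hx (y' := Y η) (y'' := Y η') (by simp only [hYη]; rfl),
      LinearMap.add_apply]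
  · refine LinearMap.ext fun δ => hr.evenCoeff_cancel h hR fun x hx θ => ?_
    rw [RingHom.id_apply, LinearMap.smul_apply, smul_eq_mul, mul_left_comm, hφ _ x hx, hφ _ x hx,
      hr.detEv_smul h hR hπ hker hx c (y' := Y η) (by simp only [hYη]; rfl),
      LinearMap.smul_apply, smul_eq_mul]
  · refine (hφ _ x hx θ δ).trans ?_
    -- The scalar `1` serves to replace the chosen lift of the class by the given `y`.
    rw [hr.detEv_smul h hR hπ hker hx 1 (y' := y) (by rw [hYη, one_smul]), one_smul]

end Construction

/-! ### Explicit formula, uniqueness, kernel and cokernel of the canonical map. -/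

section Properties

variable {R : Type u} [CommRing R] 

theorem isPseudoNull_iff {M : Type u} [AddCommGroup M] [Module R M] :
    IsPseudoNull R M ↔ ∀ q : Ideal R, q.IsPrime → q.height ≤ 1 → ∀ m : M, ∃ s ∉ q, s • m = 0 := by
  unfold IsPseudoNull
  simp only [LocalizedModule.subsingleton_iff]
  rfl

theorem isPseudoNull_quotient_range_iff {M N : Type u} [AddCommGroup M] [Module R M] [AddCommGroup N]
    [Module R N] (f : M →ₗ[R] N) : IsPseudoNull R (N ⧸ LinearMap.range f) ↔
      ∀ q : Ideal R, q.IsPrime → q.height ≤ 1 → ∀ n : N, ∃ s ∉ q, ∃ m, f m = s • n := by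
  rw [isPseudoNull_iff]
  simp only [(Submodule.mkQ_surjective (LinearMap.range f)).forall,
    Submodule.mkQ_apply, Submodule.Quotient.mk_eq_zero, ← Submodule.Quotient.mk_smul,
    LinearMap.mem_range]

theorem eq_zero_of_smul_eq_zero {N : Type*} [AddCommGroup N] [Module R N] [Module.Projective R N]
    {c : R} (hc : c ∈ nonZeroDivisors R) {n : N} (h : c • n = 0) : n = 0 := by
  rw [← Module.forall_dual_apply_eq_zero_iff R]
  intro f
  refine (mul_left_mem_nonZeroDivisors_eq_zero_iff hc).1 ?_
  rw [← smul_eq_mul, ← map_smul, h, map_zero]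

variable {X : ℤ → Type u} [∀ i, AddCommGroup (X i)]
  [∀ i, Module R (X i)] [IsNoetherianRing R] [∀ i, Module.Finite R (X i)] [∀ i, Module.Projective R (X i)]
  {d : ∀ i j, X i →ₗ[R] X j} {a b : ℤ} {r : ℤ → PrimeSpectrum R → ℕ} {l : PrimeSpectrum R → ℕ}
  {H : Type u} [AddCommGroup H] [Module R H] {π : LinearMap.ker (d 1 2) →ₗ[R] H}

omit [IsNoetherianRing R] [∀ i, Module.Finite R (X i)] in
/-- The torsion of `H¹` is pseudo-null if and only if `H¹` is torsion free in codimension one. -/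
theorem isPseudoNull_torsion_iff (hdd : ∀ w, d 1 2 (d 0 1 w) = 0) (hπ : Function.Surjective π)
    (hker : ∀ z, π z = 0 ↔ ∃ w, d 0 1 w = (z : X 1)) :
    IsPseudoNull R (Submodule.torsion R H) ↔
      ∀ q : Ideal R, q.IsPrime → q.height ≤ 1 → H1TorsionFreeAt d q := by
  rw [isPseudoNull_iff]
  refine forall_congr' fun q => forall_congr' fun hq => forall_congr' fun hht => ⟨?_, ?_⟩
  · intro h c hc w z hwz
    have hz : z ∈ LinearMap.ker (d 1 2) := eq_zero_of_smul_eq_zero hc <| by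
      rw [← map_smul, ← hwz, hdd]
    have htor : π ⟨z, hz⟩ ∈ Submodule.torsion R H := by
      refine (Submodule.mem_torsion_iff _).2 ⟨⟨c, hc⟩, ?_⟩
      change c • π ⟨z, hz⟩ = 0
      rw [← map_smul]
      exact (hker _).2 ⟨w, hwz⟩
    obtain ⟨s, hs, hsz⟩ := h ⟨_, htor⟩
    have h0 : s • π ⟨z, hz⟩ = 0 := congrArg Subtype.val hsz
    rw [← map_smul] at h0
    obtain ⟨w', hw'⟩ := (hker _).1 h0
    exact ⟨s, hs, w', hw'⟩
  · rintro h ⟨m, hm⟩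
    obtain ⟨z, rfl⟩ := hπ m
    obtain ⟨c, hc⟩ := (Submodule.mem_torsion_iff _).1 hm
    obtain ⟨w, hw⟩ := (hker _).1 ((map_smul π (c : R) z).trans hc)
    obtain ⟨s, hs, w', hw'⟩ := h c c.2 w z hw
    exact ⟨s, hs, Subtype.ext ((map_smul π s z).symm.trans ((hker (s • z)).2 ⟨w', hw'⟩))⟩

variable {Ψ : extPow R H l →ₗ[R] Module.Dual R (DetMod R X a b)}

/-- The explicit description of the canonical map. -/
theorem IsCanonical.apply_tprod_tmul (hΨ : IsCanonical (r := r) d π a b l Ψ)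
    (hr : RankData R X a b r l) (h : CodimOneExact d a b) (hR : SerreTwo R)
    {y : ExteriorAlgebra R (LinearMap.ker (d 1 2))} (hy : y ∈ extPow R (LinearMap.ker (d 1 2)) l)
    {x : ∀ i, ExteriorAlgebra R (X i)} (hx : Admissible R X a b r x)
    (ε : ⨂[R] i : (Finset.Icc a b).filter Odd, Module.Dual R (detMod R (X i))) :
    Ψ ⟨ExteriorAlgebra.map π y, extPow_map π hy⟩
      (PiTensorProduct.tprod R (evenWedge d a b x) ⊗ₜ ε) = dualEv (oddWedge d a b y x) ε :=
  hr.evenCoeff_cancel h hR fun x' hx' θ => by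
    rw [hΨ y hy x' hx', hr.detEv_tprod_tmul h hR hy hx hx']

omit [IsNoetherianRing R] [∀ i, Module.Finite R (X i)] [∀ i, Module.Projective R (X i)] in
theorem ne_one_of_even (i : (Finset.Icc a b).filter Even) : (i : ℤ) ≠ 1 := fun hi => by
  have := (Finset.mem_filter.1 i.2).2
  rw [hi] at this
  exact absurd this (by decide)

set_option maxHeartbeats 1000000 in
-- The target consists of functionals with values in `R`, so S₁ allows comparison at minimal primes.
-- There each `δ` is, up to a factor, of the form to which the explicit formula applies.
theorem IsCanonical.unique (hΨ : IsCanonical (r := r) d π a b l Ψ)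
    (hr : RankData R X a b r l) (h : CodimOneExact d a b) (hR : SerreTwo R)
    (hπ : Function.Surjective π) {Ψ' : extPow R H l →ₗ[R] Module.Dual R (DetMod R X a b)}
    (hΨ' : ∀ y (hy : y ∈ extPow R (LinearMap.ker (d 1 2)) l) x, Admissible R X a b r x →
      ∀ ψ : ∀ i : (Finset.Icc a b).filter Odd, Module.Dual R (detMod R (X i)),
      Ψ' ⟨ExteriorAlgebra.map π y, extPow_map π hy⟩ (PiTensorProduct.tprod R (evenWedge d a b x) ⊗ₜ
        PiTensorProduct.tprod R ψ) = ∏ j, ψ j (oddWedge d a b y x j)) : Ψ' = Ψ := by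
  refine LinearMap.ext fun ⟨η, hη⟩ => LinearMap.ext fun δ => ?_
  obtain ⟨y, hy, rfl⟩ := extPow_surjective π hπ hr.loc_l hη
  rw [← sub_eq_zero]
  refine hR.eq_zero _ fun p hp => ?_
  have hpp : p.IsPrime := hp.1.1
  have hht := height_le_one_of_mem_minimalPrimes hp
  obtain ⟨x, hx, e, f, hf⟩ := hr.exists_adapted h hR p hht
  have hgen : GeneratesAt p (PiTensorProduct.tprod R (evenWedge d a b x)) :=
    GeneratesAt.tprod fun i => hr.generatesAt_of_ne h p hht hx hf (ne_one_of_even i) 0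
  obtain ⟨s, hs, ε, hε⟩ := hgen.exists_smul_eq_tmul δ
  refine ⟨s, hs, ?_⟩
  have key := apply_tmul_eq_dualEv (hΨ' y hy x hx) ε
  rw [mul_sub, ← smul_eq_mul, ← smul_eq_mul, ← map_smul, ← map_smul, hε,
    hΨ.apply_tprod_tmul hr h hR hy hx, key, sub_self]

variable (d r π) in
/-- The explicit description of the canonical map in terms of elements of the determinants. -/
def HasExplicitFormula (a b : ℤ) (l : PrimeSpectrum R → ℕ)
    (Ψ : extPow R H l →ₗ[R] Module.Dual R (DetMod R X a b)) : Prop :=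
  ∀ x, Admissible R X a b r x → ∀ y ∈ extPow R (LinearMap.ker (d 1 2)) l,
    ∀ (η : extPow R H l) (u : ∀ i, detMod R (X i)) (θ : ∀ i, Module.Dual R (detMod R (X i))),
    ExteriorAlgebra.map π y = η →
    (∀ i, i ≠ 1 → (u i : ExteriorAlgebra R (X i)) =
      ExteriorAlgebra.map (d (i - 1) i) (x (i - 1)) * x i) →
    (u 1 : ExteriorAlgebra R (X 1)) = ExteriorAlgebra.map (d 0 1) (x 0) *
      ExteriorAlgebra.map (LinearMap.ker (d 1 2)).subtype y * x 1 →
    Ψ η ((PiTensorProduct.tprod R fun i : (Finset.Icc a b).filter Even => u i) ⊗ₜ[R]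
        (PiTensorProduct.tprod R fun i : (Finset.Icc a b).filter Odd => θ i)) =
      ∏ i : (Finset.Icc a b).filter Odd, θ i (u i)

theorem IsCanonical.hasExplicitFormula (hΨ : IsCanonical (r := r) d π a b l Ψ)
    (hr : RankData R X a b r l) (h : CodimOneExact d a b) (hR : SerreTwo R) :
    HasExplicitFormula d r π a b l Ψ := by
  intro x hx y hy η u θ hη hu hu1
  have huw : u = wedgeDet d y x := by
    funext i
    refine Subtype.ext ?_
    rw [hr.coe_wedgeDet hy hx, wedge]
    by_cases hi : i = 1
    · subst hi
      rw [hu1, insOne_one]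
      rfl
    · rw [hu i hi, insOne_of_ne _ _ hi, mul_one]
  have hE : (fun i : (Finset.Icc a b).filter Even => wedgeDet d y x i) = evenWedge d a b x :=
    funext fun i => wedgeDet_even _ x i
  have hη' : η = ⟨ExteriorAlgebra.map π y, extPow_map π hy⟩ := Subtype.ext hη.symm
  rw [huw, hE, hη', hΨ.apply_tprod_tmul hr h hR hy hx, dualEv_tprod]

theorem IsCanonical.eq_of_hasExplicitFormula (hΨ : IsCanonical (r := r) d π a b l Ψ)
    (hr : RankData R X a b r l) (h : CodimOneExact d a b) (hR : SerreTwo R)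
    (hπ : Function.Surjective π) {Ψ' : extPow R H l →ₗ[R] Module.Dual R (DetMod R X a b)}
    (hΨ' : HasExplicitFormula d r π a b l Ψ') : Ψ' = Ψ := by
  refine hΨ.unique hr h hR hπ fun y hy x hx ψ => ?_
  obtain ⟨θ, hθ⟩ : ∃ θ : ∀ i, Module.Dual R (detMod R (X i)),
      ∀ i : (Finset.Icc a b).filter Odd, θ i = ψ i :=
    ⟨fun i => if hi : i ∈ (Finset.Icc a b).filter Odd then ψ ⟨i, hi⟩ else 0, fun i => dif_pos i.2⟩
  obtain rfl : (fun i : (Finset.Icc a b).filter Odd => θ i) = ψ := funext hθ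
  have hE : evenWedge d a b x = fun i : (Finset.Icc a b).filter Even => wedgeDet d y x i :=
    funext fun i => (wedgeDet_even _ x i).symm
  rw [hE]
  refine hΨ' x hx y hy _ (wedgeDet d y x) θ rfl (fun i hi => ?_) ?_
  · rw [hr.coe_wedgeDet hy hx, wedge, insOne_of_ne _ _ hi, mul_one]
  · rw [hr.coe_wedgeDet hy hx, wedge, insOne_one]
    rfl

omit [IsNoetherianRing R] [∀ i, Module.Finite R (X i)] [∀ i, Module.Projective R (X i)] in
theorem H1SpansAt.spansAt {q : Ideal R} {n : ℕ} {z : Fin n → LinearMap.ker (d 1 2)}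
    (hz : H1SpansAt d q z) (hπ : Function.Surjective π)
    (hker : ∀ z, π z = 0 ↔ ∃ w, d 0 1 w = (z : X 1)) : SpansAt q (π ∘ z) := by
  obtain ⟨s, hs, hz⟩ := hz
  refine ⟨s, hs, fun m => ?_⟩
  obtain ⟨x, rfl⟩ := hπ m
  obtain ⟨w, c, hw⟩ := hz x
  refine ⟨c, ?_⟩
  have := (hker (s • x - ∑ j, c j • z j)).2 ⟨w, by
    simp only [Submodule.coe_sub, Submodule.coe_smul, Submodule.coe_sum, hw, add_sub_cancel_right]⟩
  rw [map_sub, sub_eq_zero, map_smul, map_sum] at this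
  rw [this]
  exact Finset.sum_congr rfl fun j _ => map_smul π _ _

/-- Where `H¹` is free, source and determinant are both generated by a single element, and `Ψ` pairs
these generators to a unit at `q`. Kernel and cokernel are controlled by this. -/
theorem IsCanonical.exists_generator (hΨ : IsCanonical (r := r) d π a b l Ψ)
    (hr : RankData R X a b r l) (h : CodimOneExact d a b) (hR : SerreTwo R)
    (hπ : Function.Surjective π) (hker : ∀ z, π z = 0 ↔ ∃ w, d 0 1 w = (z : X 1))
    (q : Ideal R) [hqp : q.IsPrime] (hq : q.height ≤ 1)
    (hgood : q ∈ minimalPrimes R ∨ H1TorsionFreeAt d q) :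
    ∃ (η : extPow R H l) (δ : DetMod R X a b), GeneratesAt q η ∧ GeneratesAt q δ ∧ Ψ η δ ∉ q := by
  obtain ⟨x, hx, e, f, hf⟩ := hr.exists_adapted h hR q hq
  obtain ⟨y, hy, hgen1, t, ht, z, hz, hyz⟩ := hr.exists_generatesAt_one h hR q hq hgood hx hf
  have hgen : ∀ i, GeneratesAt q (wedgeDet d y x i) := fun i => by
    by_cases hi : i = 1
    · subst hi
      exact hgen1
    · exact hr.generatesAt_of_ne h q hq hx hf hi y
  choose θ hθ using fun i => (hgen i).exists_dual_notMem
  have hfin : ∀ i, Module.Finite R (detMod R (X i)) := fun i =>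
    extPow_finite (isLocallyConstant_rank R X i)
  refine ⟨⟨_, extPow_map π hy⟩, PiTensorProduct.tprod R (evenWedge d a b x) ⊗ₜ
    PiTensorProduct.tprod R (fun j : (Finset.Icc a b).filter Odd => θ j), ?_, ?_, ?_⟩
  · refine generatesAt_extPow rfl (hz.spansAt hπ hker) ht ?_
    change ExteriorAlgebra.map π y = _
    rw [hyz, map_smul, ExteriorAlgebra.map_apply_ιMulti]
  · exact GeneratesAt.tmul (GeneratesAt.tprod fun i =>
      hr.generatesAt_of_ne h q hq hx hf (ne_one_of_even i) 0)
      (GeneratesAt.tprod fun j => (hgen j).dual (hθ j))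
  · rw [hΨ.apply_tprod_tmul hr h hR hy hx, dualEv_tprod]
    exact q.primeCompl.prod_mem fun j _ => hθ j

theorem IsCanonical.ker_eq_torsion (hΨ : IsCanonical (r := r) d π a b l Ψ)
    (hr : RankData R X a b r l) (h : CodimOneExact d a b) (hR : SerreTwo R)
    (hπ : Function.Surjective π) (hker : ∀ z, π z = 0 ↔ ∃ w, d 0 1 w = (z : X 1)) :
    LinearMap.ker Ψ = Submodule.torsion R (extPow R H l) := by
  refine le_antisymm (fun η hη => ?_) fun η hη => ?_
  · have hη0 : Ψ η = 0 := hη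
    obtain ⟨c, hc, hc'⟩ := hR.exists_mem_nonZeroDivisors
      (LinearMap.ker (LinearMap.toSpanSingleton R _ η)) fun p hp => by
        have hpp : p.IsPrime := hp.1.1
        obtain ⟨η₀, δ, hη₀, -, hne⟩ := hΨ.exists_generator hr h hR hπ hker p
          (height_le_one_of_mem_minimalPrimes hp) (Or.inl hp)
        obtain ⟨s, hs, c, hc⟩ := hη₀ η
        have h0 : Ψ η₀ δ * c = 0 := by
          have := congrArg (fun v => Ψ v δ) hc
          simp only [map_smul, hη0, smul_zero, LinearMap.zero_apply, LinearMap.smul_apply,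
            smul_eq_mul] at this
          rw [mul_comm, ← this]
        -- If `s η = c η₀` and `Ψ η = 0`, then `Ψ η₀ δ · c = 0`, so this multiplier outside `p`
        -- kills `η`.
        refine ⟨Ψ η₀ δ * s, ?_, p.primeCompl.mul_mem hne hs⟩
        rw [LinearMap.mem_ker, LinearMap.toSpanSingleton_apply, mul_smul, hc, smul_smul, h0, zero_smul]
    exact (Submodule.mem_torsion_iff _).2 ⟨⟨c, hc'⟩, by simpa using hc⟩
  · obtain ⟨c, hc⟩ := (Submodule.mem_torsion_iff _).1 hη
    refine LinearMap.mem_ker.2 (LinearMap.ext fun δ => ?_)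
    refine (mul_left_mem_nonZeroDivisors_eq_zero_iff c.2).1 ?_
    rw [← smul_eq_mul, ← LinearMap.smul_apply, ← map_smul]
    have : (c : R) • η = 0 := hc
    rw [this, map_zero, LinearMap.zero_apply]

omit [IsNoetherianRing R] in
theorem finite_detMod (a b : ℤ) : Module.Finite R (DetMod R X a b) := by
  have hfin : ∀ i, Module.Finite R (detMod R (X i)) := fun i =>
    extPow_finite (isLocallyConstant_rank R X i)
  have hproj : ∀ i, Module.Projective R (detMod R (X i)) := fun i =>
    extPow_projective (isLocallyConstant_rank R X i)
  infer_instance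

omit [IsNoetherianRing R] in
theorem projective_detMod (a b : ℤ) : Module.Projective R (DetMod R X a b) := by
  have hfin : ∀ i, Module.Finite R (detMod R (X i)) := fun i =>
    extPow_finite (isLocallyConstant_rank R X i)
  have hproj : ∀ i, Module.Projective R (detMod R (X i)) := fun i =>
    extPow_projective (isLocallyConstant_rank R X i)
  have h1 := piTensorProduct_projective (R := R)
    fun i : (Finset.Icc a b).filter Even => detMod R (X i)
  have h2 := piTensorProduct_projective (R := R)
    fun i : (Finset.Icc a b).filter Odd => Module.Dual R (detMod R (X i))
  infer_instance

omit [IsNoetherianRing R] in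
theorem isReflexive_dual_detMod (a b : ℤ) :
    Module.IsReflexive R (Module.Dual R (DetMod R X a b)) := by
  have := finite_detMod (R := R) (X := X) a b
  have := projective_detMod (R := R) (X := X) a b
  infer_instance

/-- A functional is determined at `q` by its value on the local generator `δ₀`, and `Ψ η` has a unit
value there. -/
theorem IsCanonical.exists_smul_mem_range (hΨ : IsCanonical (r := r) d π a b l Ψ)
    (hr : RankData R X a b r l) (h : CodimOneExact d a b) (hR : SerreTwo R)
    (hπ : Function.Surjective π) (hker : ∀ z, π z = 0 ↔ ∃ w, d 0 1 w = (z : X 1))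
    (q : Ideal R) [hqp : q.IsPrime] (hq : q.height ≤ 1) (hgood : H1TorsionFreeAt d q)
    (φ : Module.Dual R (DetMod R X a b)) : ∃ s ∉ q, ∃ η, Ψ η = s • φ := by
  have := finite_detMod (R := R) (X := X) a b
  obtain ⟨η, δ₀, -, hδ, hne⟩ := hΨ.exists_generator hr h hR hπ hker q hq (Or.inr hgood)
  obtain ⟨s, hs, hδ⟩ := hδ.uniform
  refine ⟨s * Ψ η δ₀, q.primeCompl.mul_mem hs hne, (s * φ δ₀) • η, LinearMap.ext fun δ => ?_⟩
  obtain ⟨c, hc⟩ := hδ δ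
  have h1 := congrArg φ hc
  have h2 := congrArg (Ψ η) hc
  simp only [map_smul, smul_eq_mul] at h1 h2
  simp only [map_smul, LinearMap.smul_apply, smul_eq_mul]
  linear_combination φ δ₀ * h2 - Ψ η δ₀ * h1

omit [IsNoetherianRing R] [∀ i, Module.Finite R (X i)] [∀ i, Module.Projective R (X i)] in
/-- If a functional does not vanish at `q` on an element of `⋀^n M`, it does not vanish at `q` on some
pure wedge. -/
theorem exists_ιMulti_notMem {M : Type*} [AddCommGroup M] [Module R M] {q : Ideal R} {n : ℕ}
    {y : ExteriorAlgebra R M} (hy : y ∈ ⋀[R]^n M) (L : ExteriorAlgebra R M →ₗ[R] R) (hL : L y ∉ q) :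
    ∃ z : Fin n → M, L (ExteriorAlgebra.ιMulti R n z) ∉ q := by
  by_contra! hcon
  rw [← ExteriorAlgebra.ιMulti_span_fixedDegree] at hy
  have hle : Submodule.span R (Set.range (ExteriorAlgebra.ιMulti R n)) ≤
      Submodule.comap L (q : Submodule R R) := by
    rw [Submodule.span_le]
    rintro _ ⟨z, rfl⟩
    exact hcon z
  exact hL (hle hy)

omit [IsNoetherianRing R] [∀ i, Module.Finite R (X i)] [∀ i, Module.Projective R (X i)] in
/-- If an alternating form does not vanish at `q` on `d f₁, …, z₁, …, f₁', …`, then `H¹` is torsion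
free at `q`. -/
theorem h1TorsionFreeAt_of_notMem {q : Ideal R} [q.IsPrime] {k m n : ℕ} {f : Fin k → X 0}
    (hf : ImageSpansAt d q 0 f) {z : Fin m → X 1} {f' : Fin n → X 1}
    {N : ℕ} {g : Fin N → X 1} (hg : SpansAt q g) (hN : N = k + m + n)
    (A : X 1 [⋀^Fin (k + m + n)]→ₗ[R] R) (hA : A (Fin.append (Fin.append (d 0 1 ∘ f) z) f') ∉ q) :
    H1TorsionFreeAt d q := by
  subst hN
  set e := Fin.append (Fin.append (d 0 1 ∘ f) z) f' with he
  obtain ⟨t, ht, hspan⟩ := hg.of_notMem A hA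
  obtain ⟨s, hs, hf⟩ := hf
  intro c hc w v hwv
  obtain ⟨coef, hcoef⟩ := hspan v
  -- Cramer coordinates: replacing the `j`-th vector of `e` by the argument gives functionals dual
  -- to `e` up to the factor `A e`.
  let κ : Fin (k + m + n) → X 1 →ₗ[R] R := fun j => A.toMultilinearMap.toLinearMap e j
  have hκ : ∀ i j, κ j (e i) = if i = j then A e else 0 := by
    intro i j
    change A (Function.update e j (e i)) = _
    split_ifs with hij
    · rw [hij, Function.update_eq_self]
    · exact A.map_update_self e (Ne.symm hij)
  have hcoef' : ∀ j, t * κ j v = coef j * A e := by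
    intro j
    have := congrArg (κ j) hcoef
    rw [map_smul, map_sum] at this
    simpa [hκ] using this
  obtain ⟨c', hc'⟩ := hf w
  -- A multiple of `c • v = d w` lies in the span of the first block of `e`. So its other
  -- coordinates vanish, and the non-zero-divisor `c` can be cancelled.
  have hzero : ∀ j, (∀ i : Fin k, Fin.castAdd n (Fin.castAdd m i) ≠ j) →
      s * A e * coef j = 0 := by
    intro j hj
    have h1 : κ j (s • d 0 1 w) = 0 := by
      have := congrArg (κ j) hc'
      refine this.trans ?_
      rw [map_sum]
      refine Finset.sum_eq_zero fun i _ => ?_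
      have hei : d 0 1 (f i) = e (Fin.castAdd n (Fin.castAdd m i)) := by simp [he]
      rw [map_smul]
      erw [hei, hκ, if_neg (hj i)]
      exact smul_zero _
    rw [hwv, map_smul, map_smul, smul_eq_mul, smul_eq_mul] at h1
    have h2 : s * κ j v = 0 := (mul_left_mem_nonZeroDivisors_eq_zero_iff hc).1
      (by linear_combination h1)
    linear_combination -s * hcoef' j + t * h2
  refine ⟨s * A e * t, q.primeCompl.mul_mem (q.primeCompl.mul_mem hs hA) ht,
    ∑ i : Fin k, (s * A e * coef (Fin.castAdd n (Fin.castAdd m i))) • f i, ?_⟩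
  have h1 : (s * A e * t) • v = ∑ j, (s * A e * coef j) • e j := by
    rw [mul_smul, hcoef, Finset.smul_sum]
    simp only [smul_smul]
  rw [h1, Fin.sum_univ_add, Fin.sum_univ_add, map_sum,
    Finset.sum_eq_zero (s := (Finset.univ : Finset (Fin n))) fun j _ => by
      rw [hzero _ fun i hi => by
        have := congrArg Fin.val hi
        simp at this
        omega, zero_smul],
    Finset.sum_eq_zero (s := (Finset.univ : Finset (Fin m))) fun j _ => by
      rw [hzero _ fun i hi => by
        have := congrArg Fin.val hi
        simp at this
        omega, zero_smul], add_zero, add_zero]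
  exact Finset.sum_congr rfl fun i _ => by simp [he]

/-- Surjectivity at `q` forces some `d x₀ ∧ y ∧ x₁` to have a unit value under a functional on `det
(X 1)`. Replacing `y` by a pure wedge exhibits a local basis of `X 1` extending vectors that span
the image of `X 0`. -/
theorem IsCanonical.h1TorsionFreeAt (hΨ : IsCanonical (r := r) d π a b l Ψ)
    (hr : RankData R X a b r l) (h : CodimOneExact d a b) (hR : SerreTwo R)
    (hπ : Function.Surjective π) (q : Ideal R) [hqp : q.IsPrime] (hq : q.height ≤ 1)
    (hcok : ∀ φ : Module.Dual R (DetMod R X a b), ∃ s ∉ q, ∃ η, Ψ η = s • φ) :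
    H1TorsionFreeAt d q := by
  choose θ w hθw using fun i => exists_dual_notMem (R := R) (F := X i) q
  -- A test functional and a test element whose pairing is a product of the values `θ i (w i)`,
  -- hence outside `q`.
  let φ : Module.Dual R (DetMod R X a b) := LinearMap.mul' R R ∘ₗ TensorProduct.map
    (prodEv fun i : (Finset.Icc a b).filter Even => θ i)
    (dualEv fun i : (Finset.Icc a b).filter Odd => w i)
  let δ : DetMod R X a b := PiTensorProduct.tprod R (fun i : (Finset.Icc a b).filter Even => w i) ⊗ₜ
    PiTensorProduct.tprod R (fun i : (Finset.Icc a b).filter Odd => θ i)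
  have hφδ : φ δ ∉ q := by
    have : φ δ = (∏ i : (Finset.Icc a b).filter Even, θ i (w i)) *
        ∏ i : (Finset.Icc a b).filter Odd, θ i (w i) := by
      simp only [φ, δ, LinearMap.comp_apply, TensorProduct.map_tmul, LinearMap.mul'_apply,
        prodEv_tprod, dualEv_tprod]
    rw [this]
    exact q.primeCompl.mul_mem (q.primeCompl.prod_mem fun i _ => hθw i)
      (q.primeCompl.prod_mem fun i _ => hθw i)
  obtain ⟨s, hs, ⟨η, hη⟩, hη'⟩ := hcok φ
  obtain ⟨y, hy, rfl⟩ := extPow_surjective π hπ hr.loc_l hη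
  obtain ⟨x, hx, θ', hθ', e, f, hf⟩ := hr.exists_evenCoeff_notMem h hR q hq
  have h1 := hΨ y hy x hx θ' δ
  rw [hη', detEv_tmul, dualEv_tprod] at h1
  have h2 : prodEv θ' (PiTensorProduct.tprod R (fun i : (Finset.Icc a b).filter Even => w i)) *
      ∏ i : (Finset.Icc a b).filter Odd, θ i (oddWedge d a b y x i) ∉ q := by
    rw [← h1]
    exact q.primeCompl.mul_mem hθ' (q.primeCompl.mul_mem hs hφδ)
  have hO : (1 : ℤ) ∈ (Finset.Icc a b).filter Odd := by simp [h.a_le, h.le_b]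
  -- The defining relation makes the product over odd degrees nonzero modulo `q`, in particular its
  -- factor in degree `1`.
  have h3 : θ 1 (wedgeDet d y x 1) ∉ q := fun h4 => h2 <| q.mul_mem_left _ <|
    Ideal.mem_of_dvd _ (Finset.dvd_prod_of_mem
      (fun i : (Finset.Icc a b).filter Odd => θ i (oddWedge d a b y x i))
      (Finset.mem_univ ⟨1, hO⟩)) h4
  let Θ : ExteriorAlgebra R (X 1) →ₗ[R] R := θ 1 ∘ₗ extRetract (isLocallyConstant_rank R X 1) (X 1)
  let L : ExteriorAlgebra R (LinearMap.ker (d 1 2)) →ₗ[R] R :=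
    Θ ∘ₗ LinearMap.mulRight R (x 1) ∘ₗ LinearMap.mulLeft R (ExteriorAlgebra.map (d 0 1) (x 0)) ∘ₗ
      (ExteriorAlgebra.map (LinearMap.ker (d 1 2)).subtype).toLinearMap
  have hLy : L y = θ 1 (wedgeDet d y x 1) := by
    rw [wedgeDet, wedge, insOne_one]
    rfl
  obtain ⟨t, ht, hty⟩ := hy ⟨q, hqp⟩
  obtain ⟨z, hz⟩ := exists_ιMulti_notMem (q := q) hty L (by
    rw [map_smul, hLy]
    exact q.primeCompl.mul_mem ht h3)
  obtain ⟨g, -, -, hg, -⟩ := exists_coordinates (F := X 1) q rfl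
  refine h1TorsionFreeAt_of_notMem (hf 0).2.1 (z := (LinearMap.ker (d 1 2)).subtype ∘ z) (f' := f 1)
    hg (hr.add_one ⟨q, hqp⟩).symm (Θ.compAlternatingMap (ExteriorAlgebra.ιMulti R _)) fun h5 => hz ?_
  have h6 : L (ExteriorAlgebra.ιMulti R _ z) = (e 0 * e 1) *
      Θ (ExteriorAlgebra.ιMulti R _ (Fin.append (Fin.append (d 0 1 ∘ f 0)
        ((LinearMap.ker (d 1 2)).subtype ∘ z)) (f 1))) := by
    simp only [L, LinearMap.comp_apply, LinearMap.mulRight_apply, LinearMap.mulLeft_apply,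
      AlgHom.toLinearMap_apply, ExteriorAlgebra.map_apply_ιMulti, (hf 0).2.2, (hf 1).2.2, map_smul,
      smul_mul_assoc, mul_smul_comm, ExteriorAlgebra.ιMulti_mul_ιMulti, smul_eq_mul]
    ring
  rw [h6]
  exact q.mul_mem_left _ h5

end Properties

/-! ### Cocycles and cohomology in elements. -/

section Cohomology

open CategoryTheory

variable {R : Type u} [CommRing R] (K : CochainComplex (ModuleCat.{u} R) ℤ)

theorem d_d_apply (i j k : ℤ) (x : K.X i) : (K.d j k).hom ((K.d i j).hom x) = 0 :=
  congrArg (fun f => f.hom x) (K.d_comp_d i j k)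

theorem iCycles_injective (i : ℤ) : Function.Injective (K.iCycles i).hom :=
  (ModuleCat.mono_iff_injective _).1 inferInstance

theorem homologyπ_surjective (i : ℤ) : Function.Surjective (K.homologyπ i).hom :=
  (ModuleCat.epi_iff_surjective _).1 inferInstance

theorem d_iCycles_apply (i j : ℤ) (z : K.cycles i) : (K.d i j).hom ((K.iCycles i).hom z) = 0 :=
  congrArg (fun f => f.hom z) (K.iCycles_d i j)

theorem exists_iCycles_eq {i : ℤ} {x : K.X i} (hx : (K.d i (i + 1)).hom x = 0) :
    ∃ z, (K.iCycles i).hom z = x := by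
  -- An element is a morphism from `R`, which lifts to the cycles by their universal property.
  let k : ModuleCat.of R R ⟶ K.X i := ModuleCat.ofHom (LinearMap.toSpanSingleton R _ x)
  have hk : k ≫ K.d i (i + 1) = 0 := by
    ext
    simpa [k] using hx
  refine ⟨(K.liftCycles k (i + 1) (by simp) hk).hom 1, ?_⟩
  have := congrArg (fun f => f.hom (1 : R)) (K.liftCycles_i k (i + 1) (by simp) hk)
  exact this.trans (one_smul R x)

theorem homologyπ_eq_zero_iff (i : ℤ) (z : K.cycles i) :
    (K.homologyπ i).hom z = 0 ↔ ∃ w, (K.d (i - 1) i).hom w = (K.iCycles i).hom z := by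
  have hi : ∀ w, (K.iCycles i).hom ((K.toCycles (i - 1) i).hom w) = (K.d (i - 1) i).hom w :=
    fun w => congrArg (fun f => f.hom w) (K.toCycles_i (i - 1) i)
  constructor
  · intro h
    let T : ShortComplex (ModuleCat.{u} R) :=
      ⟨K.toCycles (i - 1) i, K.homologyπ i, K.toCycles_comp_homologyπ (i - 1) i⟩
    have hT : T.Exact := T.exact_of_g_is_cokernel (K.homologyIsCokernel (i - 1) i (by simp))
    obtain ⟨w, hw⟩ := (ShortComplex.moduleCat_exact_iff T).1 hT z h
    exact ⟨w, by rw [← hi]; exact congrArg _ hw⟩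
  · rintro ⟨w, hw⟩
    rw [← hi] at hw
    rw [← iCycles_injective K i hw]
    exact congrArg (fun f => f.hom w) (K.toCycles_comp_homologyπ (i - 1) i)

/-- The cocycles in degree `1` form the kernel of the differential. -/
noncomputable def cyclesEquivKer : K.cycles 1 ≃ₗ[R] LinearMap.ker (K.d 1 2).hom :=
  LinearEquiv.ofBijective ((K.iCycles 1).hom.codRestrict _ (d_iCycles_apply K 1 2))
    ⟨fun z z' h => iCycles_injective K 1 (congrArg Subtype.val h), fun ⟨x, hx⟩ => by
      obtain ⟨z, hz⟩ := exists_iCycles_eq K (i := 1) hx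
      exact ⟨z, Subtype.ext hz⟩⟩

theorem subtype_comp_cyclesEquivKer :
    (LinearMap.ker (K.d 1 2).hom).subtype ∘ₗ (cyclesEquivKer K).toLinearMap = (K.iCycles 1).hom := rfl

variable {K} {C : CochainComplex (ModuleCat.{u} R) ℤ} (φ : K ⟶ C)

/-- The projection from the cocycles of `K` to the cohomology of `C` in degree `1`. -/
noncomputable def kerToH1 : LinearMap.ker (K.d 1 2).hom →ₗ[R] C.homology 1 :=
  (K.homologyπ 1 ≫ HomologicalComplex.homologyMap φ 1).hom ∘ₗ (cyclesEquivKer K).symm.toLinearMap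

theorem kerToH1_comp_cyclesEquivKer : kerToH1 φ ∘ₗ (cyclesEquivKer K).toLinearMap =
    (K.homologyπ 1 ≫ HomologicalComplex.homologyMap φ 1).hom := by
  ext z
  simp [kerToH1]

variable [QuasiIso φ]

theorem homologyMap_bijective (i : ℤ) :
    Function.Bijective (HomologicalComplex.homologyMap φ i).hom :=
  ⟨(ModuleCat.mono_iff_injective _).1 inferInstance, (ModuleCat.epi_iff_surjective _).1 inferInstance⟩

theorem kerToH1_surjective : Function.Surjective (kerToH1 φ) := by
  have : Function.Surjective (K.homologyπ 1 ≫ HomologicalComplex.homologyMap φ 1).hom := by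
    rw [ModuleCat.hom_comp]
    exact (homologyMap_bijective φ 1).2.comp (homologyπ_surjective K 1)
  exact this.comp (cyclesEquivKer K).symm.surjective

theorem kerToH1_eq_zero_iff (z : LinearMap.ker (K.d 1 2).hom) :
    kerToH1 φ z = 0 ↔ ∃ w, (K.d 0 1).hom w = (z : K.X 1) := by
  obtain ⟨z, rfl⟩ := (cyclesEquivKer K).surjective z
  have h1 : kerToH1 φ (cyclesEquivKer K z) =
      (HomologicalComplex.homologyMap φ 1).hom ((K.homologyπ 1).hom z) :=
    congrArg (fun f => f z) (kerToH1_comp_cyclesEquivKer φ)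
  rw [h1, map_eq_zero_iff _ (homologyMap_bijective φ 1).1]
  exact homologyπ_eq_zero_iff K 1 z

end Cohomology

/-! ### Application to a perfect representative. -/

section Perfect

open CategoryTheory

variable {R : Type u} [CommRing R] {C : CochainComplex (ModuleCat.{u} R) ℤ} (S : PerfectRep C)

theorem PerfectRep.codimOneExact (hC : ∀ i : ℤ, i ≠ 1 → IsPseudoNull R (C.homology i)) :
    CodimOneExact (X := fun i => S.P.X i) (fun i j => (S.P.d i j).hom) S.a S.b where
  a_le := S.a_le
  le_b := S.le_b
  dd := d_d_apply S.P
  subsingleton i hi := ModuleCat.subsingleton_of_isZero (S.isZero i hi)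
  exact q hqp hq i hi x hx := by
    have := S.quasiIso
    obtain ⟨z, rfl⟩ := exists_iCycles_eq S.P hx
    obtain ⟨s, hs, hsz⟩ := isPseudoNull_iff.1 (hC i hi) q hqp hq
      ((HomologicalComplex.homologyMap S.φ i).hom ((S.P.homologyπ i).hom z))
    rw [← map_smul, ← map_smul, map_eq_zero_iff _ (homologyMap_bijective S.φ i).1] at hsz
    obtain ⟨w, hw⟩ := (homologyπ_eq_zero_iff S.P i _).1 hsz
    exact ⟨s, hs, w, by rw [hw, map_smul]⟩

variable [IsNoetherianRing R] {r : ℤ → PrimeSpectrum R → ℕ} {l : PrimeSpectrum R → ℕ}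

omit [IsNoetherianRing R] in
theorem PerfectRep.euler_eq (hr : RankData R (fun i => S.P.X i) S.a S.b r l) (𝔭 : PrimeSpectrum R) :
    S.euler 𝔭 = l 𝔭 :=
  alternating_sum_eq S.a_le S.le_b (r := fun i => r i 𝔭)
    (n := fun i => Module.rankAtStalk (R := R) (S.P.X i) 𝔭) (fun i hi => hr.eq_zero i hi 𝔭)
    (fun i hi => hr.add_of_ne i hi 𝔭) (by exact_mod_cast hr.add_one 𝔭)

omit [IsNoetherianRing R] in
-- The rank functions quantified over in `IsPsi` are unique, and categorical cycles correspond to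
-- the kernel of the differential.
theorem PerfectRep.isPsi_iff
    (hr : RankData R (fun i => S.P.X i) S.a S.b r fun 𝔭 => (S.euler 𝔭).toNat)
    (Ψ : S.extH1 →ₗ[R] S.DetInv) : S.IsPsi Ψ ↔
      HasExplicitFormula (X := fun i => S.P.X i) (fun i j => (S.P.d i j).hom) r (kerToH1 S.φ) S.a S.b
        (fun 𝔭 => (S.euler 𝔭).toNat) Ψ := by
  constructor
  · intro hΨ x hx y hy η u θ hη hu hu1
    refine hΨ r x (ExteriorAlgebra.map (cyclesEquivKer S.P).symm.toLinearMap y) η u θ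
      (fun i hi => funext (hr.eq_zero i hi)) hr.add_of_ne (fun 𝔭 => ?_)
      hx.mem hx.eq_one (extPow_map _ hy) ?_ hu ?_
    · rw [S.euler_eq hr 𝔭]
      exact_mod_cast hr.add_one 𝔭
    · rw [← hη, ← AlgHom.comp_apply, ExteriorAlgebra.map_comp_map]
      rfl
    · rw [hu1, ← subtype_comp_cyclesEquivKer,
        ← ExteriorAlgebra.map_comp_map, AlgHom.comp_apply,
        ← AlgHom.comp_apply (ExteriorAlgebra.map (cyclesEquivKer S.P).toLinearMap),
        ExteriorAlgebra.map_comp_map, LinearEquiv.comp_symm, ExteriorAlgebra.map_id]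
      rfl
  · intro hΨ r' x y η u θ hr0 hr1 hr2 hx hx1 hy hη hu hu1
    obtain rfl : r' = r := by
      funext i 𝔭
      exact rank_unique (a := S.a) (b := S.b) (r := fun i => r' i 𝔭) (r' := fun i => r i 𝔭)
        (fun i hi => congrFun (hr0 i hi) 𝔭) (fun i hi => hr.eq_zero i hi 𝔭)
        (fun i hi => hr1 i hi 𝔭) (fun i hi => hr.add_of_ne i hi 𝔭) i
    refine hΨ x ⟨hx, hx1⟩ _ (extPow_map (cyclesEquivKer S.P).toLinearMap hy) η u θ ?_ hu ?_
    · rw [← hη, ← AlgHom.comp_apply, ExteriorAlgebra.map_comp_map, kerToH1_comp_cyclesEquivKer]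
    · rw [hu1, ← subtype_comp_cyclesEquivKer, ← ExteriorAlgebra.map_comp_map]
      rfl

theorem PerfectRep.isReflexiveHull_iff (hR : SerreTwo R)
    (h : CodimOneExact (X := fun i => S.P.X i) (fun i j => (S.P.d i j).hom) S.a S.b)
    (hr : RankData R (fun i => S.P.X i) S.a S.b r fun 𝔭 => (S.euler 𝔭).toNat)
    {Ψ : S.extH1 →ₗ[R] S.DetInv}
    (hΨ : haveI := S.finite; haveI := S.projective;
      IsCanonical (X := fun i => S.P.X i) (r := r) (fun i j => (S.P.d i j).hom) (kerToH1 S.φ) S.a S.b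
        (fun 𝔭 => (S.euler 𝔭).toNat) Ψ) :
    IsReflexiveHull Ψ ↔ IsPseudoNull R (Submodule.torsion R (C.homology 1)) := by
  have := S.quasiIso
  have := S.finite
  have := S.projective
  have hsurj := kerToH1_surjective S.φ
  have hker := kerToH1_eq_zero_iff S.φ
  rw [isPseudoNull_torsion_iff (X := fun i => S.P.X i) (d := fun i j => (S.P.d i j).hom)
    (d_d_apply S.P 0 1 2) hsurj hker]
  constructor
  · rintro ⟨-, -, hcok⟩ q hqp hq
    exact hΨ.h1TorsionFreeAt hr h hR hsurj q hq
      ((isPseudoNull_quotient_range_iff Ψ).1 hcok q hqp hq)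
  · intro hgood
    exact ⟨isReflexive_dual_detMod (X := fun i => S.P.X i) S.a S.b,
      hΨ.ker_eq_torsion hr h hR hsurj hker,
      (isPseudoNull_quotient_range_iff Ψ).2 fun q hqp hq =>
        hΨ.exists_smul_mem_range hr h hR hsurj hker q hq (hgood q hqp hq)⟩

end Perfect

end PerfectDet

theorem proposition2p3
    {Λ : Type v} {R : Type u} [CommRing Λ] [IsRegularLocalRing Λ] [CommRing R] [Algebra Λ R]
    [Module.Free Λ R] [Module.Finite Λ R]
    (hinj : Function.Injective (algebraMap Λ R))
    (hdual : PerfectDet.IsSelfDual Λ R)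
    (C : CochainComplex (ModuleCat.{u} R) ℤ) (S : PerfectDet.PerfectRep C)
    (hC : ∀ i : ℤ, i ≠ 1 → PerfectDet.IsPseudoNull R (C.homology i)) :
    (∀ 𝔭 : PrimeSpectrum R, 0 ≤ S.euler 𝔭) ∧
    ∃ Ψ : S.extH1 →ₗ[R] S.DetInv,
      (∀ Ψ' : S.extH1 →ₗ[R] S.DetInv, S.IsPsi Ψ' ↔ Ψ' = Ψ) ∧
      (PerfectDet.IsReflexiveHull Ψ ↔
        PerfectDet.IsPseudoNull R (Submodule.torsion R (C.homology 1))) := by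
  have hR : PerfectDet.SerreTwo R := PerfectDet.SerreTwo.of_regular (Λ := Λ)
  have hnoeth : IsNoetherianRing R := IsNoetherianRing.of_finite Λ R
  have := S.quasiIso
  have := S.finite
  have := S.projective
  have h := S.codimOneExact hC
  obtain ⟨r, l, hr⟩ := h.exists_rankData hR
  have hl : l = fun 𝔭 => (S.euler 𝔭).toNat := by
    funext 𝔭
    rw [S.euler_eq hr, Int.toNat_natCast]
  refine ⟨fun 𝔭 => by rw [S.euler_eq hr]; positivity, ?_⟩
  subst hl
  obtain ⟨Ψ, hΨ⟩ := hr.exists_isCanonical h hR (PerfectDet.kerToH1_surjective S.φ)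
    fun z => (PerfectDet.kerToH1_eq_zero_iff S.φ z).1
  refine ⟨Ψ, fun Ψ' => (S.isPsi_iff hr Ψ').trans ⟨fun h' => ?_, ?_⟩, S.isReflexiveHull_iff hR h hr hΨ⟩
  · exact hΨ.eq_of_hasExplicitFormula hr h hR (PerfectDet.kerToH1_surjective S.φ) h'
  · rintro rfl
    exact hΨ.hasExplicitFormula hr h hR
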